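/- **Setting.** For $a\in\mathbb R$ let $\lfloor a\rfloor$ denote the largest integer strictly smaller than $a$. Let $(x_t)_{t\ge1}$ be random vectors with values in a bounded convex set $\mathcal X\subset\mathbb R^{d_x}$, let $(\epsilon_t)_{t\ge 1}$ be real random variables on the same probability space, and let $R$ be a known $d_x\times d_z$ matrix of full column rank, $z_t=R'x_t$. Let $\mathcal H\subset(0,1)$ be a measurable set having $\tau_0$ in its interior. For $\tau\in\mathcal H$ let $\chi_\tau=(X,Z_{2\tau})$ be the $T\times(d_x+d_z)$ matrix whose $t$-th row is $(x_t',\ z_t'1\{t>\lfloor\tau T\rfloor\})$. The data are $Y=(y_1,\dots,y_T)'=\chi_{\tau_0}\gamma_0+(\epsilon_1,\dots,\epsilon_T)'$ and $x_1,\dots,x_T$, with $\gamma_0=(\beta_0',\delta_0')'$. Write $\mathbf D_T$ for the data and $P$ for their true law. Assume: (i) $\delta_0\neq0$. (ii) The $\epsilon_t$ are i.i.d. and square integrable and, conditionally on the covariates, have mean zero and variance $\sigma_0^2>0$ and are unpredictable from the past errors: $E(\epsilon_t\mid (x_s)_{s\ge1},\epsilon_1,\dots,\epsilon_{t-1})=0$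 and $E(\epsilon_t^2\mid (x_s)_{s\ge1},\epsilon_1,\dots,\epsilon_{t-1})=\sigma_0^2$. (iii) $\Sigma_X=E[x_tx_t']=\operatorname{plim}\frac1T\sum_{t=1}^Tx_tx_t'$ exists and is positive definite. (iv) For all $0<\tau_1<\tau_2<1$, $\frac1T\sum_{t=\lfloor\tau_1T\rfloor+1}^{\lfloor\tau_2T\rfloor}x_t\epsilon_t=O_p(T^{-1/2})$ and $\frac1T\sum_{t=\lfloor\tau_1T\rfloor+1}^{\lfloor\tau_2T\rfloor}x_tx_t'=(\tau_2-\tau_1)\Sigma_X+O_p(T^{-1/2})$. **Least squares.** Let $S_T(\tau)=\min_\gamma\|Y-\chi_\tau\gamma\|^2$, let $\hat\tau_{LS}$ be any minimizer of $S_T$ over $\mathcal H$, and let $\hat\gamma_{LS}$ be an ordinary least-squares estimate of $\gamma$ in the regression of $Y$ on $\chi_{\hat\tau_{LS}}$ (ties, and non-uniqueness when $\chi_{\hat\tau_{LS}}$ is rank deficient, are resolved arbitrarily). **Bayesian model.** The (possibly misspecified) likelihood is $\prod_{t=1}^T(2\pi\sigma^2)^{-1/2}\exp\{-(y_t-\chi_{\tau,t}'\gamma)^2/(2\sigma^2)\}$,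 with $\chi_{\tau,t}'$ the $t$-th row of $\chi_\tau$. A priori $\tau$ is independent of $(\gamma,\sigma^2)$. The prior of $(\gamma,\sigma^2)$ is either the conjugate prior $\gamma\mid\sigma^2\sim N(\underline\mu,\sigma^2\underline H^{-1})$, $\sigma^2\sim\mathrm{InvGamma}(\underline a,\underline b)$ with $\underline H$ positive definite and $\underline a,\underline b>0$, or its limiting case, the improper density $\pi(\gamma,\sigma^2)\propto\sigma^{-2}$; in this second case assume also $\mathcal H\subset[c,1-c]$ for some $c>0$. The prior of $\tau$ is any probability density $\pi$ on $\mathcal H$ that is bounded and bounded away from $0$ in some neighbourhood of $\tau_0$ (for example, a density that is finite on $\mathcal H$, and positive and continuous at $\tau_0$). Let $\pi[\,\cdot\mid\mathbf D_T]$ be the resulting posterior, with $\tau$ and $\sigma^2$ integrated out. **Theorem (Bernstein–von Mises theorem for the slope coefficients).** The limit in probability $V=\operatorname{plim}T^{-1}\chi_{\tau_0}'\chi_{\tau_0}$ exists and is positive definite, and $$d_{TV}\Big(\pi\big[\sqrt T(\gamma-\hat\gamma_{LS})\,\big|\,\mathbf D_T\big],\ N_{d_x+d_z}(0,\sigma_0^2V^{-1})\Big)\longrightarrow0\quad\text{in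 } P\text{-probability as }T\to\infty,$$ where $d_{TV}$ is the total variation distance. -/

import Mathlib

open MeasureTheory ProbabilityTheory Filter Topology

noncomputable section

namespace StructuralBreak

/-! Time is indexed from zero: `x i`, `ε i` stand for the covariate vector and the error of
observation number `i + 1`, so the sum over `t = m + 1, …, n` is a sum over `Finset.Ico m n`. -/

/-- The largest integer strictly smaller than `τ T` (for `τ > 0`, `T ≥ 1`): the number of
observations in the first regime. -/
def breakIndex (τ : ℝ) (T : ℕ) : ℕ := ⌈τ * T⌉₊ - 1

/-- The matrix `X` with rows `x_1', …, x_T'`. -/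
def regressors {dx : ℕ} (x : ℕ → EuclideanSpace ℝ (Fin dx)) (T : ℕ) :
    Matrix (Fin T) (Fin dx) ℝ :=
  Matrix.of fun i j => x i j

/-- The matrix `X_{2τ}`: the rows of the first regime are replaced by zero. -/
def lateRegressors {dx : ℕ} (x : ℕ → EuclideanSpace ℝ (Fin dx)) (T : ℕ) (τ : ℝ) :
    Matrix (Fin T) (Fin dx) ℝ :=
  Matrix.of fun i j => if breakIndex τ T ≤ (i : ℕ) then x i j else 0

/-- The design matrix `χ_τ = (X, Z_{2τ})`, where `Z_{2τ} = X_{2τ} R`. -/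
def design {dx dz : ℕ} (R : Matrix (Fin dx) (Fin dz) ℝ) (x : ℕ → EuclideanSpace ℝ (Fin dx))
    (T : ℕ) (τ : ℝ) : Matrix (Fin T) (Fin dx ⊕ Fin dz) ℝ :=
  Matrix.fromCols (regressors x T) (lateRegressors x T τ * R)

/-- The slope vector `γ = (β', δ')'`. -/
def slope {dx dz : ℕ} (β : EuclideanSpace ℝ (Fin dx)) (δ : EuclideanSpace ℝ (Fin dz)) :
    EuclideanSpace ℝ (Fin dx ⊕ Fin dz) :=
  WithLp.toLp 2 (Sum.elim (fun i => β i) (fun i => δ i))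

/-- The response vector `Y = χ_τ γ + ε`. -/
def response {dx dz : ℕ} (R : Matrix (Fin dx) (Fin dz) ℝ) (x : ℕ → EuclideanSpace ℝ (Fin dx))
    (e : ℕ → ℝ) (γ : EuclideanSpace ℝ (Fin dx ⊕ Fin dz)) (τ : ℝ) (T : ℕ) : Fin T → ℝ :=
  fun i => (design R x T τ).mulVec γ i + e i

/-! ### Least squares -/

/-- The sum of squares `‖Y - χ_τ γ‖²`. -/
def sumSq {dx dz : ℕ} (R : Matrix (Fin dx) (Fin dz) ℝ) (x : ℕ → EuclideanSpace ℝ (Fin dx))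
    (T : ℕ) (Y : Fin T → ℝ) (τ : ℝ) (γ : EuclideanSpace ℝ (Fin dx ⊕ Fin dz)) : ℝ :=
  ∑ i, (Y i - (design R x T τ).mulVec γ i) ^ 2

/-- The sum of squared residuals `S_T(τ)` of the regression of `Y` on `χ_τ`. -/
def residualSumSq {dx dz : ℕ} (R : Matrix (Fin dx) (Fin dz) ℝ)
    (x : ℕ → EuclideanSpace ℝ (Fin dx)) (T : ℕ) (Y : Fin T → ℝ) (τ : ℝ) : ℝ :=
  ⨅ γ, sumSq R x T Y τ γ

/-- `τ'` minimizes `S_T` over `H`, and `γ'` is an ordinary least-squares estimate of the slope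
given the break location `τ'` (the unique one when `χ_τ'` has full column rank). -/
def IsLeastSquares {dx dz : ℕ} (R : Matrix (Fin dx) (Fin dz) ℝ)
    (x : ℕ → EuclideanSpace ℝ (Fin dx)) (T : ℕ) (Y : Fin T → ℝ) (H : Set ℝ)
    (τ' : ℝ) (γ' : EuclideanSpace ℝ (Fin dx ⊕ Fin dz)) : Prop :=
  τ' ∈ H ∧ (∀ τ ∈ H, residualSumSq R x T Y τ' ≤ residualSumSq R x T Y τ) ∧
    ∀ γ, sumSq R x T Y τ' γ' ≤ sumSq R x T Y τ' γ

/-! ### Likelihood, prior, posterior -/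

/-- The normal likelihood `p(Y | X, γ, s, τ)`, where `s = σ²`. -/
def likelihood {dx dz : ℕ} (R : Matrix (Fin dx) (Fin dz) ℝ) (x : ℕ → EuclideanSpace ℝ (Fin dx))
    (T : ℕ) (Y : Fin T → ℝ) (τ s : ℝ) (γ : EuclideanSpace ℝ (Fin dx ⊕ Fin dz)) : ℝ :=
  ∏ i, (Real.sqrt (2 * Real.pi * s))⁻¹ *
    Real.exp (-(Y i - (design R x T τ).mulVec γ i) ^ 2 / (2 * s))

/-- The prior density of `(γ, s)`, `s = σ²`, up to a constant factor (which cancels in the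
posterior): `γ | s ∼ N(m, s H⁻¹)` and `s ∼ InvGamma(a, b)`. For `H = 0`, `a = -k/2`, `b = 0`
(`k` the number of coordinates of `γ`) it is the improper density `s⁻¹`. -/
def priorKernel {ι : Type*} [Fintype ι] (m : EuclideanSpace ℝ ι) (H : Matrix ι ι ℝ) (a b : ℝ)
    (s : ℝ) (γ : EuclideanSpace ℝ ι) : ℝ :=
  s ^ (-(Fintype.card ι : ℝ) / 2) *
      Real.exp (-((γ - m) ⬝ᵥ H.mulVec (γ - m)) / (2 * s)) *
    (s ^ (-a - 1) * Real.exp (-b / s))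

/-- The unnormalized marginal posterior of `γ`: likelihood times prior, with `s = σ²` and `τ`
integrated out; `p` is the prior density of `τ` on `H₀`. -/
def posteriorUnnorm {dx dz : ℕ} (R : Matrix (Fin dx) (Fin dz) ℝ)
    (x : ℕ → EuclideanSpace ℝ (Fin dx)) (T : ℕ) (Y : Fin T → ℝ)
    (m : EuclideanSpace ℝ (Fin dx ⊕ Fin dz)) (H : Matrix (Fin dx ⊕ Fin dz) (Fin dx ⊕ Fin dz) ℝ)
    (a b : ℝ) (H₀ : Set ℝ) (p : ℝ → ℝ) : Measure (EuclideanSpace ℝ (Fin dx ⊕ Fin dz)) :=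
  volume.withDensity fun γ => ∫⁻ τ in H₀, ∫⁻ s in Set.Ioi 0,
    ENNReal.ofReal (likelihood R x T Y τ s γ * (priorKernel m H a b s γ * p τ))

/-- The marginal posterior distribution of `γ` given the data. (Where the total mass is not a
positive finite number, this is the zero measure, not a probability measure.) -/
def posterior {dx dz : ℕ} (R : Matrix (Fin dx) (Fin dz) ℝ)
    (x : ℕ → EuclideanSpace ℝ (Fin dx)) (T : ℕ) (Y : Fin T → ℝ)
    (m : EuclideanSpace ℝ (Fin dx ⊕ Fin dz)) (H : Matrix (Fin dx ⊕ Fin dz) (Fin dx ⊕ Fin dz) ℝ)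
    (a b : ℝ) (H₀ : Set ℝ) (p : ℝ → ℝ) : Measure (EuclideanSpace ℝ (Fin dx ⊕ Fin dz)) :=
  (posteriorUnnorm R x T Y m H a b H₀ p Set.univ)⁻¹ • posteriorUnnorm R x T Y m H a b H₀ p

/-- The distribution of `√T (γ - c)` when `γ` has distribution `ν`. -/
def rescale {ι : Type*} [Fintype ι] (T : ℕ) (c : EuclideanSpace ℝ ι)
    (ν : Measure (EuclideanSpace ℝ ι)) : Measure (EuclideanSpace ℝ ι) :=
  ν.map fun γ => Real.sqrt T • (γ - c)

/-- Total variation distance `sup_A |ν₁ A - ν₂ A|`. -/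
def tvDist {E : Type*} [MeasurableSpace E] (ν₁ ν₂ : Measure E) : ℝ :=
  ⨆ A : {A : Set E // MeasurableSet A}, |ν₁.real A - ν₂.real A|

/-! ### Assumptions on the data-generating process and on the prior -/

/-- `Z_T = O_p(r_T)`. -/
def IsBigOInProb {Ω : Type*} [MeasurableSpace Ω] (P : Measure Ω) (Z : ℕ → Ω → ℝ) (r : ℕ → ℝ) :
    Prop :=
  ∀ η : ℝ, 0 < η → ∃ M : ℝ, ∀ᶠ T in atTop, P {ω | M * r T < |Z T ω|} ≤ ENNReal.ofReal η

/-- The information given by all covariates and by the errors before time `t`. -/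
@[reducible] def covariatesAndPast {Ω : Type*} {dx : ℕ} (x : ℕ → Ω → EuclideanSpace ℝ (Fin dx))
    (ε : ℕ → Ω → ℝ) (t : ℕ) : MeasurableSpace Ω :=
  (⨆ s : ℕ, MeasurableSpace.comap (x s) inferInstance) ⊔
    ⨆ s ∈ Set.Iio t, MeasurableSpace.comap (ε s) inferInstance

/-- The assumptions on covariates, errors and jump size: bounded covariates, nonzero jump `δ₀`,
i.i.d. errors which, conditionally on the covariates, are unpredictable with variance `σ₀²`, and
the limit behaviour of partial sums, with `SigmaX = E[x_t x_t']`. -/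
structure DGPAssumptions {Ω : Type*} [MeasurableSpace Ω] (P : Measure Ω) {dx dz : ℕ}
    (x : ℕ → Ω → EuclideanSpace ℝ (Fin dx)) (ε : ℕ → Ω → ℝ)
    (δ₀ : EuclideanSpace ℝ (Fin dz)) (σ₀ : ℝ) (SigmaX : Matrix (Fin dx) (Fin dx) ℝ) : Prop where
  measurable_x : ∀ t, Measurable (x t)
  measurable_ε : ∀ t, Measurable (ε t)
  bounded_x : ∃ S : Set (EuclideanSpace ℝ (Fin dx)),
    Convex ℝ S ∧ Bornology.IsBounded S ∧ ∀ t ω, x t ω ∈ S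
  jump_ne_zero : δ₀ ≠ 0
  indep : iIndepFun ε P
  identDistrib : ∀ t, IdentDistrib (ε t) (ε 0) P P
  memLp : ∀ t, MemLp (ε t) 2 P
  condMean : ∀ t, P[ε t | covariatesAndPast x ε t] =ᵐ[P] fun _ => 0
  condVar : ∀ t, P[fun ω => ε t ω ^ 2 | covariatesAndPast x ε t] =ᵐ[P] fun _ => σ₀ ^ 2
  secondMoment : ∀ t i j, ∫ ω, x t ω i * x t ω j ∂P = SigmaX i j
  plim : ∀ i j, TendstoInMeasure P
    (fun (T : ℕ) ω => (T : ℝ)⁻¹ * ∑ t ∈ Finset.range T, x t ω i * x t ω j) atTop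
    (fun _ => SigmaX i j)
  posDef : SigmaX.PosDef
  score : ∀ τ₁ τ₂ : ℝ, 0 < τ₁ → τ₁ < τ₂ → τ₂ < 1 → ∀ i, IsBigOInProb P
    (fun T ω => (T : ℝ)⁻¹ *
      ∑ t ∈ Finset.Ico (breakIndex τ₁ T) (breakIndex τ₂ T), x t ω i * ε t ω)
    (fun T => (Real.sqrt T)⁻¹)
  gram : ∀ τ₁ τ₂ : ℝ, 0 < τ₁ → τ₁ < τ₂ → τ₂ < 1 → ∀ i j, IsBigOInProb P
    (fun T ω => (T : ℝ)⁻¹ *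
      (∑ t ∈ Finset.Ico (breakIndex τ₁ T) (breakIndex τ₂ T), x t ω i * x t ω j) -
        (τ₂ - τ₁) * SigmaX i j)
    (fun T => (Real.sqrt T)⁻¹)

/-- The prior on `(γ, σ²)` is a (proper) normal-inverse-gamma distribution, or it is the
noninformative improper prior; in the latter case the candidate break locations stay away from
`0` and `1`, because otherwise the posterior cannot be normalized. -/
def ConjugatePrior {ι : Type*} [Fintype ι] (H : Matrix ι ι ℝ) (a b : ℝ) (H₀ : Set ℝ) : Prop :=
  (H.PosDef ∧ 0 < a ∧ 0 < b) ∨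
    (H = 0 ∧ a = -(Fintype.card ι : ℝ) / 2 ∧ b = 0 ∧ ∃ c : ℝ, 0 < c ∧ H₀ ⊆ Set.Icc c (1 - c))

/-- `p` is a probability density on `H₀` that lies between two positive constants near `τ₀`. -/
structure BreakPrior (H₀ : Set ℝ) (p : ℝ → ℝ) (τ₀ : ℝ) : Prop where
  measurable : Measurable p
  nonneg : ∀ τ, 0 ≤ p τ
  lintegral_eq_one : ∫⁻ τ in H₀, ENNReal.ofReal (p τ) = 1
  near : ∃ c C : ℝ, 0 < c ∧ ∀ᶠ τ in 𝓝 τ₀, c ≤ p τ ∧ p τ ≤ C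

end StructuralBreak

end

noncomputable section
namespace StructuralBreak
open scoped RealInnerProductSpace

/-! ### Convergence in total variation from convergence of densities -/

/-! The likelihood depends on `τ` only through the break index `k`, so the posterior of `γ` is a
finite mixture over `k`, weighted by the prior masses of the cells on which the index is constant.
Integrating out the variance turns the component of `k` into a multiple of `energy ^ (-α)`, where
the energy is `b` plus half the sum of squares (likelihood and prior) and `α ~ T / 2`: a
multivariate Student kernel. Its centre is a generalized least-squares estimate given `k`. Two
things must be shown: components with `k` close to the true break `k₀` are all asymptotically the
same Gaussian around the least-squares estimate, and the other components carry no mass.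

Closeness is measured by signal, not by time. With `D` the jump of the regime coefficients, let `q`
be the sum of `⟪x_t, D⟫²` over the observations between `k` and `k₀`; call `k` near if `q < T^0.35`
and far otherwise.

Far breaks. Using the wrong regime on the window costs a fixed fraction of `q`, while fitting noise
gains much less: squared scores over `T` are of order `T^0.1`, and the score on the window is below
`T^0.325` for windows of length about `T^0.6`, or below `2 T^0.55` for longer ones, where the signal
is already of order `T^0.6`. So the residual sum of squares exceeds that of the truth by `c T^0.35`
for every slope (`residual_ge_of_far`). Raised to the power `-α`, this is a factor `exp(-c'
T^0.35)`, which beats the polynomial factors that come from the volume of a small ball around the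
true slope and from the prior weight of order `1 / T` of the true index (`tendsto_far_ratio`). The
least-squares break is never far, since its residual sum of squares is at most that of the truth
(`near_of_rss_le`).

Near breaks. The window has length `O(T^0.6)`, so by Cauchy–Schwarz the score moves by `O(T^((0.6 +
0.35) / 2)) = O(T^0.475)`, the centre by `o(T^(-1/2))` (`estimates_equivalent`), and the normalized
Gram operator and residual variance keep their limits. The rescaled component is thus a Student
kernel with exponent tending to infinity, centre tending to `0` and precision tending to `V / σ₀²`;
Scheffé-type dominated convergence gives total variation convergence
(`conditional_posterior_tendsto`). Applying this along every selection of near breaks makes it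
uniform, and `mixture_tendsto` combines the two regimes.

Probability enters only through `RegularSample`, deterministic properties that hold with probability
tending to one; the filter `inProb` turns this phrase into an ordinary `Eventually`. Scores are
bounded by Kolmogorov's maximal inequality. The delicate property is that windows of length `T^0.6`
next to `k₀` carry signal of that order, although the Gram assumption concerns fixed fractions of
the sample: it follows by comparing the true break indices of the two sample sizes `T` and `T ±
T^0.6` through a third index, found by averaging (`eventually_gramExcess_sub_le_of_size`). -/

theorem tendsto_tv_of_dominated {κ E : Type*} [MeasurableSpace E] {μ : Measure E} {l : Filter κ}
    [l.IsCountablyGenerated] {g : κ → E → ℝ} {g₀ bound : E → ℝ}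
    (hmeas : ∀ᶠ j in l, AEStronglyMeasurable (g j) μ) (hg₀ : Integrable g₀ μ)
    (hg₀nn : ∀ θ, 0 ≤ g₀ θ) (hbound : Integrable bound μ)
    (hle : ∀ᶠ j in l, ∀ θ, |g j θ| ≤ bound θ)
    (hlim : ∀ θ, Tendsto (fun j => g j θ) l (𝓝 (g₀ θ))) (hpos : 0 < ∫ θ, g₀ θ ∂μ)
    {η : ℝ} (hη : 0 < η) :
    ∀ᶠ j in l, ∀ A : Set E,
      |(∫ θ in A, g j θ ∂μ) / (∫ θ, g j θ ∂μ) - (∫ θ in A, g₀ θ ∂μ) / ∫ θ, g₀ θ ∂μ| ≤ η := by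
  have hd : Tendsto (fun j => ∫ θ, |g j θ - g₀ θ| ∂μ) l (𝓝 0) := by
    have : Tendsto (fun j => ∫ θ, |g j θ - g₀ θ| ∂μ) l (𝓝 (∫ θ, (0 : ℝ) ∂μ)) := by
      refine tendsto_integral_filter_of_dominated_convergence (fun θ => bound θ + g₀ θ) ?_ ?_
        (hbound.add hg₀) ?_
      · filter_upwards [hmeas] with j hj
        exact (hj.sub hg₀.aestronglyMeasurable).norm
      · filter_upwards [hle] with j hj
        refine Eventually.of_forall fun θ => ?_
        rw [Real.norm_eq_abs, abs_abs]
        calc |g j θ - g₀ θ| ≤ |g j θ| + |g₀ θ| := abs_sub _ _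
          _ ≤ _ := by rw [abs_of_nonneg (hg₀nn θ)]; gcongr; exact hj θ
      · refine Eventually.of_forall fun θ => ?_
        have := ((hlim θ).sub_const (g₀ θ)).abs
        simpa using this
    simpa using this
  set c₀ := ∫ θ, g₀ θ ∂μ with hc₀
  -- The first threshold keeps the normalizing constant `c` above `c₀ / 2`; the second then makes `2
  -- * δ / c ≤ η`.
  have hlt : ∀ᶠ j in l, ∫ θ, |g j θ - g₀ θ| ∂μ < min (c₀ / 2) (η * c₀ / 4) :=
    hd.eventually (gt_mem_nhds (by positivity))
  filter_upwards [hlt, hmeas, hle] with j hj hmj hlej A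
  have hint : Integrable (g j) μ :=
    hbound.mono' hmj (Eventually.of_forall fun θ => hlej θ)
  set δ := ∫ θ, |g j θ - g₀ θ| ∂μ with hδ
  have hδA : ∀ B : Set E, |(∫ θ in B, g j θ ∂μ) - ∫ θ in B, g₀ θ ∂μ| ≤ δ := by
    intro B
    rw [← integral_sub hint.integrableOn hg₀.integrableOn]
    calc |∫ θ in B, (g j θ - g₀ θ) ∂μ| ≤ ∫ θ in B, |g j θ - g₀ θ| ∂μ :=
          abs_integral_le_integral_abs
      _ ≤ δ := setIntegral_le_integral (hint.sub hg₀).abs (Eventually.of_forall fun θ => abs_nonneg _)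
  have hc := hδA Set.univ
  simp only [setIntegral_univ] at hc
  set c := ∫ θ, g j θ ∂μ
  have h1 : δ < c₀ / 2 := hj.trans_le (min_le_left _ _)
  have h2 : δ < η * c₀ / 4 := hj.trans_le (min_le_right _ _)
  have hcpos : c₀ / 2 < c := by have := (abs_le.1 hc).1; linarith
  have hcpos' : 0 < c := by linarith
  have hA := hδA A
  set u := ∫ θ in A, g j θ ∂μ
  set v := ∫ θ in A, g₀ θ ∂μ
  have hv0 : 0 ≤ v := integral_nonneg hg₀nn
  have hv1 : v ≤ c₀ := setIntegral_le_integral hg₀ (Eventually.of_forall hg₀nn)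
  -- Error of the numerator plus error of the normalization; each is at most `δ / c`, whatever the
  -- set `A`.
  have key : u / c - v / c₀ = (u - v) / c + v / c₀ * ((c₀ - c) / c) := by
    field_simp; ring
  rw [key]
  calc |(u - v) / c + v / c₀ * ((c₀ - c) / c)| ≤ |(u - v) / c| + |v / c₀ * ((c₀ - c) / c)| :=
        abs_add_le _ _
    _ = |u - v| / c + v / c₀ * (|c - c₀| / c) := by
        rw [abs_div, abs_mul, abs_div, abs_div, abs_of_pos hcpos', abs_of_pos hpos,
          abs_of_nonneg hv0, abs_sub_comm c₀ c]
    _ ≤ δ / c + 1 * (δ / c) := by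
        gcongr
        exact div_le_one_of_le₀ hv1 hpos.le
    _ ≤ η := by
        rw [one_mul, ← add_div, div_le_iff₀ hcpos']
        nlinarith

variable {E : Type*} [NormedAddCommGroup E] [InnerProductSpace ℝ E] [FiniteDimensional ℝ E]
  [MeasurableSpace E] [BorelSpace E]

/-- The kernel of a multivariate Student density, which tends to a Gaussian kernel. -/
def studentKernel (Q : E →L[ℝ] E) (h : E) (α : ℝ) (θ : E) : ℝ :=
  (1 + ⟪Q (θ - h), θ - h⟫ / (2 * α)) ^ (-α)

/-- Bernoulli's inequality with exponent `α / α₀ ≥ 1`. Tails of Student kernels get lighter as `α`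
grows, so one kernel dominates all later ones. -/
theorem one_add_div_rpow_neg_le {u α α₀ : ℝ} (hu : 0 ≤ u) (h0 : 0 < α₀) (h : α₀ ≤ α) :
    (1 + u / α) ^ (-α) ≤ (1 + u / α₀) ^ (-α₀) := by
  have hα : 0 < α := h0.trans_le h
  rw [Real.rpow_neg (by positivity), Real.rpow_neg (by positivity)]
  gcongr
  have hb := one_add_mul_self_le_rpow_one_add (s := u / α) (p := α / α₀)
    (by have : 0 ≤ u / α := by positivity
        linarith) (by rwa [one_le_div h0])
  have : α / α₀ * (u / α) = u / α₀ := by field_simp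
  rw [this] at hb
  calc (1 + u / α₀) ^ α₀ ≤ ((1 + u / α) ^ (α / α₀)) ^ α₀ := by gcongr
    _ = (1 + u / α) ^ α := by
        rw [← Real.rpow_mul (by positivity)]; congr 1; field_simp

theorem eventually_one_add_pos {κ : Type*} {l : Filter κ} {α f : κ → ℝ} {t : ℝ}
    (hα : Tendsto α l atTop) (hf : Tendsto (fun j => α j * f j) l (𝓝 t)) :
    ∀ᶠ j in l, 0 < 1 + f j := by
  have := (hf.mul (tendsto_inv_atTop_zero.comp hα)).const_add 1
  simp only [mul_zero, add_zero] at this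
  filter_upwards [this.eventually (lt_mem_nhds zero_lt_one), hα.eventually_gt_atTop 0] with j hj hj'
  simp only [Function.comp] at hj
  field_simp at hj
  exact hj

/-- The logarithm is squeezed by `1 - x⁻¹ ≤ log x ≤ x - 1`. No sign of `f` is needed, since `f`
tends to `0`. -/
theorem tendsto_one_add_rpow_exp {κ : Type*} {l : Filter κ} {α f : κ → ℝ} {t : ℝ}
    (hα : Tendsto α l atTop) (hf : Tendsto (fun j => α j * f j) l (𝓝 t)) :
    Tendsto (fun j => (1 + f j) ^ α j) l (𝓝 (Real.exp t)) := by
  have hpos := eventually_one_add_pos hα hf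
  have hf0 : Tendsto (fun j => 1 + f j) l (𝓝 1) := by
    have := (hf.mul (tendsto_inv_atTop_zero.comp hα)).const_add 1
    simp only [mul_zero, add_zero] at this
    refine this.congr' ?_
    filter_upwards [hα.eventually_gt_atTop 0] with j hj
    simp only [Function.comp]
    field_simp
  have hlog : Tendsto (fun j => Real.log (1 + f j) * α j) l (𝓝 t) := by
    have hlow : Tendsto (fun j => α j * f j * (1 + f j)⁻¹) l (𝓝 t) := by
      simpa using hf.mul (hf0.inv₀ one_ne_zero)
    refine tendsto_of_tendsto_of_tendsto_of_le_of_le' hlow hf ?_ ?_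
    · filter_upwards [hpos, hα.eventually_gt_atTop 0] with j hj hj'
      have h1 := Real.one_sub_inv_le_log_of_pos hj
      calc α j * f j * (1 + f j)⁻¹ = (1 - (1 + f j)⁻¹) * α j := by field_simp; ring
        _ ≤ _ := by gcongr
    · filter_upwards [hpos, hα.eventually_gt_atTop 0] with j hj hj'
      have h1 := Real.log_le_sub_one_of_pos hj
      rw [mul_comm]
      gcongr; linarith
  refine ((Real.continuous_exp.tendsto t).comp hlog).congr' ?_
  filter_upwards [hpos] with j hj
  rw [Real.rpow_def_of_pos hj]; rfl

omit [FiniteDimensional ℝ E] [MeasurableSpace E] [BorelSpace E] in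
theorem tendsto_studentKernel {Q : E →L[ℝ] E} (θ : E) :
    Tendsto (fun j : (E →L[ℝ] E) × E × ℝ => studentKernel j.1 j.2.1 j.2.2 θ)
      (𝓝 Q ×ˢ 𝓝 0 ×ˢ atTop) (𝓝 (Real.exp (-⟪Q θ, θ⟫ / 2))) := by
  set l : Filter ((E →L[ℝ] E) × E × ℝ) := 𝓝 Q ×ˢ 𝓝 0 ×ˢ atTop
  have hQ : Tendsto (fun j : (E →L[ℝ] E) × E × ℝ => j.1) l (𝓝 Q) := tendsto_fst
  have hh : Tendsto (fun j : (E →L[ℝ] E) × E × ℝ => j.2.1) l (𝓝 0) := tendsto_fst.comp tendsto_snd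
  have hα : Tendsto (fun j : (E →L[ℝ] E) × E × ℝ => j.2.2) l atTop := tendsto_snd.comp tendsto_snd
  have hsub : Tendsto (fun j : (E →L[ℝ] E) × E × ℝ => θ - j.2.1) l (𝓝 θ) := by
    simpa using hh.const_sub θ
  have hu : Tendsto (fun j : (E →L[ℝ] E) × E × ℝ => ⟪j.1 (θ - j.2.1), θ - j.2.1⟫ / 2) l
      (𝓝 (⟪Q θ, θ⟫ / 2)) := (((isBoundedBilinearMap_apply.continuous.tendsto (Q, θ)).comp
      (hQ.prodMk_nhds hsub)).inner hsub).div_const 2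
  have hmul : Tendsto (fun j : (E →L[ℝ] E) × E × ℝ =>
      j.2.2 * (⟪j.1 (θ - j.2.1), θ - j.2.1⟫ / (2 * j.2.2))) l (𝓝 (⟪Q θ, θ⟫ / 2)) := by
    refine hu.congr' ?_
    filter_upwards [hα.eventually_gt_atTop 0] with j hj
    field_simp
  have hmain := (tendsto_one_add_rpow_exp hα hmul).inv₀ (Real.exp_ne_zero _)
  rw [← Real.exp_neg, ← neg_div] at hmain
  refine hmain.congr' ?_
  filter_upwards [eventually_one_add_pos hα hmul] with j hj
  rw [studentKernel, Real.rpow_neg hj.le]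

/-- The exponent `dim + 1` gives decay of order `‖θ‖ ^ (-2 (dim + 1))`, which is integrable; larger
exponents are handled by monotonicity, and a centre in the unit ball only changes constants. -/
theorem exists_integrable_studentKernel_bound {c : ℝ} (hc : 0 < c) :
    ∃ bound : E → ℝ, Integrable bound ∧ ∀ (Q : E →L[ℝ] E) (h : E) (α : ℝ),
      (∀ u, c * ‖u‖ ^ 2 ≤ ⟪Q u, u⟫) → ‖h‖ ≤ 1 → Module.finrank ℝ E + 1 ≤ α →
      ∀ θ, 0 ≤ studentKernel Q h α θ ∧ studentKernel Q h α θ ≤ bound θ := by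
  set α₀ : ℝ := Module.finrank ℝ E + 1 with hα₀
  have hα₀pos : 0 < α₀ := by positivity
  -- Chosen to dominate `(2 + s)² ≤ 8 + 2 s²` term by term: `8` for the constant, `4 α₀ / c` for the
  -- quadratic part.
  set K : ℝ := max 8 (4 * α₀ / c) with hK
  have hK0 : 0 < K := lt_of_lt_of_le (by norm_num) (le_max_left _ _)
  refine ⟨fun θ => K ^ α₀ * (1 + ‖θ‖) ^ (-(2 * α₀)), ?_, ?_⟩
  · refine (integrable_one_add_norm ?_).const_mul _
    rw [hα₀]; have : (0 : ℝ) ≤ Module.finrank ℝ E := by positivity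
    linarith
  · intro Q h α hQ hh hα θ
    have hαpos : 0 < α := hα₀pos.trans_le hα
    have hw : 0 ≤ ⟪Q (θ - h), θ - h⟫ := le_trans (by positivity) (hQ (θ - h))
    refine ⟨Real.rpow_nonneg (by positivity) _, ?_⟩
    have h1 : studentKernel Q h α θ ≤ (1 + ⟪Q (θ - h), θ - h⟫ / 2 / α₀) ^ (-α₀) := by
      rw [studentKernel, ← div_div]
      exact one_add_div_rpow_neg_le (by positivity) hα₀pos hα
    refine h1.trans ?_
    set s := ‖θ - h‖ with hs
    have hθ : 1 + ‖θ‖ ≤ 2 + s := by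
      have : ‖θ‖ ≤ ‖θ - h‖ + ‖h‖ := by simpa using norm_add_le (θ - h) h
      linarith
    have hK8 : 8 ≤ K := le_max_left _ _
    have hKc : 4 * α₀ ≤ K * c := by
      have := le_max_right 8 (4 * α₀ / c)
      rwa [← hK, div_le_iff₀ hc] at this
    have h2 : (1 + ‖θ‖) ^ 2 ≤ K * (1 + ⟪Q (θ - h), θ - h⟫ / 2 / α₀) := by
      have h3 : (1 + ‖θ‖) ^ 2 ≤ (2 + s) ^ 2 := by gcongr
      have h4 : (2 + s) ^ 2 ≤ 8 + 2 * s ^ 2 := by nlinarith [sq_nonneg (s - 2)]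
      have h5 : 2 * s ^ 2 ≤ K * (⟪Q (θ - h), θ - h⟫ / 2 / α₀) := by
        rw [div_div, ← mul_div_assoc, le_div_iff₀ (by positivity)]
        have := mul_le_mul_of_nonneg_left (hQ (θ - h)) hK0.le
        nlinarith [sq_nonneg s]
      linarith
    have h6 : (1 + ‖θ‖) ^ 2 / K ≤ 1 + ⟪Q (θ - h), θ - h⟫ / 2 / α₀ := by
      rwa [div_le_iff₀' hK0]
    calc (1 + ⟪Q (θ - h), θ - h⟫ / 2 / α₀) ^ (-α₀) ≤ ((1 + ‖θ‖) ^ 2 / K) ^ (-α₀) :=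
          Real.rpow_le_rpow_of_nonpos (by positivity) h6 (by linarith)
      _ = K ^ α₀ * (1 + ‖θ‖) ^ (-(2 * α₀)) := by
          rw [Real.div_rpow (by positivity) hK0.le, Real.rpow_neg hK0.le, div_inv_eq_mul, mul_comm,
            ← Real.rpow_natCast, ← Real.rpow_mul (by positivity)]
          congr 2; push_cast; ring

theorem measurable_studentKernel (Q : E →L[ℝ] E) (h : E) (α : ℝ) :
    Measurable (studentKernel Q h α) := by
  unfold studentKernel
  fun_prop

omit [FiniteDimensional ℝ E] [MeasurableSpace E] [BorelSpace E] in
theorem eventually_coercive {Q : E →L[ℝ] E} {c : ℝ} (hc : 0 < c)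
    (hQ : ∀ u, c * ‖u‖ ^ 2 ≤ ⟪Q u, u⟫) :
    ∀ᶠ Q' in 𝓝 Q, ∀ u, c / 2 * ‖u‖ ^ 2 ≤ ⟪Q' u, u⟫ := by
  filter_upwards [Metric.ball_mem_nhds Q (half_pos hc)] with Q' hQ' u
  rw [Metric.mem_ball, dist_eq_norm] at hQ'
  have h1 : |⟪(Q' - Q) u, u⟫| ≤ c / 2 * ‖u‖ ^ 2 := by
    calc |⟪(Q' - Q) u, u⟫| ≤ ‖(Q' - Q) u‖ * ‖u‖ := abs_real_inner_le_norm _ _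
      _ ≤ ‖Q' - Q‖ * ‖u‖ * ‖u‖ := by gcongr; exact (Q' - Q).le_opNorm u
      _ ≤ c / 2 * ‖u‖ * ‖u‖ := by gcongr
      _ = _ := by ring
  have h2 : ⟪Q' u, u⟫ = ⟪Q u, u⟫ + ⟪(Q' - Q) u, u⟫ := by
    rw [← inner_add_left]; simp
  have := (abs_le.1 h1).1
  linarith [hQ u]

/-- Student kernels converge in total variation, after normalization, to the Gaussian kernel. -/
theorem studentKernel_tendsto_tv {Q : E →L[ℝ] E} {c : ℝ} (hc : 0 < c)
    (hQ : ∀ u, c * ‖u‖ ^ 2 ≤ ⟪Q u, u⟫) {η : ℝ} (hη : 0 < η) :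
    ∀ᶠ j : (E →L[ℝ] E) × E × ℝ in 𝓝 Q ×ˢ 𝓝 0 ×ˢ atTop, ∀ A : Set E,
      |(∫ θ in A, studentKernel j.1 j.2.1 j.2.2 θ) / (∫ θ, studentKernel j.1 j.2.1 j.2.2 θ) -
        (∫ θ in A, Real.exp (-⟪Q θ, θ⟫ / 2)) / ∫ θ, Real.exp (-⟪Q θ, θ⟫ / 2)| ≤ η := by
  obtain ⟨bound, hb, hbound⟩ := exists_integrable_studentKernel_bound (E := E) (half_pos hc)
  set l : Filter ((E →L[ℝ] E) × E × ℝ) := 𝓝 Q ×ˢ 𝓝 0 ×ˢ atTop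
  have hev : ∀ᶠ j : (E →L[ℝ] E) × E × ℝ in l, ∀ θ, 0 ≤ studentKernel j.1 j.2.1 j.2.2 θ ∧
      studentKernel j.1 j.2.1 j.2.2 θ ≤ bound θ := by
    have h1 : ∀ᶠ j : (E →L[ℝ] E) × E × ℝ in l, ∀ u, c / 2 * ‖u‖ ^ 2 ≤ ⟪j.1 u, u⟫ :=
      tendsto_fst.eventually (eventually_coercive hc hQ)
    have h2 : ∀ᶠ j : (E →L[ℝ] E) × E × ℝ in l, ‖j.2.1‖ < 1 := by
      have : Tendsto (fun j : (E →L[ℝ] E) × E × ℝ => ‖j.2.1‖) l (𝓝 0) := by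
        simpa using (tendsto_fst.comp tendsto_snd :
          Tendsto (fun j : (E →L[ℝ] E) × E × ℝ => j.2.1) l (𝓝 0)).norm
      exact this.eventually (gt_mem_nhds one_pos)
    have h3 : ∀ᶠ j : (E →L[ℝ] E) × E × ℝ in l, (Module.finrank ℝ E + 1 : ℝ) ≤ j.2.2 :=
      (tendsto_snd.comp tendsto_snd : Tendsto (fun j : (E →L[ℝ] E) × E × ℝ => j.2.2) l atTop)
        |>.eventually_ge_atTop _
    filter_upwards [h1, h2, h3] with j hj1 hj2 hj3 θ using hbound _ _ _ hj1 hj2.le hj3 θ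
  have hmg : Measurable fun θ : E => Real.exp (-⟪Q θ, θ⟫ / 2) := by fun_prop
  have hg : Integrable fun θ : E => Real.exp (-⟪Q θ, θ⟫ / 2) := by
    refine hb.mono' hmg.aestronglyMeasurable (Eventually.of_forall fun θ => ?_)
    rw [Real.norm_of_nonneg (Real.exp_pos _).le]
    exact le_of_tendsto (tendsto_studentKernel θ) (hev.mono fun j hj => (hj θ).2)
  -- Dominated convergence needs a countably generated filter. The filter of the parameters is one;
  -- random samples enter later, by composing with it.
  refine tendsto_tv_of_dominated (l := l)
    (Eventually.of_forall fun j => (measurable_studentKernel _ _ _).aestronglyMeasurable)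
    hg (fun θ => (Real.exp_pos _).le) hb ?_ (fun θ => tendsto_studentKernel θ) ?_ hη
  · filter_upwards [hev] with j hj θ
    rw [abs_of_nonneg (hj θ).1]; exact (hj θ).2
  · exact integral_exp_pos hg

/-! ### The density of a Gaussian measure -/

/-- The normalized density and the standard Gaussian have the same characteristic function, by the
Fourier integral of `exp (-‖θ‖² / 2)`; the same integral at frequency zero gives the normalizing
constant. -/
theorem stdGaussian_real_eq (A : Set E) (hA : MeasurableSet A) :
    (stdGaussian E).real A =
      (∫ θ in A, Real.exp (-‖θ‖ ^ 2 / 2)) / ∫ θ : E, Real.exp (-‖θ‖ ^ 2 / 2) := by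
  set g : E → ℝ := fun θ => Real.exp (-‖θ‖ ^ 2 / 2) with hg
  have hgm : Measurable g := by fun_prop
  have hgi : Integrable g := by
    have := (GaussianFourier.integrable_cexp_neg_mul_sq_norm_add (V := E) (b := 1 / 2)
      (by norm_num) 0 0).norm
    refine this.congr (Eventually.of_forall fun θ => ?_)
    simp only [zero_mul, add_zero, hg, Complex.norm_exp]
    congr 1
    rw [← Complex.ofReal_pow, show (-(1 / 2) : ℂ) = ((-(1 / 2) : ℝ) : ℂ) by push_cast; ring,
      ← Complex.ofReal_mul, Complex.ofReal_re]
    ring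
  set Z := ∫ θ, g θ with hZ
  have hZpos : 0 < Z := integral_exp_pos hgi
  set ν : Measure E := (volume : Measure E).withDensity fun θ => ENNReal.ofReal (g θ / Z) with hν
  have hνreal : ∀ B, MeasurableSet B → ν B = ENNReal.ofReal ((∫ θ in B, g θ) / Z) := by
    intro B hB
    rw [hν, withDensity_apply _ hB, ← ofReal_integral_eq_lintegral_ofReal
      (hgi.div_const _).integrableOn (Eventually.of_forall fun θ => by positivity), integral_div]
  have : IsProbabilityMeasure ν := ⟨by rw [hνreal _ MeasurableSet.univ]; simp [← hZ, hZpos.ne']⟩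
  have heq : ν = stdGaussian E := by
    refine Measure.ext_of_charFun ?_
    ext t
    rw [charFun_stdGaussian, charFun_apply, hν,
      integral_withDensity_eq_integral_toReal_smul (by fun_prop) (by simp)]
    have hstd := GaussianFourier.integral_cexp_neg_mul_sq_norm_add (V := E) (b := 1 / 2)
      (by norm_num) Complex.I t
    have hstd0 := GaussianFourier.integral_cexp_neg_mul_sq_norm_add (V := E) (b := 1 / 2)
      (by norm_num) 0 0
    have hZc : (Z : ℂ) = ((Real.pi : ℂ) / (1 / 2)) ^ (Module.finrank ℝ E / 2 : ℂ) := by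
      rw [hZ, ← integral_complex_ofReal]
      simp only [zero_mul, add_zero] at hstd0
      simp only [norm_zero] at hstd0
      norm_num at hstd0
      norm_num
      rw [← hstd0]
      congr 1; ext θ; simp only [hg]; push_cast; congr 1; ring
    calc ∫ θ, (ENNReal.ofReal (g θ / Z)).toReal • Complex.exp (⟪θ, t⟫ * Complex.I)
        = ∫ θ, (Z : ℂ)⁻¹ * Complex.exp (-(1 / 2) * ‖θ‖ ^ 2 + Complex.I * ⟪t, θ⟫) := by
          congr 1; ext θ
          rw [ENNReal.toReal_ofReal (by positivity), Complex.real_smul, Complex.exp_add,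
            real_inner_comm]
          simp only [hg]; push_cast
          rw [div_eq_inv_mul, mul_assoc]; congr 3
          · ring
          · ring
      _ = _ := by
          rw [integral_const_mul, hstd, ← hZc, ← mul_assoc,
            inv_mul_cancel₀ (by exact_mod_cast hZpos.ne'), one_mul]
          congr 1; rw [Complex.I_sq]; ring
  rw [← heq, measureReal_def, hνreal _ hA, ENNReal.toReal_ofReal]
  exact div_nonneg (integral_nonneg fun θ => (Real.exp_pos _).le) hZpos.le

/-- Change of variables under the square root `L` of the covariance: the precision form at `L x` is
`‖x‖²`, and the determinant cancels in the ratio. -/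
theorem multivariateGaussian_real_eq {ι : Type*} [Fintype ι] [DecidableEq ι] {V : Matrix ι ι ℝ}
    (hV : V.PosDef) {σ : ℝ} (hσ : 0 < σ) (A : Set (EuclideanSpace ℝ ι)) (hA : MeasurableSet A) :
    (multivariateGaussian 0 (σ ^ 2 • V⁻¹)).real A =
      (∫ θ in A, Real.exp (-⟪((σ ^ 2)⁻¹ • Matrix.toEuclideanCLM (𝕜 := ℝ) V) θ, θ⟫ / 2)) /
        ∫ θ, Real.exp (-⟪((σ ^ 2)⁻¹ • Matrix.toEuclideanCLM (𝕜 := ℝ) V) θ, θ⟫ / 2) := by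
  classical
  open scoped MatrixOrder in
  set S : Matrix ι ι ℝ := σ ^ 2 • V⁻¹ with hS
  have hSpd : S.PosSemidef := (hV.inv.smul (by positivity)).posSemidef
  set r : Matrix ι ι ℝ := CFC.sqrt S with hr
  have hrr : r * r = S := CFC.sqrt_mul_sqrt_self _ hSpd.nonneg
  set L : EuclideanSpace ℝ ι →L[ℝ] EuclideanSpace ℝ ι := Matrix.toEuclideanCLM (𝕜 := ℝ) r with hL
  set Q : EuclideanSpace ℝ ι →L[ℝ] EuclideanSpace ℝ ι :=
    (σ ^ 2)⁻¹ • Matrix.toEuclideanCLM (𝕜 := ℝ) V with hQ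
  have hVr : ((σ ^ 2)⁻¹ • V) * r * r = 1 := by
    rw [mul_assoc, hrr, hS, Matrix.smul_mul, Matrix.mul_smul, smul_smul,
      Matrix.mul_nonsing_inv _ (isUnit_iff_ne_zero.2 hV.det_pos.ne'),
      inv_mul_cancel₀ (by positivity), one_smul]
  have hLsa : IsSelfAdjoint L := (CFC.sqrt_nonneg S).isSelfAdjoint.map _
  have hLQL : L * (Q * L) = 1 := by
    rw [hL, hQ, ← map_smul, ← map_mul, ← map_mul, mul_eq_one_comm.1 hVr, map_one]
  have hquad : ∀ x, ⟪Q (L x), L x⟫ = ‖x‖ ^ 2 := by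
    intro x
    have h2 := ContinuousLinearMap.adjoint_inner_left L x (Q (L x))
    rw [hLsa.adjoint_eq] at h2
    rw [← h2, show L (Q (L x)) = x from congrArg (fun f => f x) hLQL, real_inner_self_eq_norm_sq]
  have hdet : LinearMap.det (L : EuclideanSpace ℝ ι →ₗ[ℝ] EuclideanSpace ℝ ι) ≠ 0 := by
    intro h0
    have h2 : L.toLinearMap * (Q * L).toLinearMap = 1 := by
      ext1 y; exact congrArg (fun f => f y) hLQL
    have h1 := congrArg LinearMap.det h2
    rw [map_mul, h0, zero_mul, map_one] at h1
    exact zero_ne_one h1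
  have hLm : Measurable L := L.continuous.measurable
  have hmap := Measure.map_linearMap_addHaar_eq_smul_addHaar
    (volume : Measure (EuclideanSpace ℝ ι)) hdet
  set D : ℝ := |(LinearMap.det (L : EuclideanSpace ℝ ι →ₗ[ℝ] EuclideanSpace ℝ ι))⁻¹| with hD
  have hDpos : 0 < D := abs_pos.2 (inv_ne_zero hdet)
  set G : EuclideanSpace ℝ ι → ℝ := fun θ => Real.exp (-⟪Q θ, θ⟫ / 2) with hG
  have hGm : Measurable G := by fun_prop
  have hcv : ∀ B, MeasurableSet B → ∫ x in L ⁻¹' B, Real.exp (-‖x‖ ^ 2 / 2) =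
      D * ∫ θ in B, G θ := by
    intro B hB
    have h1 : ∫ x in L ⁻¹' B, Real.exp (-‖x‖ ^ 2 / 2) =
        ∫ x in L ⁻¹' B, G (L x) := by
      congr 1; ext x; simp only [hG, hquad]
    rw [h1, ← setIntegral_map hB hGm.aestronglyMeasurable hLm.aemeasurable]
    have : Measure.map L (volume : Measure (EuclideanSpace ℝ ι)) = ENNReal.ofReal D • volume := hmap
    rw [this, Measure.restrict_smul, integral_smul_measure, ENNReal.toReal_ofReal hDpos.le,
      smul_eq_mul]
  have hN : multivariateGaussian 0 S = (stdGaussian (EuclideanSpace ℝ ι)).map L := by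
    rw [multivariateGaussian]; congr 1; ext1 x; simp [hL, hr]
  rw [hN, map_measureReal_apply hLm hA, stdGaussian_real_eq _ (hLm hA), hcv A hA]
  have huniv := hcv Set.univ MeasurableSet.univ
  rw [Set.preimage_univ, setIntegral_univ, setIntegral_univ] at huniv
  rw [huniv, mul_div_mul_left _ _ hDpos.ne']

end StructuralBreak
end

noncomputable section
namespace StructuralBreak
open scoped RealInnerProductSpace
open Finset (range Ico)

/-! ### Regression with a break: deterministic estimates -/

section Deterministic

variable {F : Type*} [NormedAddCommGroup F] [InnerProductSpace ℝ F]

/-- The score `∑ e_t x_t` over the observations in `I`. -/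
def score (x : ℕ → F) (e : ℕ → ℝ) (I : Finset ℕ) : F := ∑ t ∈ I, e t • x t

/-- The quadratic form `∑ ⟪x_t, u⟫²` of the Gram matrix over the observations in `I`. -/
def gramForm (x : ℕ → F) (I : Finset ℕ) (u : F) : ℝ := ∑ t ∈ I, ⟪x t, u⟫ ^ 2

/-- The Gram operator `∑ x_t x_t'` over the observations in `I`. -/
def gramOp (x : ℕ → F) (I : Finset ℕ) : F →L[ℝ] F :=
  ∑ t ∈ I, InnerProductSpace.rankOne ℝ (x t) (x t)

theorem gramOp_apply (x : ℕ → F) (I : Finset ℕ) (u : F) :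
    gramOp x I u = ∑ t ∈ I, ⟪x t, u⟫ • x t := by
  simp [gramOp, InnerProductSpace.rankOne_apply]

theorem inner_gramOp (x : ℕ → F) (I : Finset ℕ) (u : F) :
    ⟪gramOp x I u, u⟫ = gramForm x I u := by
  rw [gramOp_apply, sum_inner, gramForm]
  exact Finset.sum_congr rfl fun t _ => by rw [real_inner_smul_left, sq]

theorem inner_score (x : ℕ → F) (e : ℕ → ℝ) (I : Finset ℕ) (u : F) :
    ⟪score x e I, u⟫ = ∑ t ∈ I, e t * ⟪x t, u⟫ := by
  rw [score, sum_inner]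
  exact Finset.sum_congr rfl fun t _ => by rw [real_inner_smul_left]

theorem gramForm_nonneg (x : ℕ → F) (I : Finset ℕ) (u : F) : 0 ≤ gramForm x I u :=
  Finset.sum_nonneg fun _ _ => sq_nonneg _

theorem gramForm_mono (x : ℕ → F) {I J : Finset ℕ} (h : I ⊆ J) (u : F) :
    gramForm x I u ≤ gramForm x J u :=
  Finset.sum_le_sum_of_subset_of_nonneg h fun _ _ _ => sq_nonneg _

theorem gramForm_le {x : ℕ → F} {B : ℝ} (hB : ∀ t, ‖x t‖ ≤ B) (I : Finset ℕ) (u : F) :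
    gramForm x I u ≤ B ^ 2 * I.card * ‖u‖ ^ 2 := by
  calc gramForm x I u ≤ ∑ _t ∈ I, B ^ 2 * ‖u‖ ^ 2 := by
        refine Finset.sum_le_sum fun t _ => ?_
        rw [← mul_pow, ← sq_abs]
        have := abs_real_inner_le_norm (x t) u
        gcongr
        exact this.trans (by gcongr; exact hB t)
    _ = _ := by rw [Finset.sum_const, nsmul_eq_mul]; ring

theorem sum_residual_sq (x : ℕ → F) (e : ℕ → ℝ) (I : Finset ℕ) (u : F) :
    ∑ t ∈ I, (e t - ⟪x t, u⟫) ^ 2 =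
      ∑ t ∈ I, e t ^ 2 - 2 * ⟪score x e I, u⟫ + gramForm x I u := by
  rw [inner_score, gramForm, Finset.mul_sum, ← Finset.sum_sub_distrib, ← Finset.sum_add_distrib]
  exact Finset.sum_congr rfl fun t _ => by ring

theorem two_mul_inner_le {M u : F} {c : ℝ} (hc : 0 < c) :
    2 * ⟪M, u⟫ ≤ c * ‖u‖ ^ 2 + ‖M‖ ^ 2 / c := by
  have h1 := real_inner_le_norm M u
  have h2 : 2 * (‖M‖ * ‖u‖) ≤ c * ‖u‖ ^ 2 + ‖M‖ ^ 2 / c := by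
    have : 0 ≤ (c * ‖u‖ - ‖M‖) ^ 2 / c := by positivity
    have h3 : (c * ‖u‖ - ‖M‖) ^ 2 / c = c * ‖u‖ ^ 2 + ‖M‖ ^ 2 / c - 2 * (‖M‖ * ‖u‖) := by
      field_simp; ring
    linarith
  linarith

/-- Fitting pure noise gains at most the squared score over the curvature. -/
theorem sum_residual_sq_ge {x : ℕ → F} (e : ℕ → ℝ) {J : Finset ℕ} {Λ : ℝ} (hΛ : 0 < Λ)
    (hJ : ∀ u, Λ * ‖u‖ ^ 2 ≤ gramForm x J u) (v : F) :
    ∑ t ∈ J, e t ^ 2 - ‖score x e J‖ ^ 2 / Λ ≤ ∑ t ∈ J, (e t - ⟪x t, v⟫) ^ 2 := by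
  rw [sum_residual_sq]
  linarith [hJ v, two_mul_inner_le (M := score x e J) (u := v) hΛ]

/-- If the model has the wrong regime on `I`, the fit on `J ∪ I` deteriorates in proportion to the
size of the jump `D` on `I`. -/
theorem sum_residual_sq_misfit_ge {x : ℕ → F} (e : ℕ → ℝ) {J I : Finset ℕ} {Λ Γ : ℝ} (hΛ : 0 < Λ)
    (hΓ : 0 < Γ) (hJ : ∀ u, Λ * ‖u‖ ^ 2 ≤ gramForm x J u) (hI : ∀ u, gramForm x I u ≤ Γ * ‖u‖ ^ 2)
    (D u : F) :
    ∑ t ∈ J, e t ^ 2 + ∑ t ∈ I, e t ^ 2 + Λ / (2 * Γ + Λ) * gramForm x I D -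
        2 * ‖score x e J + score x e I‖ ^ 2 / Λ - 2 * (‖D‖ * ‖score x e I‖) ≤
      ∑ t ∈ J, (e t - ⟪x t, u⟫) ^ 2 + ∑ t ∈ I, (e t - ⟪x t, u - D⟫) ^ 2 := by
  rw [sum_residual_sq, sum_residual_sq]
  -- For each observation, `(p - d)² + Λ / (2Γ) p²` has minimum `Λ / (2Γ + Λ) d²` over `p`. Avoiding
  -- the misfit on `I` requires a `u` that is costly on `J`. Half of the curvature `Λ` pays for
  -- this; the other half absorbs the scores in `h3`.
  have h1 : Λ / (2 * Γ + Λ) * gramForm x I D ≤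
      gramForm x I (u - D) + Λ / (2 * Γ) * gramForm x I u := by
    simp only [gramForm]
    rw [Finset.mul_sum, Finset.mul_sum, ← Finset.sum_add_distrib]
    refine Finset.sum_le_sum fun t _ => ?_
    rw [inner_sub_right]
    set p := ⟪x t, u⟫
    set d := ⟪x t, D⟫
    have h : (p - d) ^ 2 + Λ / (2 * Γ) * p ^ 2 - Λ / (2 * Γ + Λ) * d ^ 2 =
        ((2 * Γ + Λ) * p - 2 * Γ * d) ^ 2 / (2 * Γ * (2 * Γ + Λ)) := by
      field_simp; ring
    have : 0 ≤ ((2 * Γ + Λ) * p - 2 * Γ * d) ^ 2 / (2 * Γ * (2 * Γ + Λ)) := by positivity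
    linarith
  have h2 : Λ / (2 * Γ) * gramForm x I u ≤ Λ / 2 * ‖u‖ ^ 2 := by
    calc Λ / (2 * Γ) * gramForm x I u ≤ Λ / (2 * Γ) * (Γ * ‖u‖ ^ 2) := by gcongr; exact hI u
      _ = _ := by field_simp
  have h3 := two_mul_inner_le (M := score x e J + score x e I) (u := u) (half_pos hΛ)
  rw [inner_add_left] at h3
  have h3' : ‖score x e J + score x e I‖ ^ 2 / (Λ / 2) =
    2 * ‖score x e J + score x e I‖ ^ 2 / Λ := by field_simp
  rw [h3'] at h3
  have h4 : -(‖D‖ * ‖score x e I‖) ≤ ⟪score x e I, D⟫ := by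
    have := neg_le_of_abs_le (abs_real_inner_le_norm (score x e I) D)
    linarith [mul_comm ‖D‖ ‖score x e I‖]
  rw [inner_sub_right]
  linarith [hJ u]

/-- Three noise terms, each allowed an eighth of the misfit gain `κ * gramForm x I D`, leave more
than half of it. The block `K` is fitted by its own regime; it either has enough curvature to
control the noise gain or is so short that its whole error sum is negligible. -/
theorem sum_residual_sq_break_ge {x : ℕ → F} {e : ℕ → ℝ} {J I K : Finset ℕ} {Λ Γ : ℝ} (hΛ : 0 < Λ)
    (hΓ : 0 < Γ) (hJ : ∀ u, Λ * ‖u‖ ^ 2 ≤ gramForm x J u) (hI : ∀ u, gramForm x I u ≤ Γ * ‖u‖ ^ 2)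
    {D : F} {κ : ℝ} (hκ : κ = Λ / (2 * Γ + Λ))
    (h1 : 2 * ‖score x e J + score x e I‖ ^ 2 / Λ ≤ κ / 8 * gramForm x I D)
    (h2 : 2 * (‖D‖ * ‖score x e I‖) ≤ κ / 8 * gramForm x I D)
    (h3 : (∃ M, 0 < M ∧ (∀ u, M * ‖u‖ ^ 2 ≤ gramForm x K u) ∧
        ‖score x e K‖ ^ 2 / M ≤ κ / 8 * gramForm x I D) ∨
      ∑ t ∈ K, e t ^ 2 ≤ κ / 8 * gramForm x I D) (u v : F) :
    ∑ t ∈ J, e t ^ 2 + ∑ t ∈ I, e t ^ 2 + ∑ t ∈ K, e t ^ 2 + κ / 2 * gramForm x I D ≤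
      ∑ t ∈ J, (e t - ⟪x t, u⟫) ^ 2 + ∑ t ∈ I, (e t - ⟪x t, u - D⟫) ^ 2 +
        ∑ t ∈ K, (e t - ⟪x t, v⟫) ^ 2 := by
  have hA := sum_residual_sq_misfit_ge e hΛ hΓ hJ hI D u
  rw [← hκ] at hA
  have hB : ∑ t ∈ K, e t ^ 2 - κ / 8 * gramForm x I D ≤ ∑ t ∈ K, (e t - ⟪x t, v⟫) ^ 2 := by
    rcases h3 with ⟨M, hM, hK, hs⟩ | h3
    · linarith [sum_residual_sq_ge e hM hK v]
    · have : 0 ≤ ∑ t ∈ K, (e t - ⟪x t, v⟫) ^ 2 := Finset.sum_nonneg fun _ _ => sq_nonneg _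
      linarith
  have hκ0 : 0 < κ := by rw [hκ]; positivity
  have := mul_nonneg hκ0.le (gramForm_nonneg x I D)
  linarith

theorem score_union (x : ℕ → F) (e : ℕ → ℝ) {a b : ℕ} (h : a ≤ b) :
    score x e (range a) + score x e (Ico a b) = score x e (range b) := by
  simp only [score]
  exact Finset.sum_range_add_sum_Ico _ h

theorem norm_score_Ico_le {x : ℕ → F} {e : ℕ → ℝ} {a b : ℕ} (h : a ≤ b) {C : ℝ}
    (ha : ‖score x e (range a)‖ ≤ C) (hb : ‖score x e (range b)‖ ≤ C) :
    ‖score x e (Ico a b)‖ ≤ 2 * C := by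
  have := score_union x e h
  rw [← eq_sub_iff_add_eq'] at this
  rw [this]
  linarith [norm_sub_le (score x e (range b)) (score x e (range a))]

theorem le_norm_of_coercive {Q : F →L[ℝ] F} {c : ℝ} {u : F} (h : c * ‖u‖ ^ 2 ≤ ⟪Q u, u⟫) :
    c * ‖u‖ ≤ ‖Q u‖ := by
  rcases eq_or_ne u 0 with rfl | hu
  · simp
  · have h1 : c * ‖u‖ * ‖u‖ ≤ ‖Q u‖ * ‖u‖ := by
      have := real_inner_le_norm (Q u) u
      linarith [sq ‖u‖, show c * ‖u‖ * ‖u‖ = c * ‖u‖ ^ 2 by ring]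
    exact le_of_mul_le_mul_right h1 (norm_pos_iff.2 hu)

theorem norm_rankOne_self_le (u : F) : ‖InnerProductSpace.rankOne ℝ u u‖ ≤ ‖u‖ ^ 2 := by
  rw [InnerProductSpace.norm_rankOne, sq]

/-- Cauchy–Schwarz. For near breaks the window length and the lost signal are `O(n^0.6)` and
`n^0.35`, so that this part of the score stays below `√n`. -/
theorem norm_sum_inner_smul_le {x : ℕ → F} {B : ℝ} (hB : ∀ t, ‖x t‖ ≤ B) (I : Finset ℕ) (D : F) :
    ‖∑ t ∈ I, ⟪x t, D⟫ • x t‖ ≤ B * Real.sqrt (I.card * gramForm x I D) := by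
  have hB0 : 0 ≤ B := (norm_nonneg _).trans (hB 0)
  calc ‖∑ t ∈ I, ⟪x t, D⟫ • x t‖ ≤ ∑ t ∈ I, |⟪x t, D⟫| * B := by
        refine norm_sum_le_of_le _ fun t _ => ?_
        rw [norm_smul, Real.norm_eq_abs]
        gcongr; exact hB t
    _ = B * ∑ t ∈ I, |⟪x t, D⟫| := by rw [← Finset.sum_mul, mul_comm]
    _ ≤ _ := by
        gcongr
        refine Real.le_sqrt_of_sq_le ?_
        refine (sq_sum_le_card_mul_sum_sq).trans ?_
        simp only [gramForm, sq_abs]; rfl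

end Deterministic

/-! ### Comparison of powers of the sample size -/

theorem eventually_mul_rpow_le {ι : Type*} {l : Filter ι} {n : ι → ℕ} (hn : Tendsto n l atTop)
    (C : ℝ) {a b : ℝ} (hab : a < b) : ∀ᶠ i in l, C * (n i : ℝ) ^ a ≤ (n i : ℝ) ^ b := by
  have h : Tendsto (fun i => (n i : ℝ)) l atTop := tendsto_natCast_atTop_atTop.comp hn
  have h1 := (tendsto_rpow_atTop (sub_pos.2 hab)).comp h
  filter_upwards [h1.eventually_ge_atTop C, h.eventually_gt_atTop 0] with i hi hi0
  simp only [Function.comp] at hi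
  calc C * (n i : ℝ) ^ a ≤ (n i : ℝ) ^ (b - a) * (n i : ℝ) ^ a := by gcongr
    _ = _ := by rw [← Real.rpow_add hi0]; congr 1; ring

end StructuralBreak
end

noncomputable section
namespace StructuralBreak
open scoped RealInnerProductSpace
open Finset (range Ico)

/-! ### Break date: separation of distant candidates -/

/-- The observations between the candidate break `k` and the true break `k₀`. -/
def window (k₀ k : ℕ) : Finset ℕ := Ico (min k k₀) (max k k₀)

/-- Samples of growing size `n` with break `k₀`, jump `D` and neighbourhood `[kL, kR]` of the break,
for which the sums of squares and cross products have their typical orders of magnitude. -/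
structure RegularSample {ι F : Type*} [NormedAddCommGroup F] [InnerProductSpace ℝ F]
    (l : Filter ι) (n k₀ kL kR : ι → ℕ) (x : ι → ℕ → F) (e : ι → ℕ → ℝ) (D : F)
    (SL SR : F →L[ℝ] F) (σ : ℝ) : Prop where
  size : Tendsto n l atTop
  order : ∀ᶠ i in l, kL i ≤ k₀ i ∧ k₀ i ≤ kR i ∧ kR i ≤ n i
  width : ∃ C : ℝ, ∀ᶠ i in l, (kR i : ℝ) - kL i ≤ C * (n i : ℝ) ^ (0.6 : ℝ)
  bounded : ∃ B : ℝ, ∀ i t, ‖x i t‖ ≤ B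
  error : Tendsto (fun i => (∑ t ∈ range (n i), e i t ^ 2) / n i) l (𝓝 (σ ^ 2))
  gram_left : Tendsto (fun i => (n i : ℝ)⁻¹ • gramOp (x i) (range (k₀ i))) l (𝓝 SL)
  gram_right : Tendsto (fun i => (n i : ℝ)⁻¹ • gramOp (x i) (Ico (k₀ i) (n i))) l (𝓝 SR)
  coercive_left : ∃ c : ℝ, 0 < c ∧ ∀ u, c * ‖u‖ ^ 2 ≤ ⟪SL u, u⟫
  coercive_right : ∃ c : ℝ, 0 < c ∧ ∀ u, c * ‖u‖ ^ 2 ≤ ⟪SR u, u⟫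
  score_le : ∀ᶠ i in l, ∀ k ≤ n i, ‖score (x i) (e i) (range k)‖ ≤ (n i : ℝ) ^ (0.55 : ℝ)
  score_window_le : ∀ᶠ i in l, ∀ k, kL i ≤ k → k ≤ kR i →
    ‖score (x i) (e i) (window (k₀ i) k)‖ ≤ (n i : ℝ) ^ (0.325 : ℝ)
  separated_left : ∃ c : ℝ, 0 < c ∧ ∀ᶠ i in l,
    c * (n i : ℝ) ^ (0.6 : ℝ) ≤ gramForm (x i) (Ico (kL i) (k₀ i)) D
  separated_right : ∃ c : ℝ, 0 < c ∧ ∀ᶠ i in l,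
    c * (n i : ℝ) ^ (0.6 : ℝ) ≤ gramForm (x i) (Ico (k₀ i) (kR i)) D
  end_left : ∃ c : ℝ, 0 < c ∧ ∀ θ : ℝ, 0 < θ → ∃ c' : ℝ, 0 < c' ∧ ∀ᶠ i in l, ∀ k ≤ k₀ i,
    (∀ u, c' * n i * ‖u‖ ^ 2 ≤ gramForm (x i) (range k) u) ∨
      (∑ t ∈ range k, e i t ^ 2 ≤ θ * n i ∧ c * n i ≤ gramForm (x i) (Ico k (k₀ i)) D)
  end_right : ∃ c : ℝ, 0 < c ∧ ∀ θ : ℝ, 0 < θ → ∃ c' : ℝ, 0 < c' ∧ ∀ᶠ i in l, ∀ k, k₀ i ≤ k →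
    k ≤ n i → (∀ u, c' * n i * ‖u‖ ^ 2 ≤ gramForm (x i) (Ico k (n i)) u) ∨
      (∑ t ∈ Ico k (n i), e i t ^ 2 ≤ θ * n i ∧ c * n i ≤ gramForm (x i) (Ico (k₀ i) k) D)

theorem two_mul_mul_le_of_le {d s w q κ C : ℝ} (hκ : 0 < κ) (hd : 0 ≤ d) (h1 : s ≤ C * w)
    (h2 : 16 * C * d / κ * w ≤ q) : 2 * (d * s) ≤ κ / 8 * q := by
  calc 2 * (d * s) ≤ 2 * (d * (C * w)) := by gcongr
    _ = κ / 8 * (16 * C * d / κ * w) := by field_simp; ring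
    _ ≤ κ / 8 * q := by gcongr

theorem mul_le_of_div_mul_le {c w v q a : ℝ} (hc : 0 < c) (h1 : a / c * w ≤ v) (h2 : c * v ≤ q) :
    a * w ≤ q := by
  calc a * w = c * (a / c * w) := by field_simp
    _ ≤ c * v := by gcongr
    _ ≤ q := h2

namespace RegularSample

variable {ι F : Type*} [NormedAddCommGroup F] [InnerProductSpace ℝ F]
  {l : Filter ι} {n k₀ kL kR : ι → ℕ} {x : ι → ℕ → F} {e : ι → ℕ → ℝ} {D : F}
  {SL SR : F →L[ℝ] F} {σ : ℝ}

theorem eventually_size_pos (h : RegularSample l n k₀ kL kR x e D SL SR σ) :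
    ∀ᶠ i in l, (0 : ℝ) < n i :=
  (h.size.eventually_gt_atTop 0).mono fun _ hi => by exact_mod_cast hi

theorem gramForm_lower {I : ι → Finset ℕ} {S : F →L[ℝ] F} {c : ℝ} (hc : 0 < c)
    (hS : ∀ u, c * ‖u‖ ^ 2 ≤ ⟪S u, u⟫) (hn : ∀ᶠ i in l, (0 : ℝ) < n i)
    (hI : Tendsto (fun i => (n i : ℝ)⁻¹ • gramOp (x i) (I i)) l (𝓝 S)) :
    ∀ᶠ i in l, ∀ u, c / 2 * n i * ‖u‖ ^ 2 ≤ gramForm (x i) (I i) u := by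
  filter_upwards [hI.eventually (eventually_coercive hc hS), hn] with i hi hni u
  have := hi u
  rw [smul_apply, real_inner_smul_left, inner_gramOp, inv_mul_eq_div,
    le_div_iff₀ hni] at this
  linarith

set_option maxHeartbeats 1000000 in
/-- Candidates that are separated from the true break have a distinctly larger sum of squares;
here `u`, `v` are the deviations of the fitted coefficients of the two regimes. -/
theorem residual_ge_of_far (h : RegularSample l n k₀ kL kR x e D SL SR σ) :
    ∃ c : ℝ, 0 < c ∧ ∀ᶠ i in l, ∀ k ≤ n i,
      (n i : ℝ) ^ (0.35 : ℝ) ≤ gramForm (x i) (window (k₀ i) k) D →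
      (k₀ i ≤ k → ∀ u v, ∑ t ∈ range (n i), e i t ^ 2 + c * (n i : ℝ) ^ (0.35 : ℝ) ≤
        ∑ t ∈ range (k₀ i), (e i t - ⟪x i t, u⟫) ^ 2 +
          ∑ t ∈ Ico (k₀ i) k, (e i t - ⟪x i t, u - D⟫) ^ 2 +
          ∑ t ∈ Ico k (n i), (e i t - ⟪x i t, v⟫) ^ 2) ∧
      (k ≤ k₀ i → ∀ u v, ∑ t ∈ range (n i), e i t ^ 2 + c * (n i : ℝ) ^ (0.35 : ℝ) ≤
        ∑ t ∈ range k, (e i t - ⟪x i t, u⟫) ^ 2 +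
          ∑ t ∈ Ico k (k₀ i), (e i t - ⟪x i t, v + D⟫) ^ 2 +
          ∑ t ∈ Ico (k₀ i) (n i), (e i t - ⟪x i t, v⟫) ^ 2) := by
  obtain ⟨B, hB⟩ := h.bounded
  obtain ⟨cL, hcL, hSL⟩ := h.coercive_left
  obtain ⟨cR, hcR, hSR⟩ := h.coercive_right
  obtain ⟨c1, hc1, hsepL⟩ := h.separated_left
  obtain ⟨c2, hc2, hsepR⟩ := h.separated_right
  obtain ⟨c3, hc3, hendL⟩ := h.end_left
  obtain ⟨c4, hc4, hendR⟩ := h.end_right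
  have hpos := h.eventually_size_pos
  set c₀ := min cL cR / 2 with hc₀
  have hc₀pos : 0 < c₀ := half_pos (lt_min hcL hcR)
  have hgL := gramForm_lower hcL hSL hpos h.gram_left
  have hgR := gramForm_lower hcR hSR hpos h.gram_right
  set Γ₀ := B ^ 2 + 1 with hΓ₀
  have hΓ₀pos : 0 < Γ₀ := by positivity
  set κ := c₀ / (2 * Γ₀ + c₀) with hκ
  have hκpos : 0 < κ := by positivity
  -- The tolerance for the error sum of a very short regime is an eighth of the misfit it causes. It
  -- depends on `c3`, which is why the end conditions fix their signal constant before `θ`.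
  obtain ⟨c5, hc5, hendL⟩ := hendL (κ / 8 * c3) (by positivity)
  obtain ⟨c6, hc6, hendR⟩ := hendR (κ / 8 * c4) (by positivity)
  refine ⟨κ / 2, by positivity, ?_⟩
  filter_upwards [hpos, hgL, hgR, hsepL, hsepR, hendL, hendR, h.order, h.score_le,
    h.score_window_le,
    -- Exponent bookkeeping. Squared scores over `n` have order `2 · 0.55 - 1 = 0.1` and scores on
    -- windows inside `[kL, kR]` order `0.325`, both below `0.35`. Outside `[kL, kR]` only the order
    -- `0.55` is available, but there the signal has order `0.6`.
    eventually_mul_rpow_le h.size (8 * 8 / (c₀ * κ)) (show (0.1 : ℝ) < 0.35 by norm_num),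
    eventually_mul_rpow_le h.size (8 * 8 / (c5 * κ)) (show (0.1 : ℝ) < 0.35 by norm_num),
    eventually_mul_rpow_le h.size (8 * 8 / (c6 * κ)) (show (0.1 : ℝ) < 0.35 by norm_num),
    eventually_mul_rpow_le h.size (16 * 1 * ‖D‖ / κ) (show (0.325 : ℝ) < 0.35 by norm_num),
    eventually_mul_rpow_le h.size (16 * 2 * ‖D‖ / κ / c1) (show (0.55 : ℝ) < 0.6 by norm_num),
    eventually_mul_rpow_le h.size (16 * 2 * ‖D‖ / κ / c2) (show (0.55 : ℝ) < 0.6 by norm_num)]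
    with i hn hgL hgR hsepL hsepR hendL hendR hord hsc hscw hp0 hp5 hp6 hw hw1 hw2 k hkn hfar
  obtain ⟨hLk, hkR, hRn⟩ := hord
  have hk₀n : k₀ i ≤ n i := hkR.trans hRn
  have h11 : ((n i : ℝ) ^ (0.55 : ℝ)) ^ 2 = (n i : ℝ) ^ (0.1 : ℝ) * n i := by
    rw [← Real.rpow_natCast, ← Real.rpow_mul hn.le, ← Real.rpow_add_one hn.ne']; norm_num
  have hloss : ∀ {M : F} {c : ℝ}, 0 < c → 8 * 8 / (c * κ) * (n i : ℝ) ^ (0.1 : ℝ) ≤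
      (n i : ℝ) ^ (0.35 : ℝ) → ‖M‖ ≤ 2 * (n i : ℝ) ^ (0.55 : ℝ) → ∀ {q : ℝ},
      (n i : ℝ) ^ (0.35 : ℝ) ≤ q → 2 * ‖M‖ ^ 2 / (c * n i) ≤ κ / 8 * q := by
    intro M c hc hle hM q hq
    have h1 : ‖M‖ ^ 2 ≤ 4 * ((n i : ℝ) ^ (0.1 : ℝ) * n i) := by
      rw [← h11]; nlinarith [norm_nonneg M]
    have h2 : 8 * 8 * (n i : ℝ) ^ (0.1 : ℝ) ≤ q * (c * κ) := by
      have := hle.trans hq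
      rwa [div_mul_eq_mul_div, div_le_iff₀ (by positivity)] at this
    rw [div_le_iff₀ (by positivity)]
    nlinarith
  have hΓ : ∀ I : Finset ℕ, I.card ≤ n i → ∀ u, gramForm (x i) I u ≤ Γ₀ * n i * ‖u‖ ^ 2 := by
    intro I hI u
    refine (gramForm_le (hB i) I u).trans ?_
    have : (I.card : ℝ) ≤ n i := by exact_mod_cast hI
    gcongr; rw [hΓ₀]; linarith
  have hκ' : κ = c₀ * n i / (2 * (Γ₀ * n i) + c₀ * n i) := by rw [hκ]; field_simp
  constructor
  · intro hk u v
    have hwin : window (k₀ i) k = Ico (k₀ i) k := by simp [window, hk]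
    rw [hwin] at hfar
    set q := gramForm (x i) (Ico (k₀ i) k) D with hq
    have hM : 2 * (‖D‖ * ‖score (x i) (e i) (Ico (k₀ i) k)‖) ≤ κ / 8 * q := by
      rcases le_or_gt k (kR i) with hkR' | hkR'
      · have h1 := hscw k (hLk.trans hk) hkR'
        rw [hwin] at h1
        exact two_mul_mul_le_of_le hκpos (norm_nonneg D) (h1.trans_eq (one_mul _).symm)
          (hw.trans hfar)
      · have h1 := norm_score_Ico_le hk (hsc _ hk₀n) (hsc _ hkn)
        refine two_mul_mul_le_of_le hκpos (norm_nonneg D) h1 (mul_le_of_div_mul_le hc2 hw2 ?_)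
        exact hsepR.trans (gramForm_mono _ (Finset.Ico_subset_Ico le_rfl hkR'.le) D)
    have hmain := sum_residual_sq_break_ge (x := x i) (e := e i) (J := range (k₀ i))
      (I := Ico (k₀ i) k) (K := Ico k (n i)) (Λ := c₀ * n i) (Γ := Γ₀ * n i) (D := D)
      (by positivity) (by positivity)
      (fun u => le_trans (by gcongr; rw [hc₀]; gcongr; exact min_le_left _ _) (hgL u))
      (hΓ _ (by simp; omega)) hκ'
      (hloss hc₀pos hp0 (by
        rw [score_union _ _ hk]
        linarith [hsc k hkn, norm_nonneg (score (x i) (e i) (range k))]) hfar)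
      hM (by
        rcases hendR k hk hkn with h1 | ⟨h1, h2⟩
        · refine Or.inl ⟨c6 * n i, by positivity, h1, ?_⟩
          have := hloss hc6 hp6 (norm_score_Ico_le hkn (hsc _ hkn) (hsc _ le_rfl)) hfar
          have h3 : 0 ≤ ‖score (x i) (e i) (Ico k (n i))‖ ^ 2 / (c6 * n i) := by positivity
          rw [mul_div_assoc] at this
          linarith
        · refine Or.inr (h1.trans ?_)
          rw [mul_assoc]; gcongr) u v
    have hsum : ∑ t ∈ range (k₀ i), e i t ^ 2 + ∑ t ∈ Ico (k₀ i) k, e i t ^ 2 +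
        ∑ t ∈ Ico k (n i), e i t ^ 2 = ∑ t ∈ range (n i), e i t ^ 2 := by
      rw [Finset.sum_range_add_sum_Ico _ hk, Finset.sum_range_add_sum_Ico _ hkn]
    rw [hsum] at hmain
    refine le_trans ?_ hmain
    gcongr
  -- The mirror image: the second regime is the reference sample, the jump is `-D`, and the possibly
  -- short block is the first regime.
  · intro hk u v
    have hwin : window (k₀ i) k = Ico k (k₀ i) := by simp [window, hk]
    rw [hwin] at hfar
    set q := gramForm (x i) (Ico k (k₀ i)) D with hq
    have hqneg : gramForm (x i) (Ico k (k₀ i)) (-D) = q := by simp [hq, gramForm]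
    have hM : 2 * (‖-D‖ * ‖score (x i) (e i) (Ico k (k₀ i))‖) ≤ κ / 8 * q := by
      rw [norm_neg]
      rcases le_or_gt (kL i) k with hkL' | hkL'
      · have h1 := hscw k hkL' (hk.trans hkR)
        rw [hwin] at h1
        exact two_mul_mul_le_of_le hκpos (norm_nonneg D) (h1.trans_eq (one_mul _).symm)
          (hw.trans hfar)
      · have h1 := norm_score_Ico_le hk (hsc _ hkn) (hsc _ hk₀n)
        refine two_mul_mul_le_of_le hκpos (norm_nonneg D) h1 (mul_le_of_div_mul_le hc1 hw1 ?_)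
        exact hsepL.trans (gramForm_mono _ (Finset.Ico_subset_Ico hkL'.le le_rfl) D)
    have hunion : score (x i) (e i) (Ico (k₀ i) (n i)) + score (x i) (e i) (Ico k (k₀ i)) =
        score (x i) (e i) (Ico k (n i)) := by
      rw [add_comm]; exact Finset.sum_Ico_consecutive _ hk hk₀n
    have hmain := sum_residual_sq_break_ge (x := x i) (e := e i) (J := Ico (k₀ i) (n i))
      (I := Ico k (k₀ i)) (K := range k) (Λ := c₀ * n i) (Γ := Γ₀ * n i) (D := -D)
      (by positivity) (by positivity)
      (fun u => le_trans (by gcongr; rw [hc₀]; gcongr; exact min_le_right _ _) (hgR u))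
      (hΓ _ (by simp; omega)) hκ'
      (by
        rw [hunion, hqneg]
        exact hloss hc₀pos hp0 (norm_score_Ico_le hkn (hsc _ hkn) (hsc _ le_rfl)) hfar)
      (by rw [hqneg]; exact hM) (by
        rw [hqneg]
        rcases hendL k hk with h1 | ⟨h1, h2⟩
        · refine Or.inl ⟨c5 * n i, by positivity, h1, ?_⟩
          have := hloss hc5 hp5 (M := score (x i) (e i) (range k)) (by
            linarith [hsc k hkn, norm_nonneg (score (x i) (e i) (range k))]) hfar
          have h3 : 0 ≤ ‖score (x i) (e i) (range k)‖ ^ 2 / (c5 * n i) := by positivity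
          rw [mul_div_assoc] at this
          linarith
        · refine Or.inr (h1.trans ?_)
          rw [mul_assoc]; gcongr) v u
    have hsum : ∑ t ∈ Ico (k₀ i) (n i), e i t ^ 2 + ∑ t ∈ Ico k (k₀ i), e i t ^ 2 +
        ∑ t ∈ range k, e i t ^ 2 = ∑ t ∈ range (n i), e i t ^ 2 := by
      rw [← Finset.sum_range_add_sum_Ico _ hk₀n, ← Finset.sum_range_add_sum_Ico _ hk]; ring
    rw [hsum, hqneg] at hmain
    simp only [sub_neg_eq_add] at hmain
    have h4 : κ / 2 * (n i : ℝ) ^ (0.35 : ℝ) ≤ κ / 2 * q := by gcongr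
    linarith

/-- Candidates that are not separated from the true break lie close to it. -/
theorem near_of_not_far (h : RegularSample l n k₀ kL kR x e D SL SR σ) :
    ∀ᶠ i in l, ∀ k, gramForm (x i) (window (k₀ i) k) D < (n i : ℝ) ^ (0.35 : ℝ) →
      kL i ≤ k ∧ k ≤ kR i := by
  obtain ⟨c1, hc1, hsepL⟩ := h.separated_left
  obtain ⟨c2, hc2, hsepR⟩ := h.separated_right
  filter_upwards [hsepL, hsepR, h.order,
    eventually_mul_rpow_le h.size c1⁻¹ (show (0.35 : ℝ) < 0.6 by norm_num),
    eventually_mul_rpow_le h.size c2⁻¹ (show (0.35 : ℝ) < 0.6 by norm_num)]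
    with i hsepL hsepR hord h1 h2 k hk
  rw [inv_mul_le_iff₀ hc1] at h1
  rw [inv_mul_le_iff₀ hc2] at h2
  constructor <;> by_contra! hlt
  · have : gramForm (x i) (Ico (kL i) (k₀ i)) D ≤ gramForm (x i) (window (k₀ i) k) D :=
      gramForm_mono _ (by rw [window]; apply Finset.Ico_subset_Ico <;> omega) D
    linarith
  · have : gramForm (x i) (Ico (k₀ i) (kR i)) D ≤ gramForm (x i) (window (k₀ i) k) D :=
      gramForm_mono _ (by rw [window]; apply Finset.Ico_subset_Ico <;> omega) D
    linarith

end RegularSample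
end StructuralBreak
end

noncomputable section
namespace StructuralBreak
open scoped RealInnerProductSpace
open Finset (range Ico)

/-! ### The two-regime regression near the true break -/

section TwoRegimes

variable {F E : Type*} [NormedAddCommGroup F] [InnerProductSpace ℝ F]
  [NormedAddCommGroup E] [InnerProductSpace ℝ E]

/-- The row of the design matrix with break `k`; `Ja`, `Jb` map the covariates to the rows of the
first and of the second regime. -/
def row (Ja Jb : F →L[ℝ] E) (x : ℕ → F) (k t : ℕ) : E := if t < k then Ja (x t) else Jb (x t)

/-- The deviation of the response from the model with break `k` at the true slope. -/
def deviation (Ja Jb : F →L[ℝ] E) (x : ℕ → F) (e : ℕ → ℝ) (k₀ : ℕ) (γ₀ : E) (k t : ℕ) : ℝ :=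
  ⟪row Ja Jb x k₀ t, γ₀⟫ + e t - ⟪row Ja Jb x k t, γ₀⟫

/-- The sum of squared residuals of the model with break `k` and slope `γ`. -/
def rss (Ja Jb : F →L[ℝ] E) (x : ℕ → F) (e : ℕ → ℝ) (k₀ : ℕ) (γ₀ : E) (n k : ℕ) (γ : E) : ℝ :=
  ∑ t ∈ range n, (⟪row Ja Jb x k₀ t, γ₀⟫ + e t - ⟪row Ja Jb x k t, γ⟫) ^ 2

/-- The Gram operator `χ'χ` of the design with break `k`. -/
def rowGram (Ja Jb : F →L[ℝ] E) (x : ℕ → F) (n k : ℕ) : E →L[ℝ] E :=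
  gramOp (row Ja Jb x k) (range n)

/-- The score `χ'(Y - χγ₀)` of the model with break `k` at the true slope. -/
def rowScore (Ja Jb : F →L[ℝ] E) (x : ℕ → F) (e : ℕ → ℝ) (k₀ : ℕ) (γ₀ : E) (n k : ℕ) : E :=
  score (row Ja Jb x k) (deviation Ja Jb x e k₀ γ₀ k) (range n)

variable {Ja Jb : F →L[ℝ] E} {x : ℕ → F} {e : ℕ → ℝ} {n k₀ k : ℕ} {γ₀ : E}

theorem rss_eq (γ : E) : rss Ja Jb x e k₀ γ₀ n k γ =
    rss Ja Jb x e k₀ γ₀ n k γ₀ - 2 * ⟪rowScore Ja Jb x e k₀ γ₀ n k, γ - γ₀⟫ +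
      ⟪rowGram Ja Jb x n k (γ - γ₀), γ - γ₀⟫ := by
  have h := sum_residual_sq (row Ja Jb x k) (deviation Ja Jb x e k₀ γ₀ k) (range n) (γ - γ₀)
  rw [rowGram, inner_gramOp, rowScore]
  rw [show rss Ja Jb x e k₀ γ₀ n k γ₀ = ∑ t ∈ range n, deviation Ja Jb x e k₀ γ₀ k t ^ 2 from rfl,
    ← h, rss]
  refine Finset.sum_congr rfl fun t _ => ?_
  rw [deviation, inner_sub_right]; ring

theorem rss_true : rss Ja Jb x e k₀ γ₀ n k₀ γ₀ = ∑ t ∈ range n, e t ^ 2 :=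
  Finset.sum_congr rfl fun t _ => by ring

theorem norm_row_le {B : ℝ} (hB : ∀ t, ‖x t‖ ≤ B) (k t : ℕ) :
    ‖row Ja Jb x k t‖ ≤ (‖Ja‖ + ‖Jb‖) * B := by
  have hB0 : 0 ≤ B := (norm_nonneg _).trans (hB t)
  unfold row
  split_ifs
  · refine (Ja.le_opNorm_of_le (hB t)).trans ?_
    gcongr; linarith [norm_nonneg Jb]
  · refine (Jb.le_opNorm_of_le (hB t)).trans ?_
    gcongr; linarith [norm_nonneg Ja]

theorem row_eq_of_notMem_window {t : ℕ} (ht : t ∉ window k₀ k) :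
    row Ja Jb x k t = row Ja Jb x k₀ t := by
  simp only [window, Finset.mem_Ico, not_and, not_lt] at ht
  unfold row
  congr 1
  rw [eq_iff_iff]
  omega

theorem window_subset (hk₀ : k₀ ≤ n) (hk : k ≤ n) : window k₀ k ⊆ range n := by
  intro t ht
  simp only [window, Finset.mem_Ico] at ht
  simp only [Finset.mem_range]; omega

theorem deviation_of_notMem_window {t : ℕ} (ht : t ∉ window k₀ k) :
    deviation Ja Jb x e k₀ γ₀ k t = e t := by
  rw [deviation, row_eq_of_notMem_window ht]; ring

variable {Pa Pb : E →L[ℝ] F} (hPa : ∀ z γ, ⟪Ja z, γ⟫ = ⟪z, Pa γ⟫)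
  (hPb : ∀ z γ, ⟪Jb z, γ⟫ = ⟪z, Pb γ⟫)

include hPa hPb

/-- Treats late and early candidates together: `s = 1` with `J = Ja` if the candidate is late, `s =
-1` with `J = Jb` if it is early. -/
theorem exists_regime_window (γ₀ : E) (x : ℕ → F) (e : ℕ → ℝ) (k₀ k : ℕ) :
    ∃ (s : ℝ) (J J' : F →L[ℝ] E), |s| = 1 ∧ ‖J‖ ≤ ‖Ja‖ + ‖Jb‖ ∧ ‖J'‖ ≤ ‖Ja‖ + ‖Jb‖ ∧
      ∀ t ∈ window k₀ k, row Ja Jb x k t = J (x t) ∧ row Ja Jb x k₀ t = J' (x t) ∧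
        deviation Ja Jb x e k₀ γ₀ k t = e t + s * ⟪x t, Pb γ₀ - Pa γ₀⟫ := by
  rcases le_total k₀ k with h | h
  · refine ⟨1, Ja, Jb, by simp, by linarith [norm_nonneg Jb], by linarith [norm_nonneg Ja], ?_⟩
    intro t ht
    simp only [window, Finset.mem_Ico] at ht
    have h1 : row Ja Jb x k t = Ja (x t) := if_pos (by omega)
    have h2 : row Ja Jb x k₀ t = Jb (x t) := if_neg (by omega)
    refine ⟨h1, h2, ?_⟩
    rw [deviation, h1, h2, hPa, hPb, inner_sub_right]; ring
  · refine ⟨-1, Jb, Ja, by simp, by linarith [norm_nonneg Ja], by linarith [norm_nonneg Jb], ?_⟩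
    intro t ht
    simp only [window, Finset.mem_Ico] at ht
    have h1 : row Ja Jb x k t = Jb (x t) := if_neg (by omega)
    have h2 : row Ja Jb x k₀ t = Ja (x t) := if_pos (by omega)
    refine ⟨h1, h2, ?_⟩
    rw [deviation, h1, h2, hPa, hPb, inner_sub_right]; ring

/-- At the true slope a wrong break changes the residuals only on the window, where they become `e ±
⟪x, D⟫`; expand the square. -/
theorem abs_rss_sub_le (hk₀ : k₀ ≤ n) (hk : k ≤ n) :
    |rss Ja Jb x e k₀ γ₀ n k γ₀ - ∑ t ∈ range n, e t ^ 2| ≤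
      2 * ‖score x e (window k₀ k)‖ * ‖Pb γ₀ - Pa γ₀‖ +
        gramForm x (window k₀ k) (Pb γ₀ - Pa γ₀) := by
  obtain ⟨s, J, J', hs, -, -, hw⟩ := exists_regime_window hPa hPb γ₀ x e k₀ k
  set D := Pb γ₀ - Pa γ₀
  have h1 : rss Ja Jb x e k₀ γ₀ n k γ₀ - ∑ t ∈ range n, e t ^ 2 =
      2 * s * ⟪score x e (window k₀ k), D⟫ + gramForm x (window k₀ k) D := by
    rw [show rss Ja Jb x e k₀ γ₀ n k γ₀ = ∑ t ∈ range n, deviation Ja Jb x e k₀ γ₀ k t ^ 2 from rfl,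
      ← Finset.sum_sub_distrib, ← Finset.sum_subset (window_subset hk₀ hk)
        (fun t _ ht => by rw [deviation_of_notMem_window ht, sub_self]), inner_score, gramForm,
      Finset.mul_sum, ← Finset.sum_add_distrib]
    refine Finset.sum_congr rfl fun t ht => ?_
    rw [(hw t ht).2.2]
    have hs2 : s ^ 2 = 1 := by rw [← sq_abs, hs, one_pow]
    linear_combination ⟪x t, D⟫ ^ 2 * hs2
  rw [h1]
  refine (abs_add_le _ _).trans ?_
  rw [abs_of_nonneg (gramForm_nonneg _ _ _), abs_mul, abs_mul, hs, mul_one, abs_two, mul_assoc]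
  gcongr
  exact abs_real_inner_le_norm _ _

/-- Only the window contributes: the errors there are multiplied by the row of the other regime, and
the misfit `± ⟪x, D⟫` adds a deterministic term, bounded by Cauchy–Schwarz. -/
theorem norm_rowScore_sub_le {B : ℝ} (hB : ∀ t, ‖x t‖ ≤ B) (hk₀ : k₀ ≤ n) (hk : k ≤ n) :
    ‖rowScore Ja Jb x e k₀ γ₀ n k - rowScore Ja Jb x e k₀ γ₀ n k₀‖ ≤
      (‖Ja‖ + ‖Jb‖) * (2 * ‖score x e (window k₀ k)‖ +
        B * Real.sqrt ((window k₀ k).card * gramForm x (window k₀ k) (Pb γ₀ - Pa γ₀))) := by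
  obtain ⟨s, J, J', hs, hJ, hJ', hw⟩ := exists_regime_window hPa hPb γ₀ x e k₀ k
  set D := Pb γ₀ - Pa γ₀
  set c := ‖Ja‖ + ‖Jb‖
  have hdev0 : ∀ t, deviation Ja Jb x e k₀ γ₀ k₀ t = e t := fun t => by rw [deviation]; ring
  have h1 : rowScore Ja Jb x e k₀ γ₀ n k - rowScore Ja Jb x e k₀ γ₀ n k₀ =
      J (score x e (window k₀ k)) - J' (score x e (window k₀ k)) +
        s • J (∑ t ∈ window k₀ k, ⟪x t, D⟫ • x t) := by
    rw [rowScore, rowScore, score, score, ← Finset.sum_sub_distrib,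
      ← Finset.sum_subset (window_subset hk₀ hk) (fun t _ ht => by
        rw [deviation_of_notMem_window ht, row_eq_of_notMem_window ht, hdev0, sub_self]),
      score, map_sum, map_sum, map_sum, Finset.smul_sum, ← Finset.sum_sub_distrib,
      ← Finset.sum_add_distrib]
    refine Finset.sum_congr rfl fun t ht => ?_
    rw [(hw t ht).2.2, (hw t ht).1, (hw t ht).2.1, hdev0, map_smul, map_smul, map_smul]
    module
  rw [h1]
  calc _ ≤ ‖J (score x e (window k₀ k))‖ + ‖J' (score x e (window k₀ k))‖ +
        ‖s • J (∑ t ∈ window k₀ k, ⟪x t, D⟫ • x t)‖ :=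
        (norm_add_le _ _).trans (by gcongr; exact norm_sub_le _ _)
    _ ≤ c * ‖score x e (window k₀ k)‖ + c * ‖score x e (window k₀ k)‖ +
        c * (B * Real.sqrt ((window k₀ k).card * gramForm x (window k₀ k) D)) := by
        gcongr
        · exact J.le_of_opNorm_le hJ _
        · exact J'.le_of_opNorm_le hJ' _
        · rw [norm_smul, Real.norm_eq_abs, hs, one_mul]
          exact (J.le_of_opNorm_le hJ _).trans
            (by gcongr; exact norm_sum_inner_smul_le hB _ _)
    _ = _ := by ring

omit hPa hPb in
theorem norm_rowGram_sub_le {B : ℝ} (hB : ∀ t, ‖x t‖ ≤ B) (hk₀ : k₀ ≤ n) (hk : k ≤ n) :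
    ‖rowGram Ja Jb x n k - rowGram Ja Jb x n k₀‖ ≤
      2 * ((‖Ja‖ + ‖Jb‖) * B) ^ 2 * (window k₀ k).card := by
  rw [rowGram, rowGram, gramOp, gramOp, ← Finset.sum_sub_distrib,
    ← Finset.sum_subset (window_subset hk₀ hk) (fun t _ ht => by
        rw [row_eq_of_notMem_window ht, sub_self])]
  calc _ ≤ ∑ _t ∈ window k₀ k, 2 * ((‖Ja‖ + ‖Jb‖) * B) ^ 2 := by
        refine norm_sum_le_of_le _ fun t _ => (norm_sub_le _ _).trans ?_
        have h : ∀ k', ‖InnerProductSpace.rankOne ℝ (row Ja Jb x k' t) (row Ja Jb x k' t)‖ ≤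
            ((‖Ja‖ + ‖Jb‖) * B) ^ 2 := fun k' => (norm_rankOne_self_le _).trans (by
              gcongr; exact norm_row_le hB _ _)
        linarith [h k, h k₀]
    _ = _ := by rw [Finset.sum_const, nsmul_eq_mul]; ring

omit hPa hPb in
theorem rowScore_true (hk₀ : k₀ ≤ n) : rowScore Ja Jb x e k₀ γ₀ n k₀ =
    Ja (score x e (range k₀)) + Jb (score x e (Ico k₀ n)) := by
  rw [rowScore, score, ← Finset.sum_range_add_sum_Ico _ hk₀, score, score, map_sum, map_sum]
  congr 1
  · refine Finset.sum_congr rfl fun t ht => ?_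
    rw [map_smul, row, if_pos (by simpa using ht), deviation]
    congr 1; ring
  · refine Finset.sum_congr rfl fun t ht => ?_
    rw [map_smul, row, if_neg (by simp at ht; omega), deviation]
    congr 1; ring

theorem rowGram_true (hk₀ : k₀ ≤ n) : rowGram Ja Jb x n k₀ =
    Ja ∘L gramOp x (range k₀) ∘L Pa + Jb ∘L gramOp x (Ico k₀ n) ∘L Pb := by
  ext u
  rw [rowGram, gramOp_apply, ← Finset.sum_range_add_sum_Ico _ hk₀]
  simp only [add_apply, ContinuousLinearMap.comp_apply, gramOp_apply, map_sum]
  congr 1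
  · refine Finset.sum_congr rfl fun t ht => ?_
    rw [map_smul, row, if_pos (by simpa using ht), hPa]
  · refine Finset.sum_congr rfl fun t ht => ?_
    rw [map_smul, row, if_neg (by simp at ht; omega), hPb]

end TwoRegimes

namespace RegularSample

variable {ι F E : Type*} [NormedAddCommGroup F] [InnerProductSpace ℝ F]
  [NormedAddCommGroup E] [InnerProductSpace ℝ E]
  {l : Filter ι} {n k₀ kL kR : ι → ℕ} {x : ι → ℕ → F} {e : ι → ℕ → ℝ}
  {SL SR : F →L[ℝ] F} {σ : ℝ} {Ja Jb : F →L[ℝ] E} {γ₀ : E}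
  {Pa Pb : E →L[ℝ] F}

/-- Orders of magnitude near the true break. -/
theorem near_bounds (h : RegularSample l n k₀ kL kR x e (Pb γ₀ - Pa γ₀) SL SR σ)
    (hPa : ∀ z γ, ⟪Ja z, γ⟫ = ⟪z, Pa γ⟫) (hPb : ∀ z γ, ⟪Jb z, γ⟫ = ⟪z, Pb γ⟫) :
    ∃ C : ℝ, 0 ≤ C ∧ ∀ᶠ i in l, ∀ k,
      gramForm (x i) (window (k₀ i) k) (Pb γ₀ - Pa γ₀) < (n i : ℝ) ^ (0.35 : ℝ) →
      |rss Ja Jb (x i) (e i) (k₀ i) γ₀ (n i) k γ₀ - ∑ t ∈ range (n i), e i t ^ 2| ≤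
        C * (n i : ℝ) ^ (0.35 : ℝ) ∧
      ‖rowScore Ja Jb (x i) (e i) (k₀ i) γ₀ (n i) k -
        rowScore Ja Jb (x i) (e i) (k₀ i) γ₀ (n i) (k₀ i)‖ ≤ C * (n i : ℝ) ^ (0.475 : ℝ) ∧
      ‖rowScore Ja Jb (x i) (e i) (k₀ i) γ₀ (n i) k‖ ≤ C * (n i : ℝ) ^ (0.55 : ℝ) ∧
      ‖rowGram Ja Jb (x i) (n i) k - rowGram Ja Jb (x i) (n i) (k₀ i)‖ ≤
        C * (n i : ℝ) ^ (0.6 : ℝ) := by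
  obtain ⟨B, hB⟩ := h.bounded
  obtain ⟨C₁, hwidth⟩ := h.width
  set D := Pb γ₀ - Pa γ₀
  set c := ‖Ja‖ + ‖Jb‖ with hc
  have hc0 : 0 ≤ c := by positivity
  set C₂ := |C₁| with hC₂
  set B' := |B| with hB'
  have hB'' : ∀ i t, ‖x i t‖ ≤ B' := fun i t => (hB i t).trans (le_abs_self B)
  set K₁ := 2 * ‖D‖ + 1
  set K₂ := c * (2 + B' * Real.sqrt C₂)
  set K₃ := K₂ + 3 * c
  set K₄ := 2 * (c * B') ^ 2 * C₂
  refine ⟨K₁ + K₃ + K₄ , by positivity, ?_⟩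
  have hsz : ∀ᶠ i in l, (1 : ℝ) ≤ n i :=
    (h.size.eventually_ge_atTop 1).mono fun _ hi => by exact_mod_cast hi
  filter_upwards [h.near_of_not_far, hwidth, h.order, h.score_le, h.score_window_le, hsz]
    with i hnear hwidth hord hsc hscw hn k hk
  obtain ⟨hkL, hkR⟩ := hnear k hk
  have hkn : k ≤ n i := by omega
  have hk₀n : k₀ i ≤ n i := by omega
  have hmono : ∀ {a b : ℝ}, a ≤ b → (n i : ℝ) ^ a ≤ (n i : ℝ) ^ b :=
    fun hab => Real.rpow_le_rpow_of_exponent_le hn hab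
  have hscw := hscw k hkL hkR
  have hcard : ((window (k₀ i) k).card : ℝ) ≤ C₂ * (n i : ℝ) ^ (0.6 : ℝ) := by
    have h1 : (window (k₀ i) k).card + kL i ≤ kR i := by
      simp only [window, Nat.card_Ico]; omega
    have h2 : ((window (k₀ i) k).card : ℝ) + kL i ≤ kR i := by exact_mod_cast h1
    calc ((window (k₀ i) k).card : ℝ) ≤ C₁ * (n i : ℝ) ^ (0.6 : ℝ) := by linarith
      _ ≤ _ := by gcongr; exact le_abs_self _
  have hsqrt : Real.sqrt ((window (k₀ i) k).card * gramForm (x i) (window (k₀ i) k) D) ≤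
      Real.sqrt C₂ * (n i : ℝ) ^ (0.475 : ℝ) := by
    have h1 : (n i : ℝ) ^ (0.475 : ℝ) = Real.sqrt ((n i : ℝ) ^ (0.6 : ℝ) * (n i : ℝ) ^ (0.35 : ℝ)) := by
      rw [← Real.rpow_add (by linarith), Real.sqrt_eq_rpow, ← Real.rpow_mul (by linarith)]
      norm_num
    rw [h1, ← Real.sqrt_mul (by positivity)]
    apply Real.sqrt_le_sqrt
    rw [← mul_assoc]
    have := gramForm_nonneg (x i) (window (k₀ i) k) D
    gcongr
  have hS := norm_rowScore_sub_le (e := e i) (γ₀ := γ₀) hPa hPb (hB'' i) hk₀n hkn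
  have hS' : ‖rowScore Ja Jb (x i) (e i) (k₀ i) γ₀ (n i) k -
        rowScore Ja Jb (x i) (e i) (k₀ i) γ₀ (n i) (k₀ i)‖ ≤ K₂ * (n i : ℝ) ^ (0.475 : ℝ) := by
    refine hS.trans ?_
    calc _ ≤ c * (2 * (n i : ℝ) ^ (0.475 : ℝ) + B' * (Real.sqrt C₂ * (n i : ℝ) ^ (0.475 : ℝ))) := by
          gcongr
          exact hscw.trans (hmono (by norm_num))
      _ = _ := by ring
  have hT : ‖rowScore Ja Jb (x i) (e i) (k₀ i) γ₀ (n i) (k₀ i)‖ ≤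
      3 * c * (n i : ℝ) ^ (0.55 : ℝ) := by
    rw [rowScore_true hk₀n]
    have h1 := hsc _ hk₀n
    have h2 := norm_score_Ico_le hk₀n h1 (hsc _ le_rfl)
    calc _ ≤ ‖Ja‖ * (n i : ℝ) ^ (0.55 : ℝ) + ‖Jb‖ * (2 * (n i : ℝ) ^ (0.55 : ℝ)) :=
          (norm_add_le _ _).trans (add_le_add (Ja.le_opNorm_of_le h1) (Jb.le_opNorm_of_le h2))
      _ ≤ c * (n i : ℝ) ^ (0.55 : ℝ) + c * (2 * (n i : ℝ) ^ (0.55 : ℝ)) := by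
          gcongr
          · linarith [norm_nonneg Jb]
          · linarith [norm_nonneg Ja]
      _ = _ := by ring
  have hC : 0 ≤ K₁ ∧ 0 ≤ K₂ ∧ 0 ≤ K₄ := ⟨by positivity, by positivity, by positivity⟩
  have hp : ∀ a : ℝ, 0 ≤ (n i : ℝ) ^ a := fun a => by positivity
  refine ⟨?_, ?_, ?_, ?_⟩
  · refine (abs_rss_sub_le hPa hPb hk₀n hkn).trans ?_
    calc _ ≤ 2 * (n i : ℝ) ^ (0.35 : ℝ) * ‖D‖ + (n i : ℝ) ^ (0.35 : ℝ) := by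
          gcongr
          exact hscw.trans (hmono (by norm_num))
      _ = K₁ * (n i : ℝ) ^ (0.35 : ℝ) := by ring
      _ ≤ _ := by gcongr; linarith
  · refine hS'.trans ?_
    gcongr; linarith
  · calc _ ≤ K₂ * (n i : ℝ) ^ (0.475 : ℝ) + 3 * c * (n i : ℝ) ^ (0.55 : ℝ) := by
          refine le_trans ?_ (add_le_add hS' hT)
          simpa using norm_add_le (rowScore Ja Jb (x i) (e i) (k₀ i) γ₀ (n i) k -
            rowScore Ja Jb (x i) (e i) (k₀ i) γ₀ (n i) (k₀ i))
            (rowScore Ja Jb (x i) (e i) (k₀ i) γ₀ (n i) (k₀ i))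
      _ ≤ K₂ * (n i : ℝ) ^ (0.55 : ℝ) + 3 * c * (n i : ℝ) ^ (0.55 : ℝ) := by
          gcongr _ * ?_ + _
          exact hmono (by norm_num)
      _ = K₃ * (n i : ℝ) ^ (0.55 : ℝ) := by ring
      _ ≤ _ := by gcongr; linarith
  · refine (norm_rowGram_sub_le (hB'' i) hk₀n hkn).trans ?_
    calc 2 * (c * B') ^ 2 * ((window (k₀ i) k).card : ℝ) ≤
          2 * (c * B') ^ 2 * (C₂ * (n i : ℝ) ^ (0.6 : ℝ)) := by gcongr
      _ = K₄ * (n i : ℝ) ^ (0.6 : ℝ) := by ring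
      _ ≤ _ := by gcongr; linarith

end RegularSample
end StructuralBreak
end

noncomputable section
namespace StructuralBreak
open scoped RealInnerProductSpace
open Finset (range Ico)

/-! ### Limits along candidates near the true break -/

theorem tendsto_rpow_size_zero {ι : Type*} {l : Filter ι} {n : ι → ℕ} (hn : Tendsto n l atTop)
    {a : ℝ} (ha : a < 0) : Tendsto (fun i => (n i : ℝ) ^ a) l (𝓝 0) := by
  have := (tendsto_rpow_neg_atTop (neg_pos.2 ha)).comp (tendsto_natCast_atTop_atTop.comp hn)
  simpa [Function.comp_def] using this

/-- The limit of the normalized Gram operators of the designs. -/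
def gramLimit {F E : Type*} [NormedAddCommGroup F] [InnerProductSpace ℝ F]
    [NormedAddCommGroup E] [InnerProductSpace ℝ E] (Ja Jb : F →L[ℝ] E) (Pa Pb : E →L[ℝ] F)
    (SL SR : F →L[ℝ] F) : E →L[ℝ] E :=
  Ja ∘L SL ∘L Pa + Jb ∘L SR ∘L Pb

namespace RegularSample

variable {ι F E : Type*} [NormedAddCommGroup F] [InnerProductSpace ℝ F]
  [NormedAddCommGroup E] [InnerProductSpace ℝ E]
  {l : Filter ι} {n k₀ kL kR : ι → ℕ} {x : ι → ℕ → F} {e : ι → ℕ → ℝ} {D : F}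
  {SL SR : F →L[ℝ] F} {σ : ℝ} {Ja Jb : F →L[ℝ] E} {γ₀ : E}
  {Pa Pb : E →L[ℝ] F}

theorem gramLimit_coercive (h : RegularSample l n k₀ kL kR x e D SL SR σ)
    (hPa : ∀ z γ, ⟪Ja z, γ⟫ = ⟪z, Pa γ⟫) (hPb : ∀ z γ, ⟪Jb z, γ⟫ = ⟪z, Pb γ⟫) {c : ℝ} (hc : 0 < c)
    (hP : ∀ γ, c * ‖γ‖ ^ 2 ≤ ‖Pa γ‖ ^ 2 + ‖Pb γ‖ ^ 2) :
    ∃ c' : ℝ, 0 < c' ∧ ∀ u, c' * ‖u‖ ^ 2 ≤ ⟪gramLimit Ja Jb Pa Pb SL SR u, u⟫ := by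
  obtain ⟨cL, hcL, hSL⟩ := h.coercive_left
  obtain ⟨cR, hcR, hSR⟩ := h.coercive_right
  refine ⟨min cL cR * c, by positivity, fun u => ?_⟩
  have h1 : ⟪gramLimit Ja Jb Pa Pb SL SR u, u⟫ = ⟪SL (Pa u), Pa u⟫ + ⟪SR (Pb u), Pb u⟫ := by
    simp [gramLimit, inner_add_left, hPa, hPb]
  rw [h1]
  calc min cL cR * c * ‖u‖ ^ 2 = min cL cR * (c * ‖u‖ ^ 2) := by ring
    _ ≤ min cL cR * (‖Pa u‖ ^ 2 + ‖Pb u‖ ^ 2) := by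
        gcongr
        exact hP u
    _ ≤ cL * ‖Pa u‖ ^ 2 + cR * ‖Pb u‖ ^ 2 := by
        rw [mul_add]
        gcongr
        · exact min_le_left _ _
        · exact min_le_right _ _
    _ ≤ _ := add_le_add (hSL _) (hSR _)

theorem tendsto_rowGram_true (h : RegularSample l n k₀ kL kR x e D SL SR σ)
    (hPa : ∀ z γ, ⟪Ja z, γ⟫ = ⟪z, Pa γ⟫) (hPb : ∀ z γ, ⟪Jb z, γ⟫ = ⟪z, Pb γ⟫) :
    Tendsto (fun i => (n i : ℝ)⁻¹ • rowGram Ja Jb (x i) (n i) (k₀ i)) l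
      (𝓝 (gramLimit Ja Jb Pa Pb SL SR)) := by
  have hcont : ∀ (J : F →L[ℝ] E) (P : E →L[ℝ] F), Continuous fun S : F →L[ℝ] F => J ∘L S ∘L P :=
    fun J P => by fun_prop
  have h1 := ((hcont Ja Pa).tendsto SL).comp h.gram_left
  have h2 := ((hcont Jb Pb).tendsto SR).comp h.gram_right
  refine (h1.add h2).congr' ?_
  filter_upwards [h.order] with i hi
  rw [rowGram_true hPa hPb (hi.2.1.trans hi.2.2)]
  simp

variable {κ : ι → ℕ}

theorem tendsto_rowGram (h : RegularSample l n k₀ kL kR x e (Pb γ₀ - Pa γ₀) SL SR σ)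
    (hPa : ∀ z γ, ⟪Ja z, γ⟫ = ⟪z, Pa γ⟫) (hPb : ∀ z γ, ⟪Jb z, γ⟫ = ⟪z, Pb γ⟫)
    (hκ : ∀ᶠ i in l,
      gramForm (x i) (window (k₀ i) (κ i)) (Pb γ₀ - Pa γ₀) < (n i : ℝ) ^ (0.35 : ℝ)) :
    Tendsto (fun i => (n i : ℝ)⁻¹ • rowGram Ja Jb (x i) (n i) (κ i)) l
      (𝓝 (gramLimit Ja Jb Pa Pb SL SR)) := by
  obtain ⟨C, hC, hb⟩ := h.near_bounds (Ja := Ja) (Jb := Jb) hPa hPb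
  have hdiff : Tendsto (fun i => (n i : ℝ)⁻¹ • (rowGram Ja Jb (x i) (n i) (κ i) -
      rowGram Ja Jb (x i) (n i) (k₀ i))) l (𝓝 0) := by
    have h0 : Tendsto (fun i => C * (n i : ℝ) ^ (-0.4 : ℝ)) l (𝓝 0) := by
      simpa using (tendsto_rpow_size_zero h.size (show (-0.4 : ℝ) < 0 by norm_num)).const_mul C
    refine squeeze_zero_norm' ?_ h0
    filter_upwards [hb, hκ, h.eventually_size_pos] with i hb hκ hn
    rw [norm_smul, norm_inv, Real.norm_of_nonneg hn.le, inv_mul_le_iff₀ hn]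
    refine (hb _ hκ).2.2.2.trans_eq ?_
    rw [mul_left_comm, mul_comm (n i : ℝ), ← Real.rpow_add_one hn.ne']; norm_num
  have := (h.tendsto_rowGram_true hPa hPb).add hdiff
  rw [add_zero] at this
  refine this.congr fun i => ?_
  rw [← smul_add, add_sub_cancel]

variable {Hop H₁ H₂ : E →L[ℝ] E} {w w₁ w₂ : E} {d d₁ d₂ : ι → E} {κ₁ κ₂ : ι → ℕ}

theorem eventually_rowGram_coercive
    (h : RegularSample l n k₀ kL kR x e (Pb γ₀ - Pa γ₀) SL SR σ)
    (hPa : ∀ z γ, ⟪Ja z, γ⟫ = ⟪z, Pa γ⟫) (hPb : ∀ z γ, ⟪Jb z, γ⟫ = ⟪z, Pb γ⟫) {c : ℝ} (hc : 0 < c)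
    (hP : ∀ γ, c * ‖γ‖ ^ 2 ≤ ‖Pa γ‖ ^ 2 + ‖Pb γ‖ ^ 2) (hH : ∀ u, 0 ≤ ⟪Hop u, u⟫)
    (hκ : ∀ᶠ i in l,
      gramForm (x i) (window (k₀ i) (κ i)) (Pb γ₀ - Pa γ₀) < (n i : ℝ) ^ (0.35 : ℝ)) :
    ∃ c' : ℝ, 0 < c' ∧ ∀ᶠ i in l, ∀ u,
      c' * n i * ‖u‖ ≤ ‖(rowGram Ja Jb (x i) (n i) (κ i) + Hop) u‖ := by
  obtain ⟨c', hc', hV⟩ := h.gramLimit_coercive hPa hPb hc hP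
  refine ⟨c' / 2, by positivity, ?_⟩
  filter_upwards [(h.tendsto_rowGram hPa hPb hκ).eventually (eventually_coercive hc' hV),
    h.eventually_size_pos] with i hi hn u
  refine le_norm_of_coercive ?_
  have h1 := hi u
  rw [smul_apply, real_inner_smul_left, inv_mul_eq_div, le_div_iff₀ hn] at h1
  rw [add_apply, inner_add_left]
  linarith [hH u]

/-- The (generalized) least-squares estimates with break near the true one are consistent. -/
theorem estimate_error_le (h : RegularSample l n k₀ kL kR x e (Pb γ₀ - Pa γ₀) SL SR σ)
    (hPa : ∀ z γ, ⟪Ja z, γ⟫ = ⟪z, Pa γ⟫) (hPb : ∀ z γ, ⟪Jb z, γ⟫ = ⟪z, Pb γ⟫) {c : ℝ} (hc : 0 < c)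
    (hP : ∀ γ, c * ‖γ‖ ^ 2 ≤ ‖Pa γ‖ ^ 2 + ‖Pb γ‖ ^ 2) (hH : ∀ u, 0 ≤ ⟪Hop u, u⟫)
    (hκ : ∀ᶠ i in l,
      gramForm (x i) (window (k₀ i) (κ i)) (Pb γ₀ - Pa γ₀) < (n i : ℝ) ^ (0.35 : ℝ))
    (hd : ∀ᶠ i in l, (rowGram Ja Jb (x i) (n i) (κ i) + Hop) (d i) =
      rowScore Ja Jb (x i) (e i) (k₀ i) γ₀ (n i) (κ i) + w) :
    ∃ C : ℝ, 0 ≤ C ∧ ∀ᶠ i in l, ‖d i‖ ≤ C * (n i : ℝ) ^ (-0.45 : ℝ) := by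
  obtain ⟨C, hC, hb⟩ := h.near_bounds (Ja := Ja) (Jb := Jb) hPa hPb
  obtain ⟨c', hc', hcoer⟩ := h.eventually_rowGram_coercive hPa hPb hc hP hH hκ
  refine ⟨(C + ‖w‖) / c', by positivity, ?_⟩
  filter_upwards [hb, hκ, hd, hcoer, h.size.eventually_ge_atTop 1] with i hb hκ hd hcoer hn
  have hn1 : (1 : ℝ) ≤ n i := by exact_mod_cast hn
  have hn0 : (0 : ℝ) < n i := by linarith
  have h1 := hcoer (d i)
  rw [hd] at h1
  have h2 : c' * n i * ‖d i‖ ≤ (C + ‖w‖) * (n i : ℝ) ^ (0.55 : ℝ) := by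
    refine h1.trans ((norm_add_le _ _).trans ?_)
    rw [add_mul]
    refine add_le_add (hb _ hκ).2.2.1 (le_mul_of_one_le_right (norm_nonneg _) ?_)
    exact Real.one_le_rpow hn1 (by norm_num)
  have h3 : (n i : ℝ) ^ (0.55 : ℝ) = (n i : ℝ) ^ (-0.45 : ℝ) * n i := by
    rw [← Real.rpow_add_one hn0.ne']; norm_num
  rw [h3, ← mul_assoc, mul_right_comm] at h2
  have h4 := le_of_mul_le_mul_right h2 hn0
  rwa [div_mul_eq_mul_div, le_div_iff₀ hc', mul_comm]

/-- Two (generalized) least-squares estimates with breaks near the true one are asymptotically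
equivalent. -/
theorem estimates_equivalent (h : RegularSample l n k₀ kL kR x e (Pb γ₀ - Pa γ₀) SL SR σ)
    (hPa : ∀ z γ, ⟪Ja z, γ⟫ = ⟪z, Pa γ⟫) (hPb : ∀ z γ, ⟪Jb z, γ⟫ = ⟪z, Pb γ⟫) {c : ℝ} (hc : 0 < c)
    (hP : ∀ γ, c * ‖γ‖ ^ 2 ≤ ‖Pa γ‖ ^ 2 + ‖Pb γ‖ ^ 2)
    (hH₁ : ∀ u, 0 ≤ ⟪H₁ u, u⟫) (hH₂ : ∀ u, 0 ≤ ⟪H₂ u, u⟫)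
    (hκ₁ : ∀ᶠ i in l,
      gramForm (x i) (window (k₀ i) (κ₁ i)) (Pb γ₀ - Pa γ₀) < (n i : ℝ) ^ (0.35 : ℝ))
    (hκ₂ : ∀ᶠ i in l,
      gramForm (x i) (window (k₀ i) (κ₂ i)) (Pb γ₀ - Pa γ₀) < (n i : ℝ) ^ (0.35 : ℝ))
    (hd₁ : ∀ᶠ i in l, (rowGram Ja Jb (x i) (n i) (κ₁ i) + H₁) (d₁ i) =
      rowScore Ja Jb (x i) (e i) (k₀ i) γ₀ (n i) (κ₁ i) + w₁)
    (hd₂ : ∀ᶠ i in l, (rowGram Ja Jb (x i) (n i) (κ₂ i) + H₂) (d₂ i) =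
      rowScore Ja Jb (x i) (e i) (k₀ i) γ₀ (n i) (κ₂ i) + w₂) :
    Tendsto (fun i => Real.sqrt (n i) • (d₁ i - d₂ i)) l (𝓝 0) := by
  obtain ⟨C, hC, hb⟩ := h.near_bounds (Ja := Ja) (Jb := Jb) hPa hPb
  obtain ⟨c', hc', hcoer⟩ := h.eventually_rowGram_coercive hPa hPb hc hP hH₁ hκ₁
  obtain ⟨C', hC', hle⟩ := h.estimate_error_le hPa hPb hc hP hH₂ hκ₂ hd₂
  set M := 2 * C + ‖w₁‖ + ‖w₂‖ + (2 * C + ‖H₁‖ + ‖H₂‖) * C' with hM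
  -- Score difference `0.475`, minus `1` for inverting the Gram operator, plus `1 / 2` for the
  -- rescaling.
  have h0 : Tendsto (fun i => M / c' * (n i : ℝ) ^ (-0.025 : ℝ)) l (𝓝 0) := by
    simpa using (tendsto_rpow_size_zero h.size (show (-0.025 : ℝ) < 0 by norm_num)).const_mul _
  refine squeeze_zero_norm' ?_ h0
  filter_upwards [hb, hκ₁, hκ₂, hd₁, hd₂, hcoer, hle, h.size.eventually_ge_atTop 1]
    with i hb hκ₁ hκ₂ hd₁ hd₂ hcoer hle hn
  have hn1 : (1 : ℝ) ≤ n i := by exact_mod_cast hn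
  have hn0 : (0 : ℝ) < n i := by linarith
  have hone : ∀ {a : ℝ}, 0 ≤ a → 1 ≤ (n i : ℝ) ^ a := fun ha => Real.one_le_rpow hn1 ha
  set G₁ := rowGram Ja Jb (x i) (n i) (κ₁ i)
  set G₂ := rowGram Ja Jb (x i) (n i) (κ₂ i)
  set G₀ := rowGram Ja Jb (x i) (n i) (k₀ i)
  set s₁ := rowScore Ja Jb (x i) (e i) (k₀ i) γ₀ (n i) (κ₁ i)
  set s₂ := rowScore Ja Jb (x i) (e i) (k₀ i) γ₀ (n i) (κ₂ i)
  set s₀ := rowScore Ja Jb (x i) (e i) (k₀ i) γ₀ (n i) (k₀ i)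
  obtain ⟨-, hs₁, -, hG₁⟩ := hb _ hκ₁
  obtain ⟨-, hs₂, -, hG₂⟩ := hb _ hκ₂
  -- The difference of the two normal equations, with scores and Gram operators both compared with
  -- those of the true break. The operator difference, of order `n^0.6`, acts on `d₂ = O(n^(-0.45))`
  -- and so contributes only `n^0.15`.
  have heq : (G₁ + H₁) (d₁ i - d₂ i) =
      (s₁ - s₀) - (s₂ - s₀) + w₁ - w₂ + ((G₂ - G₀) - (G₁ - G₀) + H₂ - H₁) (d₂ i) := by
    have e2 : (G₂ + H₂) (d₂ i) = s₂ + w₂ := hd₂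
    rw [map_sub, hd₁]
    simp only [sub_apply, add_apply] at e2 ⊢
    rw [eq_sub_of_add_eq e2.symm]
    abel
  have hnorm : ‖(G₁ + H₁) (d₁ i - d₂ i)‖ ≤ M * (n i : ℝ) ^ (0.475 : ℝ) := by
    rw [heq]
    have hop : ‖(G₂ - G₀) - (G₁ - G₀) + H₂ - H₁‖ ≤ (2 * C + ‖H₁‖ + ‖H₂‖) * (n i : ℝ) ^ (0.6 : ℝ) := by
      have b1 : ‖H₁‖ ≤ ‖H₁‖ * (n i : ℝ) ^ (0.6 : ℝ) :=
        le_mul_of_one_le_right (norm_nonneg _) (hone (by norm_num))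
      have b2 : ‖H₂‖ ≤ ‖H₂‖ * (n i : ℝ) ^ (0.6 : ℝ) :=
        le_mul_of_one_le_right (norm_nonneg _) (hone (by norm_num))
      have b3 := norm_sub_le (G₂ - G₀ - (G₁ - G₀) + H₂) H₁
      have b4 := norm_add_le (G₂ - G₀ - (G₁ - G₀)) H₂
      have b5 := norm_sub_le (G₂ - G₀) (G₁ - G₀)
      linarith
    have hlast : ‖((G₂ - G₀) - (G₁ - G₀) + H₂ - H₁) (d₂ i)‖ ≤
        (2 * C + ‖H₁‖ + ‖H₂‖) * C' * (n i : ℝ) ^ (0.475 : ℝ) := by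
      calc _ ≤ (2 * C + ‖H₁‖ + ‖H₂‖) * (n i : ℝ) ^ (0.6 : ℝ) * (C' * (n i : ℝ) ^ (-0.45 : ℝ)) :=
            (ContinuousLinearMap.le_of_opNorm_le _ hop _).trans (by gcongr)
        _ = (2 * C + ‖H₁‖ + ‖H₂‖) * C' * (n i : ℝ) ^ (0.15 : ℝ) := by
            rw [show (0.15 : ℝ) = 0.6 + -0.45 by norm_num, Real.rpow_add hn0]; ring
        _ ≤ _ := by
            gcongr 1
            exact Real.rpow_le_rpow_of_exponent_le hn1 (by norm_num)
    have b1 : ‖w₁‖ ≤ ‖w₁‖ * (n i : ℝ) ^ (0.475 : ℝ) :=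
      le_mul_of_one_le_right (norm_nonneg _) (hone (by norm_num))
    have b2 : ‖w₂‖ ≤ ‖w₂‖ * (n i : ℝ) ^ (0.475 : ℝ) :=
      le_mul_of_one_le_right (norm_nonneg _) (hone (by norm_num))
    have b3 := norm_add_le (s₁ - s₀ - (s₂ - s₀) + w₁ - w₂) (((G₂ - G₀) - (G₁ - G₀) + H₂ - H₁) (d₂ i))
    have b4 := norm_sub_le (s₁ - s₀ - (s₂ - s₀) + w₁) w₂
    have b5 := norm_add_le (s₁ - s₀ - (s₂ - s₀)) w₁
    have b6 := norm_sub_le (s₁ - s₀) (s₂ - s₀)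
    rw [hM]
    linarith
  have hfin := (hcoer (d₁ i - d₂ i)).trans hnorm
  rw [norm_smul, Real.norm_of_nonneg (Real.sqrt_nonneg _), Real.sqrt_eq_rpow, div_mul_eq_mul_div,
    le_div_iff₀ hc']
  have e1 : (n i : ℝ) ^ (0.475 : ℝ) = (n i : ℝ) ^ (-0.025 : ℝ) * (n i : ℝ) ^ (1 / 2 : ℝ) := by
    rw [← Real.rpow_add hn0]; norm_num
  have e2 : (n i : ℝ) = (n i : ℝ) ^ (1 / 2 : ℝ) * (n i : ℝ) ^ (1 / 2 : ℝ) := by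
    rw [← Real.rpow_add hn0]; norm_num
  have hp : 0 < (n i : ℝ) ^ (1 / 2 : ℝ) := by positivity
  rw [e1] at hfin
  nth_rewrite 1 [e2] at hfin
  refine le_of_mul_le_mul_right ?_ hp
  linarith

/-- The residual variance with break near the true one is consistent. -/
theorem tendsto_rss (h : RegularSample l n k₀ kL kR x e (Pb γ₀ - Pa γ₀) SL SR σ)
    (hPa : ∀ z γ, ⟪Ja z, γ⟫ = ⟪z, Pa γ⟫) (hPb : ∀ z γ, ⟪Jb z, γ⟫ = ⟪z, Pb γ⟫)
    (hκ : ∀ᶠ i in l,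
      gramForm (x i) (window (k₀ i) (κ i)) (Pb γ₀ - Pa γ₀) < (n i : ℝ) ^ (0.35 : ℝ))
    {C' : ℝ} (hd : ∀ᶠ i in l, ‖d i‖ ≤ C' * (n i : ℝ) ^ (-0.45 : ℝ)) :
    Tendsto (fun i => rss Ja Jb (x i) (e i) (k₀ i) γ₀ (n i) (κ i) (γ₀ + d i) / n i) l
      (𝓝 (σ ^ 2)) := by
  obtain ⟨C, hC, hb⟩ := h.near_bounds (Ja := Ja) (Jb := Jb) hPa hPb
  have hd0 : Tendsto d l (𝓝 0) := by
    refine squeeze_zero_norm' hd ?_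
    simpa using (tendsto_rpow_size_zero h.size (show (-0.45 : ℝ) < 0 by norm_num)).const_mul C'
  have h1 : Tendsto (fun i => (rss Ja Jb (x i) (e i) (k₀ i) γ₀ (n i) (κ i) γ₀ -
      ∑ t ∈ range (n i), e i t ^ 2) / n i) l (𝓝 0) := by
    have h0 : Tendsto (fun i => C * (n i : ℝ) ^ (-0.65 : ℝ)) l (𝓝 0) := by
      simpa using (tendsto_rpow_size_zero h.size (show (-0.65 : ℝ) < 0 by norm_num)).const_mul C
    refine squeeze_zero_norm' ?_ h0
    filter_upwards [hb, hκ, h.eventually_size_pos] with i hb hκ hn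
    rw [norm_div, Real.norm_of_nonneg hn.le, div_le_iff₀ hn, mul_assoc, ← Real.rpow_add_one hn.ne']
    refine (hb _ hκ).1.trans_eq ?_
    norm_num
  have h2 : Tendsto (fun i => 2 * ⟪rowScore Ja Jb (x i) (e i) (k₀ i) γ₀ (n i) (κ i), d i⟫ / n i) l
      (𝓝 0) := by
    have h0 : Tendsto (fun i => 2 * (C * C') * (n i : ℝ) ^ (-0.9 : ℝ)) l (𝓝 0) := by
      simpa using (tendsto_rpow_size_zero h.size (show (-0.9 : ℝ) < 0 by norm_num)).const_mul _
    refine squeeze_zero_norm' ?_ h0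
    filter_upwards [hb, hκ, hd, h.eventually_size_pos] with i hb hκ hd hn
    rw [norm_div, Real.norm_of_nonneg hn.le, div_le_iff₀ hn, norm_mul, Real.norm_two]
    calc _ ≤ 2 * ((C * (n i : ℝ) ^ (0.55 : ℝ)) * (C' * (n i : ℝ) ^ (-0.45 : ℝ))) := by
          gcongr
          rw [Real.norm_eq_abs]
          exact (abs_real_inner_le_norm _ _).trans (by gcongr; exact (hb _ hκ).2.2.1)
      _ = 2 * (C * C') * ((n i : ℝ) ^ (0.55 : ℝ) * (n i : ℝ) ^ (-0.45 : ℝ)) := by ring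
      _ = _ := by
          rw [mul_assoc _ _ (n i : ℝ), ← Real.rpow_add_one hn.ne', ← Real.rpow_add hn]; norm_num
  have h3 : Tendsto (fun i => ⟪((n i : ℝ)⁻¹ • rowGram Ja Jb (x i) (n i) (κ i)) (d i), d i⟫) l
      (𝓝 0) := by
    have h4 : Tendsto (fun i => ((n i : ℝ)⁻¹ • rowGram Ja Jb (x i) (n i) (κ i)) (d i)) l
        (𝓝 (gramLimit Ja Jb Pa Pb SL SR 0)) :=
      (isBoundedBilinearMap_apply.continuous.tendsto (gramLimit Ja Jb Pa Pb SL SR, (0 : E))).comp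
        ((h.tendsto_rowGram hPa hPb hκ).prodMk_nhds hd0)
    have h5 := Tendsto.inner (𝕜 := ℝ) h4 hd0
    rwa [inner_zero_right] at h5
  have := ((h.error.add h1).sub h2).add h3
  simp only [add_zero, sub_zero] at this
  refine this.congr fun i => ?_
  rw [rss_eq (γ₀ + d i), add_sub_cancel_left, smul_apply, real_inner_smul_left]
  ring

end RegularSample
end StructuralBreak
end

noncomputable section
namespace StructuralBreak
open scoped RealInnerProductSpace
open Finset (range Ico)

/-! ### Least squares and posterior energy -/

section Energy

variable {F E : Type*} [NormedAddCommGroup F] [InnerProductSpace ℝ F]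
  [NormedAddCommGroup E] [InnerProductSpace ℝ E]
  {Ja Jb : F →L[ℝ] E} {x : ℕ → F} {e : ℕ → ℝ} {n k₀ k : ℕ} {γ₀ : E}

theorem inner_rowGram_comm (u v : E) :
    ⟪rowGram Ja Jb x n k u, v⟫ = ⟪u, rowGram Ja Jb x n k v⟫ := by
  rw [rowGram, gramOp_apply, gramOp_apply, sum_inner, inner_sum]
  refine Finset.sum_congr rfl fun t _ => ?_
  rw [real_inner_smul_left, real_inner_smul_right, real_inner_comm u]; ring

theorem inner_rowGram_nonneg (u : E) : 0 ≤ ⟪rowGram Ja Jb x n k u, u⟫ := by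
  rw [rowGram, inner_gramOp]; exact gramForm_nonneg _ _ _

/-- The normal equation. -/
theorem rowGram_eq_of_isMin {γ : E}
    (hmin : ∀ γ', rss Ja Jb x e k₀ γ₀ n k γ ≤ rss Ja Jb x e k₀ γ₀ n k γ') :
    rowGram Ja Jb x n k (γ - γ₀) = rowScore Ja Jb x e k₀ γ₀ n k := by
  set G := rowGram Ja Jb x n k with hG
  set s := rowScore Ja Jb x e k₀ γ₀ n k with hs
  set d := γ - γ₀ with hd
  set r := G d - s with hr
  by_contra hne
  have hrpos : 0 < ‖r‖ ^ 2 := by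
    have : r ≠ 0 := sub_ne_zero.2 hne
    positivity
  set g := ⟪G r, r⟫ with hg
  have hg0 : 0 ≤ g := inner_rowGram_nonneg r
  -- Length of a gradient step that would lower the sum of squares; `g + 1` instead of `g` because
  -- `g` may vanish.
  set τ := ‖r‖ ^ 2 / (g + 1) with hτ
  have h := hmin (γ₀ + (d - τ • r))
  rw [rss_eq γ, rss_eq (γ₀ + (d - τ • r)), add_sub_cancel_left] at h
  simp only [← hG, ← hs, ← hd, map_sub, map_smul, inner_sub_left, inner_sub_right,
    real_inner_smul_left, real_inner_smul_right] at h
  have hsym : ⟪G r, d⟫ = ⟪G d, r⟫ := by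
    rw [hG, inner_rowGram_comm, real_inner_comm]
  have hrr : ⟪G d, r⟫ - ⟪s, r⟫ = ‖r‖ ^ 2 := by
    rw [← inner_sub_left, ← hr, real_inner_self_eq_norm_sq]
  rw [hsym, ← hg] at h
  have h1 : 2 * τ * ‖r‖ ^ 2 ≤ τ ^ 2 * g := by rw [← hrr]; linarith
  have h2 : τ * (g + 1) = ‖r‖ ^ 2 := by rw [hτ]; field_simp
  have hτ0 : 0 < τ := by positivity
  rw [← h2] at h1
  nlinarith [mul_pos hτ0 hτ0, mul_nonneg (mul_pos hτ0 hτ0).le hg0]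

/-- The exponent of the posterior of `γ` given the break `k`, after integrating out the variance. -/
def energy (Ja Jb : F →L[ℝ] E) (x : ℕ → F) (e : ℕ → ℝ) (k₀ : ℕ) (γ₀ : E) (Hop : E →L[ℝ] E) (m : E)
    (b : ℝ) (n k : ℕ) (γ : E) : ℝ :=
  b + (rss Ja Jb x e k₀ γ₀ n k γ + ⟪Hop (γ - m), γ - m⟫) / 2

variable {Hop : E →L[ℝ] E} {m : E} {b : ℝ}

/-- Completing the square: `d` solves the normal equation penalized by the prior, so the term linear
in `v` vanishes. -/
theorem energy_completed (hsym : ∀ u v, ⟪Hop u, v⟫ = ⟪u, Hop v⟫) {d : E}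
    (hd : (rowGram Ja Jb x n k + Hop) d = rowScore Ja Jb x e k₀ γ₀ n k + Hop (m - γ₀)) (v : E) :
    energy Ja Jb x e k₀ γ₀ Hop m b n k (γ₀ + d + v) =
      energy Ja Jb x e k₀ γ₀ Hop m b n k (γ₀ + d) +
        ⟪(rowGram Ja Jb x n k + Hop) v, v⟫ / 2 := by
  set G := rowGram Ja Jb x n k with hG
  set s := rowScore Ja Jb x e k₀ γ₀ n k with hs
  rw [energy, energy, rss_eq (γ₀ + d + v), rss_eq (γ₀ + d), ← hG, ← hs]
  have h1 : γ₀ + d + v - γ₀ = d + v := by abel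
  have h2 : γ₀ + d - γ₀ = d := by abel
  have h3 : γ₀ + d + v - m = (γ₀ + d - m) + v := by abel
  rw [h1, h2, h3]
  set y := γ₀ + d - m with hy
  have hkey : ⟪G d, v⟫ + ⟪Hop y, v⟫ = ⟪s, v⟫ := by
    rw [← inner_add_left]
    congr 1
    have : Hop y = Hop d - Hop (m - γ₀) := by rw [← map_sub, hy]; congr 1; abel
    rw [this]
    rw [add_apply] at hd
    rw [← add_sub_assoc, hd, add_sub_cancel_right]
  have hGs : ⟪G v, d⟫ = ⟪G d, v⟫ := by rw [hG, inner_rowGram_comm, real_inner_comm]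
  have hHs : ⟪Hop v, y⟫ = ⟪Hop y, v⟫ := by rw [hsym, real_inner_comm]
  simp only [map_add, inner_add_left, inner_add_right, add_apply, hGs, hHs]
  linarith

theorem half_rss_le_energy (hH : ∀ u, 0 ≤ ⟪Hop u, u⟫) (hb : 0 ≤ b) (γ : E) :
    rss Ja Jb x e k₀ γ₀ n k γ / 2 ≤ energy Ja Jb x e k₀ γ₀ Hop m b n k γ := by
  rw [energy]; linarith [hH (γ - m)]

theorem exists_center [FiniteDimensional ℝ E] {G : E →L[ℝ] E} {c : ℝ} (hc : 0 < c)
    (hG : ∀ u, c * ‖u‖ ^ 2 ≤ ⟪G u, u⟫) (y : E) : ∃ d, G d = y := by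
  have hinj : Function.Injective G := by
    refine (injective_iff_map_eq_zero G).2 fun u hu => ?_
    have := hG u
    rw [hu, inner_zero_left] at this
    have h2 : ‖u‖ ^ 2 ≤ 0 := by nlinarith [sq_nonneg ‖u‖]
    exact norm_eq_zero.1 (pow_eq_zero_iff two_ne_zero |>.1 (le_antisymm h2 (sq_nonneg _)))
  exact (LinearMap.injective_iff_surjective (f := G.toLinearMap)).1 hinj y

variable {Pa Pb : E →L[ℝ] F}

/-- Brings the residuals into the form of `residual_ge_of_far`. Observations between the breaks
follow the second regime but are fitted by the first, hence the shift by the jump. -/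
theorem rss_eq_right (hPa : ∀ z γ, ⟪Ja z, γ⟫ = ⟪z, Pa γ⟫) (hPb : ∀ z γ, ⟪Jb z, γ⟫ = ⟪z, Pb γ⟫)
    (hk : k₀ ≤ k) (hkn : k ≤ n) (γ : E) :
    rss Ja Jb x e k₀ γ₀ n k γ = ∑ t ∈ range k₀, (e t - ⟪x t, Pa (γ - γ₀)⟫) ^ 2 +
      ∑ t ∈ Ico k₀ k, (e t - ⟪x t, Pa (γ - γ₀) - (Pb γ₀ - Pa γ₀)⟫) ^ 2 +
      ∑ t ∈ Ico k n, (e t - ⟪x t, Pb (γ - γ₀)⟫) ^ 2 := by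
  rw [rss, ← Finset.sum_range_add_sum_Ico _ hkn, ← Finset.sum_range_add_sum_Ico _ hk]
  congr 1
  · congr 1
    · refine Finset.sum_congr rfl fun t ht => ?_
      simp only [Finset.mem_range] at ht
      rw [row, row, if_pos ht, if_pos (by omega), hPa, hPa, map_sub, inner_sub_right]; ring
    · refine Finset.sum_congr rfl fun t ht => ?_
      simp only [Finset.mem_Ico] at ht
      rw [row, row, if_neg (by omega), if_pos (by omega), hPa, hPb, map_sub]
      simp only [inner_sub_right]; ring
  · refine Finset.sum_congr rfl fun t ht => ?_
    simp only [Finset.mem_Ico] at ht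
    rw [row, row, if_neg (by omega), if_neg (by omega), hPb, hPb, map_sub, inner_sub_right]; ring

theorem rss_eq_left (hPa : ∀ z γ, ⟪Ja z, γ⟫ = ⟪z, Pa γ⟫) (hPb : ∀ z γ, ⟪Jb z, γ⟫ = ⟪z, Pb γ⟫)
    (hk : k ≤ k₀) (hkn : k₀ ≤ n) (γ : E) :
    rss Ja Jb x e k₀ γ₀ n k γ = ∑ t ∈ range k, (e t - ⟪x t, Pa (γ - γ₀)⟫) ^ 2 +
      ∑ t ∈ Ico k k₀, (e t - ⟪x t, Pb (γ - γ₀) + (Pb γ₀ - Pa γ₀)⟫) ^ 2 +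
      ∑ t ∈ Ico k₀ n, (e t - ⟪x t, Pb (γ - γ₀)⟫) ^ 2 := by
  rw [rss, ← Finset.sum_range_add_sum_Ico _ hkn, ← Finset.sum_range_add_sum_Ico _ hk]
  congr 1
  · congr 1
    · refine Finset.sum_congr rfl fun t ht => ?_
      simp only [Finset.mem_range] at ht
      rw [row, row, if_pos (by omega), if_pos ht, hPa, hPa, map_sub, inner_sub_right]; ring
    · refine Finset.sum_congr rfl fun t ht => ?_
      simp only [Finset.mem_Ico] at ht
      rw [row, row, if_pos (by omega), if_neg (by omega), hPa, hPb, map_sub]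
      simp only [inner_sub_right, inner_add_right]; ring
  · refine Finset.sum_congr rfl fun t ht => ?_
    simp only [Finset.mem_Ico] at ht
    rw [row, row, if_neg (by omega), if_neg (by omega), hPb, hPb, map_sub, inner_sub_right]; ring

end Energy

namespace RegularSample

variable {ι F E : Type*} [NormedAddCommGroup F] [InnerProductSpace ℝ F]
  [NormedAddCommGroup E] [InnerProductSpace ℝ E]
  {l : Filter ι} {n k₀ kL kR : ι → ℕ} {x : ι → ℕ → F} {e : ι → ℕ → ℝ}
  {SL SR : F →L[ℝ] F} {σ : ℝ} {Ja Jb : F →L[ℝ] E} {γ₀ : E}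
  {Pa Pb : E →L[ℝ] F}

theorem rss_ge_of_far (h : RegularSample l n k₀ kL kR x e (Pb γ₀ - Pa γ₀) SL SR σ)
    (hPa : ∀ z γ, ⟪Ja z, γ⟫ = ⟪z, Pa γ⟫) (hPb : ∀ z γ, ⟪Jb z, γ⟫ = ⟪z, Pb γ⟫) :
    ∃ c : ℝ, 0 < c ∧ ∀ᶠ i in l, ∀ k ≤ n i,
      (n i : ℝ) ^ (0.35 : ℝ) ≤ gramForm (x i) (window (k₀ i) k) (Pb γ₀ - Pa γ₀) → ∀ γ,
      ∑ t ∈ range (n i), e i t ^ 2 + c * (n i : ℝ) ^ (0.35 : ℝ) ≤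
        rss Ja Jb (x i) (e i) (k₀ i) γ₀ (n i) k γ := by
  obtain ⟨c, hc, hfar⟩ := h.residual_ge_of_far
  refine ⟨c, hc, ?_⟩
  filter_upwards [hfar, h.order] with i hfar hord k hk hq γ
  obtain ⟨h1, h2⟩ := hfar k hk hq
  rcases le_total (k₀ i) k with hle | hle
  · rw [rss_eq_right hPa hPb hle hk]
    exact h1 hle _ _
  · rw [rss_eq_left hPa hPb hle (hord.2.1.trans hord.2.2)]
    exact h2 hle _ _

/-- Used for the least-squares break, whose minimal sum of squares cannot exceed the value at the
true parameters. -/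
theorem near_of_rss_le (h : RegularSample l n k₀ kL kR x e (Pb γ₀ - Pa γ₀) SL SR σ)
    (hPa : ∀ z γ, ⟪Ja z, γ⟫ = ⟪z, Pa γ⟫) (hPb : ∀ z γ, ⟪Jb z, γ⟫ = ⟪z, Pb γ⟫)
    {κ : ι → ℕ} {γ : ι → E} (hκ : ∀ᶠ i in l, κ i ≤ n i)
    (hle : ∀ᶠ i in l, rss Ja Jb (x i) (e i) (k₀ i) γ₀ (n i) (κ i) (γ i) ≤
      ∑ t ∈ range (n i), e i t ^ 2) :
    ∀ᶠ i in l,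
      gramForm (x i) (window (k₀ i) (κ i)) (Pb γ₀ - Pa γ₀) < (n i : ℝ) ^ (0.35 : ℝ) := by
  obtain ⟨c, hc, hfar⟩ := h.rss_ge_of_far hPa hPb
  filter_upwards [hfar, hκ, hle, h.eventually_size_pos] with i hfar hκ hle hn
  by_contra! hq
  have h1 := hfar _ hκ hq (γ i)
  have h2 : 0 < c * (n i : ℝ) ^ (0.35 : ℝ) := by positivity
  linarith

end RegularSample
end StructuralBreak
end

noncomputable section
namespace StructuralBreak
open scoped RealInnerProductSpace
open Finset (range Ico)

/-! ### The posterior given a break near the true one -/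

section Rescaling

variable {E : Type*} [NormedAddCommGroup E] [InnerProductSpace ℝ E] [FiniteDimensional ℝ E]
  [MeasurableSpace E] [BorelSpace E]

theorem setIntegral_preimage_rescale {r : ℝ} (hr : 0 < r) (c : E) (f : E → ℝ) {S : Set E}
    (hS : MeasurableSet S) :
    ∫ γ in (fun γ => r • (γ - c)) ⁻¹' S, f γ =
      (r ^ Module.finrank ℝ E)⁻¹ * ∫ θ in S, f (c + r⁻¹ • θ) := by
  have hm : Measurable fun γ : E => r • (γ - c) := by fun_prop
  rw [← integral_indicator (hm hS), ← integral_indicator hS]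
  set g := ((fun γ => r • (γ - c)) ⁻¹' S).indicator f with hg
  have h1 : ∀ θ, S.indicator (fun θ => f (c + r⁻¹ • θ)) θ = g (c + r⁻¹ • θ) := by
    intro θ
    have h2 : c + r⁻¹ • θ ∈ (fun γ => r • (γ - c)) ⁻¹' S ↔ θ ∈ S := by
      rw [Set.mem_preimage, add_sub_cancel_left, smul_smul, mul_inv_cancel₀ hr.ne', one_smul]
    by_cases hθ : θ ∈ S
    · rw [hg, Set.indicator_of_mem hθ, Set.indicator_of_mem (h2.2 hθ)]
    · rw [hg, Set.indicator_of_notMem hθ, Set.indicator_of_notMem (mt h2.1 hθ)]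
  simp_rw [h1]
  rw [Measure.integral_comp_inv_smul volume (fun u => g (c + u)) r, integral_add_left_eq_self,
    abs_of_pos (by positivity), smul_eq_mul, inv_mul_cancel_left₀ (by positivity)]

/-- The probability of `S` under the Gaussian distribution with precision operator `Q`. -/
def gaussianRatio (Q : E →L[ℝ] E) (S : Set E) : ℝ :=
  (∫ θ in S, Real.exp (-⟪Q θ, θ⟫ / 2)) / ∫ θ, Real.exp (-⟪Q θ, θ⟫ / 2)

/-- The unnormalized posterior mass of `S` given the break `k`. -/
def energyMass {F : Type*} [NormedAddCommGroup F] [InnerProductSpace ℝ F]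
    (Ja Jb : F →L[ℝ] E) (x : ℕ → F) (e : ℕ → ℝ) (k₀ : ℕ) (γ₀ : E) (Hop : E →L[ℝ] E) (m : E)
    (b : ℝ) (n : ℕ) (α : ℝ) (k : ℕ) (S : Set E) : ℝ :=
  ∫ γ in S, energy Ja Jb x e k₀ γ₀ Hop m b n k γ ^ (-α)

end Rescaling

namespace RegularSample

variable {ι F E : Type*} [NormedAddCommGroup F] [InnerProductSpace ℝ F]
  [NormedAddCommGroup E] [InnerProductSpace ℝ E] [FiniteDimensional ℝ E]
  [MeasurableSpace E] [BorelSpace E]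
  {l : Filter ι} {n k₀ kL kR : ι → ℕ} {x : ι → ℕ → F} {e : ι → ℕ → ℝ}
  {SL SR : F →L[ℝ] F} {σ : ℝ} {Ja Jb : F →L[ℝ] E} {γ₀ : E}
  {Pa Pb : E →L[ℝ] F} {Hop : E →L[ℝ] E} {m : E} {b : ℝ} {d dLS : ι → E} {κ κLS : ι → ℕ} {α : ι → ℝ}

omit [FiniteDimensional ℝ E] [MeasurableSpace E] [BorelSpace E] in
theorem tendsto_energy (h : RegularSample l n k₀ kL kR x e (Pb γ₀ - Pa γ₀) SL SR σ)
    (hPa : ∀ z γ, ⟪Ja z, γ⟫ = ⟪z, Pa γ⟫) (hPb : ∀ z γ, ⟪Jb z, γ⟫ = ⟪z, Pb γ⟫) {c : ℝ} (hc : 0 < c)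
    (hP : ∀ γ, c * ‖γ‖ ^ 2 ≤ ‖Pa γ‖ ^ 2 + ‖Pb γ‖ ^ 2) (hH : ∀ u, 0 ≤ ⟪Hop u, u⟫)
    (hκ : ∀ᶠ i in l,
      gramForm (x i) (window (k₀ i) (κ i)) (Pb γ₀ - Pa γ₀) < (n i : ℝ) ^ (0.35 : ℝ))
    (hd : ∀ᶠ i in l, (rowGram Ja Jb (x i) (n i) (κ i) + Hop) (d i) =
      rowScore Ja Jb (x i) (e i) (k₀ i) γ₀ (n i) (κ i) + Hop (m - γ₀)) :
    Tendsto (fun i => energy Ja Jb (x i) (e i) (k₀ i) γ₀ Hop m b (n i) (κ i) (γ₀ + d i) / n i) l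
      (𝓝 (σ ^ 2 / 2)) := by
  obtain ⟨C, hC, hdC⟩ := h.estimate_error_le hPa hPb hc hP hH hκ hd
  have hd0 : Tendsto d l (𝓝 0) := by
    refine squeeze_zero_norm' hdC ?_
    simpa using (tendsto_rpow_size_zero h.size (show (-0.45 : ℝ) < 0 by norm_num)).const_mul C
  have hinv : Tendsto (fun i => (n i : ℝ)⁻¹) l (𝓝 0) :=
    tendsto_inv_atTop_zero.comp (tendsto_natCast_atTop_atTop.comp h.size)
  have h1 := h.tendsto_rss hPa hPb hκ hdC
  have h2 : Tendsto (fun i => γ₀ + d i - m) l (𝓝 (γ₀ - m)) := by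
    simpa using (hd0.const_add γ₀).sub_const m
  have h3 : Tendsto (fun i => ⟪Hop (γ₀ + d i - m), γ₀ + d i - m⟫) l (𝓝 ⟪Hop (γ₀ - m), γ₀ - m⟫) :=
    Tendsto.inner (𝕜 := ℝ) ((Hop.continuous.tendsto _).comp h2) h2
  have h4 := (hinv.const_mul b).add ((h1.add (h3.mul hinv)).div_const 2)
  simp only [mul_zero, add_zero, zero_add] at h4
  refine h4.congr fun i => ?_
  rw [energy]
  ring

/-- With `A` the minimal energy, completing the square writes the rescaled density as `A ^ (-α)`
times a Student kernel. Its precision is `(α / A) (Gram + Hop) / n`, which tends to `V / σ²` because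
`α / n → 1 / 2` and `A / n → σ² / 2`; its centre is the rescaled distance to the least-squares
estimate, which tends to `0`. -/
theorem conditional_posterior_tendsto
    (h : RegularSample l n k₀ kL kR x e (Pb γ₀ - Pa γ₀) SL SR σ) (hσ : 0 < σ)
    (hPa : ∀ z γ, ⟪Ja z, γ⟫ = ⟪z, Pa γ⟫) (hPb : ∀ z γ, ⟪Jb z, γ⟫ = ⟪z, Pb γ⟫) {c : ℝ} (hc : 0 < c)
    (hP : ∀ γ, c * ‖γ‖ ^ 2 ≤ ‖Pa γ‖ ^ 2 + ‖Pb γ‖ ^ 2)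
    (hsym : ∀ u v, ⟪Hop u, v⟫ = ⟪u, Hop v⟫) (hH : ∀ u, 0 ≤ ⟪Hop u, u⟫)
    (hα : Tendsto (fun i => α i / n i) l (𝓝 (1 / 2)))
    (hκ : ∀ᶠ i in l,
      gramForm (x i) (window (k₀ i) (κ i)) (Pb γ₀ - Pa γ₀) < (n i : ℝ) ^ (0.35 : ℝ))
    (hκLS : ∀ᶠ i in l,
      gramForm (x i) (window (k₀ i) (κLS i)) (Pb γ₀ - Pa γ₀) < (n i : ℝ) ^ (0.35 : ℝ))
    (hd : ∀ᶠ i in l, (rowGram Ja Jb (x i) (n i) (κ i) + Hop) (d i) =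
      rowScore Ja Jb (x i) (e i) (k₀ i) γ₀ (n i) (κ i) + Hop (m - γ₀))
    (hdLS : ∀ᶠ i in l, rowGram Ja Jb (x i) (n i) (κLS i) (dLS i) =
      rowScore Ja Jb (x i) (e i) (k₀ i) γ₀ (n i) (κLS i)) {η : ℝ} (hη : 0 < η) :
    ∀ᶠ i in l, ∀ S, MeasurableSet S →
      |energyMass Ja Jb (x i) (e i) (k₀ i) γ₀ Hop m b (n i) (α i) (κ i)
          ((fun γ => Real.sqrt (n i) • (γ - (γ₀ + dLS i))) ⁻¹' S) /
        energyMass Ja Jb (x i) (e i) (k₀ i) γ₀ Hop m b (n i) (α i) (κ i) Set.univ -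
        gaussianRatio ((σ ^ 2)⁻¹ • gramLimit Ja Jb Pa Pb SL SR) S| ≤ η := by
  obtain ⟨c', hc', hV⟩ := h.gramLimit_coercive hPa hPb hc hP
  set V := gramLimit Ja Jb Pa Pb SL SR with hVdef
  have hn := h.eventually_size_pos
  set A := fun i => energy Ja Jb (x i) (e i) (k₀ i) γ₀ Hop m b (n i) (κ i) (γ₀ + d i) with hA
  have hAlim : Tendsto (fun i => A i / n i) l (𝓝 (σ ^ 2 / 2)) :=
    h.tendsto_energy hPa hPb hc hP hH hκ hd
  have hApos : ∀ᶠ i in l, 0 < A i := by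
    filter_upwards [hAlim.eventually (lt_mem_nhds (show 0 < σ ^ 2 / 2 by positivity)), hn]
      with i hi hni
    exact (div_pos_iff_of_pos_right hni).1 hi
  have hnR : Tendsto (fun i => (n i : ℝ)) l atTop := tendsto_natCast_atTop_atTop.comp h.size
  have hαtop : Tendsto α l atTop := by
    refine (hα.pos_mul_atTop (by norm_num) hnR).congr' ?_
    filter_upwards [hn] with i hi
    field_simp
  set Q := fun i => (α i / A i) • ((n i : ℝ)⁻¹ • (rowGram Ja Jb (x i) (n i) (κ i) + Hop)) with hQ
  have hQlim : Tendsto Q l (𝓝 ((σ ^ 2)⁻¹ • V)) := by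
    have h1 : Tendsto (fun i => α i / A i) l (𝓝 ((σ ^ 2)⁻¹)) := by
      have h2 := hα.div hAlim (by positivity)
      have h3 : 1 / 2 / (σ ^ 2 / 2) = (σ ^ 2)⁻¹ := by field_simp
      rw [h3] at h2
      refine h2.congr' ?_
      filter_upwards [hn, hApos] with i hi hAi
      simp only [Pi.div_apply]
      field_simp
    refine h1.smul ?_
    have h2 := (h.tendsto_rowGram hPa hPb hκ).add
      ((tendsto_inv_atTop_zero.comp hnR).smul_const Hop)
    rw [zero_smul, add_zero] at h2
    refine h2.congr fun i => ?_
    rw [smul_add]; rfl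
  set hh := fun i => Real.sqrt (n i) • (d i - dLS i) with hhh
  have hhlim : Tendsto hh l (𝓝 0) :=
    h.estimates_equivalent hPa hPb hc hP (H₁ := Hop) (H₂ := 0) (w₁ := Hop (m - γ₀)) (w₂ := 0)
      hH (fun u => by simp) hκ hκLS hd (by simpa using hdLS)
  have hcoer : ∀ u, (σ ^ 2)⁻¹ * c' * ‖u‖ ^ 2 ≤ ⟪((σ ^ 2)⁻¹ • V) u, u⟫ := by
    intro u
    rw [smul_apply, real_inner_smul_left, mul_assoc]
    gcongr
    exact hV u
  have htv := studentKernel_tendsto_tv (by positivity) hcoer hη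
  have hlim : Tendsto (fun i => (Q i, hh i, α i)) l (𝓝 ((σ ^ 2)⁻¹ • V) ×ˢ 𝓝 0 ×ˢ atTop) :=
    hQlim.prodMk (hhlim.prodMk hαtop)
  filter_upwards [hlim.eventually htv, hn, hApos, hd, hαtop.eventually_gt_atTop 0]
    with i htv hni hAi hd hαi S hS
  have hr : 0 < Real.sqrt (n i) := Real.sqrt_pos.2 hni
  set G := rowGram Ja Jb (x i) (n i) (κ i) with hG
  have hGnn : ∀ u, 0 ≤ ⟪(G + Hop) u, u⟫ := fun u => by
    rw [add_apply, inner_add_left]; exact add_nonneg (inner_rowGram_nonneg u) (hH u)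
  have hkernel : ∀ θ, energy Ja Jb (x i) (e i) (k₀ i) γ₀ Hop m b (n i) (κ i)
      (γ₀ + dLS i + (Real.sqrt (n i))⁻¹ • θ) ^ (-α i) =
      A i ^ (-α i) * studentKernel (Q i) (hh i) (α i) θ := by
    intro θ
    have h1 : γ₀ + dLS i + (Real.sqrt (n i))⁻¹ • θ =
        γ₀ + d i + (Real.sqrt (n i))⁻¹ • (θ - hh i) := by
      simp only [hhh, smul_sub, smul_smul, inv_mul_cancel₀ hr.ne', one_smul]
      abel
    rw [h1, energy_completed hsym hd, studentKernel, ← Real.mul_rpow hAi.le]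
    · congr 1
      rw [map_smul, real_inner_smul_left, real_inner_smul_right]
      simp only [hQ, smul_apply, real_inner_smul_left]
      have hsq : (Real.sqrt (n i))⁻¹ * (Real.sqrt (n i))⁻¹ = (n i : ℝ)⁻¹ := by
        rw [← mul_inv, Real.mul_self_sqrt hni.le]
      rw [← mul_assoc, hsq]
      rw [← hG, show energy Ja Jb (x i) (e i) (k₀ i) γ₀ Hop m b (n i) (κ i) (γ₀ + d i) = A i from rfl]
      field_simp
    · simp only [hQ, smul_apply, real_inner_smul_left]
      have := hGnn (θ - hh i)
      positivity
  have hmass : ∀ S, MeasurableSet S → energyMass Ja Jb (x i) (e i) (k₀ i) γ₀ Hop m b (n i) (α i)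
      (κ i) ((fun γ => Real.sqrt (n i) • (γ - (γ₀ + dLS i))) ⁻¹' S) =
      (Real.sqrt (n i) ^ Module.finrank ℝ E)⁻¹ * A i ^ (-α i) *
        ∫ θ in S, studentKernel (Q i) (hh i) (α i) θ := by
    intro S hS
    rw [energyMass, setIntegral_preimage_rescale hr _ _ hS]
    simp_rw [hkernel]
    rw [integral_const_mul, mul_assoc]
  have hu := hmass Set.univ MeasurableSet.univ
  rw [Set.preimage_univ, setIntegral_univ] at hu
  rw [hmass S hS, hu, mul_div_mul_left _ _ (by positivity)]
  exact htv S

end RegularSample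
end StructuralBreak
end

noncomputable section
namespace StructuralBreak
open scoped RealInnerProductSpace
open Finset (range Ico)

/-! ### The posterior as a mixture over the candidate breaks -/

/-- Select a counterexample wherever one exists, and `κ₀` elsewhere. This makes limit statements
along sequences of breaks uniform over all near breaks. -/
theorem eventually_forall_of_selections {ι : Type*} {l : Filter ι} {N : ι → ℕ → Prop}
    {p : ι → ℕ → Prop} {κ₀ : ι → ℕ} (h₀ : ∀ᶠ i in l, N i (κ₀ i))
    (h : ∀ κ : ι → ℕ, (∀ᶠ i in l, N i (κ i)) → ∀ᶠ i in l, p i (κ i)) :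
    ∀ᶠ i in l, ∀ k, N i k → p i k := by
  classical
  set κ : ι → ℕ := fun i => if hi : ∃ k, N i k ∧ ¬ p i k then hi.choose else κ₀ i with hκ
  have h1 : ∀ᶠ i in l, N i (κ i) := by
    filter_upwards [h₀] with i hi
    simp only [hκ]
    split_ifs with hex
    · exact hex.choose_spec.1
    · exact hi
  filter_upwards [h κ h1] with i hi k hk
  by_contra hp
  have hex : ∃ k, N i k ∧ ¬ p i k := ⟨k, hk, hp⟩
  simp only [hκ, dif_pos hex] at hi
  exact hex.choose_spec.2 hi

section Bounds

variable {E : Type*} [NormedAddCommGroup E] [InnerProductSpace ℝ E] [FiniteDimensional ℝ E]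
  [MeasurableSpace E] [BorelSpace E]

/-- A power `dim + 1` of `f` is spent on integrability, with a bound free of `α`; the remaining
power is bounded by the minimum. -/
theorem exists_integral_rpow_neg_le (E : Type*) [NormedAddCommGroup E] [InnerProductSpace ℝ E]
    [FiniteDimensional ℝ E] [MeasurableSpace E] [BorelSpace E] {c : ℝ} (hc : 0 < c) :
    ∃ K : ℝ, 0 < K ∧ ∀ (f : E → ℝ) (y : E) (a α : ℝ), Measurable f → 1 ≤ a →
      (Module.finrank ℝ E + 1 : ℝ) ≤ α → (∀ γ, a + c / 2 * ‖γ - y‖ ^ 2 ≤ f γ) →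
      Integrable (fun γ => f γ ^ (-α)) ∧
        ∫ γ, f γ ^ (-α) ≤ K * a ^ (-(α - (Module.finrank ℝ E + 1))) := by
  set p : ℝ := Module.finrank ℝ E + 1 with hp
  have hp0 : 0 < p := by positivity
  obtain ⟨bound, hb, hbound⟩ := exists_integrable_studentKernel_bound (E := E)
    (c := c * p) (by positivity)
  have hker := hbound ((c * p) • ContinuousLinearMap.id ℝ E) 0 p
    (fun u => by simp [real_inner_smul_left]) (by simp) le_rfl
  have hg : ∀ θ : E, (1 + c / 2 * ‖θ‖ ^ 2) ^ (-p) ≤ bound θ := by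
    intro θ
    have h1 := (hker θ).2
    rw [studentKernel] at h1
    have h2 : ⟪((c * p) • ContinuousLinearMap.id ℝ E) (θ - 0), θ - 0⟫ / (2 * p) =
        c / 2 * ‖θ‖ ^ 2 := by
      rw [sub_zero, smul_apply, ContinuousLinearMap.id_apply, real_inner_smul_left,
        real_inner_self_eq_norm_sq]
      field_simp
    rwa [h2] at h1
  have hnn : 0 ≤ ∫ θ, bound θ := integral_nonneg fun θ => le_trans (by positivity) (hg θ)
  refine ⟨(∫ θ, bound θ) + 1, by positivity, fun f y a α hf ha hα hle => ?_⟩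
  have hpt : ∀ γ, f γ ^ (-α) ≤ a ^ (-(α - p)) * bound (γ - y) := by
    intro γ
    set s := c / 2 * ‖γ - y‖ ^ 2 with hs
    have hs0 : 0 ≤ s := by positivity
    calc f γ ^ (-α) ≤ (a + s) ^ (-α) :=
          Real.rpow_le_rpow_of_nonpos (by positivity) (hle γ) (by linarith)
      _ = (a + s) ^ (-(α - p)) * (a + s) ^ (-p) := by
          rw [← Real.rpow_add (by positivity)]; congr 1; ring
      -- The second factor uses `1 ≤ a`; this is why the minimal energy is required to be at least
      -- one.
      _ ≤ a ^ (-(α - p)) * (1 + s) ^ (-p) := by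
          gcongr ?_ * ?_
          · exact Real.rpow_le_rpow_of_nonpos (by positivity) (by linarith) (by linarith)
          · exact Real.rpow_le_rpow_of_nonpos (by positivity) (by linarith) (by linarith)
      _ ≤ _ := by gcongr; exact hg _
  have hint : Integrable fun γ => a ^ (-(α - p)) * bound (γ - y) :=
    (hb.comp_sub_right y).const_mul _
  have hfnn : ∀ γ, 0 ≤ f γ ^ (-α) := fun γ =>
    Real.rpow_nonneg (le_trans (by positivity) (hle γ)) _
  have hfint : Integrable fun γ => f γ ^ (-α) := by
    refine hint.mono' (hf.pow_const _).aestronglyMeasurable (Eventually.of_forall fun γ => ?_)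
    rw [Real.norm_of_nonneg (hfnn γ)]
    exact hpt γ
  refine ⟨hfint, (integral_mono hfint hint hpt).trans ?_⟩
  rw [integral_const_mul, integral_sub_right_eq_self, mul_comm]
  gcongr
  linarith

theorem le_integral_rpow_neg {f : E → ℝ} {y : E} {r a α : ℝ} (hr : 0 ≤ r) (hα : 0 ≤ α)
    (hf : ∀ γ, 0 < f γ) (hint : Integrable fun γ => f γ ^ (-α))
    (hle : ∀ γ, ‖γ - y‖ ≤ r → f γ ≤ a) :
    volume.real (Metric.ball (0 : E) 1) * r ^ Module.finrank ℝ E * a ^ (-α) ≤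
      ∫ γ, f γ ^ (-α) := by
  have h1 : volume.real (Metric.closedBall y r) =
      r ^ Module.finrank ℝ E * volume.real (Metric.ball (0 : E) 1) :=
    Measure.addHaar_real_closedBall volume y hr
  have hfin : volume (Metric.closedBall y r) ≠ ⊤ := measure_closedBall_lt_top.ne
  calc _ = ∫ _γ in Metric.closedBall y r, a ^ (-α) := by
        rw [setIntegral_const, h1, smul_eq_mul]; ring
    _ ≤ ∫ γ in Metric.closedBall y r, f γ ^ (-α) := by
        refine setIntegral_mono_on (integrableOn_const hfin) hint.integrableOn
          measurableSet_closedBall fun γ hγ => ?_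
        rw [Metric.mem_closedBall, dist_eq_norm] at hγ
        exact Real.rpow_le_rpow_of_nonpos (hf γ) (hle γ hγ) (by linarith)
    _ ≤ _ := setIntegral_le_integral hint
        (Eventually.of_forall fun γ => Real.rpow_nonneg (hf γ).le _)

theorem measurable_energy {F : Type*} [NormedAddCommGroup F] [InnerProductSpace ℝ F]
    (Ja Jb : F →L[ℝ] E) (x : ℕ → F) (e : ℕ → ℝ) (k₀ : ℕ) (γ₀ : E) (Hop : E →L[ℝ] E) (m : E)
    (b : ℝ) (n k : ℕ) : Measurable (energy Ja Jb x e k₀ γ₀ Hop m b n k) := by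
  unfold energy rss
  fun_prop

end Bounds

/-- The mass ratio of distant breaks and the true break is negligible. -/
theorem tendsto_far_ratio {ι : Type*} {l : Filter ι} {n : ι → ℕ} (hn : Tendsto n l atTop)
    {c C p q K V : ℝ} (hc : 0 < c) (hV : 0 < V) {ss α : ι → ℝ} {s : ℝ} (hs : 0 < s)
    (hss : Tendsto (fun i => ss i / n i) l (𝓝 s)) (hα : ∀ᶠ i in l, (n i : ℝ) / 2 ≤ α i)
    (hp : 0 ≤ p) (hK : 0 ≤ K) {η : ℝ} (hη : 0 < η) :
    ∀ᶠ i in l, K * (ss i / 2 + c * (n i : ℝ) ^ (0.35 : ℝ)) ^ (-(α i - p)) ≤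
      η * (V * (n i : ℝ) ^ (-q) * (ss i / 2 + C) ^ (-α i)) := by
  have hnR : Tendsto (fun i => (n i : ℝ)) l atTop := tendsto_natCast_atTop_atTop.comp hn
  -- The constant `32` collects `4` from the choice of `z` below, `2` from `log (1 + z) ≥ z / 2` and
  -- `4` from `α - p ≥ n / 4`.
  have hlim : Tendsto (fun i => (n i : ℝ) ^ (q + p) * Real.exp (-(c / (32 * s)) * (n i : ℝ) ^ (0.35 : ℝ)))
      l (𝓝 0) := by
    have h1 := (tendsto_rpow_mul_exp_neg_mul_atTop_nhds_zero ((q + p) / 0.35) (c / (32 * s))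
      (by positivity)).comp ((tendsto_rpow_atTop (show (0 : ℝ) < 0.35 by norm_num)).comp hnR)
    refine h1.congr' ?_
    filter_upwards [hnR.eventually_gt_atTop 0] with i hi
    simp only [Function.comp]
    rw [← Real.rpow_mul hi.le]
    congr 2
    field_simp
  have hlim2 := hlim.const_mul (K * (2 * s) ^ p)
  rw [mul_zero] at hlim2
  have hsmall : Tendsto (fun i => c / (4 * s) * (n i : ℝ) ^ (-0.65 : ℝ)) l (𝓝 0) := by
    simpa using (tendsto_rpow_size_zero hn (show (-0.65 : ℝ) < 0 by norm_num)).const_mul _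
  filter_upwards [hnR.eventually_gt_atTop 0, hnR.eventually_ge_atTop (4 * p),
    hlim2.eventually (gt_mem_nhds (show 0 < η * V by positivity)),
    hss.eventually (gt_mem_nhds (show s < 2 * s by linarith)),
    hss.eventually (lt_mem_nhds (show s / 2 < s by linarith)), hα,
    eventually_mul_rpow_le hn (2 * C / c) (show (0 : ℝ) < 0.35 by norm_num),
    hnR.eventually_ge_atTop (4 * |C| / s + 1), hsmall.eventually (gt_mem_nhds one_pos)]
    with i hn0 hnp hlim hup hlow hα hC hnC hz1
  rw [div_lt_iff₀ hn0] at hup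
  rw [lt_div_iff₀ hn0] at hlow
  set a₀ := ss i / 2 + C with ha₀
  set a₁ := ss i / 2 + c * (n i : ℝ) ^ (0.35 : ℝ) with ha₁
  set N := (n i : ℝ) with hN
  have hCN : |C| ≤ s * N / 4 - s / 4 := by
    have : 4 * |C| / s + 1 ≤ N := hnC
    have h2 : 4 * |C| / s ≤ N - 1 := by linarith
    rw [div_le_iff₀ hs] at h2
    linarith
  have hC1 := neg_abs_le C
  have hC2 := le_abs_self C
  have ha₀pos : 0 < a₀ := by rw [ha₀]; nlinarith
  have ha₀up : a₀ ≤ 2 * s * N := by rw [ha₀]; nlinarith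
  set z := c / (4 * s) * N ^ (-0.65 : ℝ) with hz
  have hz0 : 0 < z := by positivity
  -- Half of `c N^0.35` absorbs the constant `C`, the other half gives the relative gain `z`, since
  -- `a₀ ≤ 2 s N`.
  have ha₁low : a₀ * (1 + z) ≤ a₁ := by
    have h1 : a₀ * z ≤ c / 2 * N ^ (0.35 : ℝ) := by
      calc a₀ * z ≤ 2 * s * N * z := by gcongr
        _ = c / 2 * (N ^ (-0.65 : ℝ) * N) := by rw [hz]; field_simp; ring
        _ = _ := by rw [← Real.rpow_add_one hn0.ne']; norm_num
    have h2 : 2 * C ≤ c * N ^ (0.35 : ℝ) := by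
      rw [Real.rpow_zero, mul_one, div_le_iff₀ hc] at hC
      linarith
    rw [ha₀, ha₁] at *
    linarith
  have hαp : N / 4 ≤ α i - p := by linarith
  have hexp : (1 + z) ^ (-(α i - p)) ≤ Real.exp (-(c / (32 * s)) * N ^ (0.35 : ℝ)) := by
    rw [Real.rpow_def_of_pos (by positivity)]
    apply Real.exp_le_exp.2
    have h1 : z / 2 ≤ Real.log (1 + z) := by
      have h2 := Real.one_sub_inv_le_log_of_pos (show 0 < 1 + z by positivity)
      have h3 : z / 2 ≤ 1 - (1 + z)⁻¹ := by
        rw [show 1 - (1 + z)⁻¹ = z / (1 + z) by field_simp; ring]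
        exact div_le_div_of_nonneg_left hz0.le (by positivity) (by linarith)
      linarith
    have h0 : 0 ≤ Real.log (1 + z) := by linarith
    have h4 : z / 2 * (N / 4) ≤ Real.log (1 + z) * (α i - p) := by gcongr
    have h5 : z / 2 * (N / 4) = c / (32 * s) * N ^ (0.35 : ℝ) := by
      rw [hz, show N ^ (0.35 : ℝ) = N ^ (-0.65 : ℝ) * N by
        rw [← Real.rpow_add_one hn0.ne']; norm_num]
      field_simp
      norm_num
    rw [mul_neg, neg_mul, neg_le_neg_iff, ← h5]
    exact h4
  calc K * a₁ ^ (-(α i - p)) ≤ K * (a₀ * (1 + z)) ^ (-(α i - p)) := by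
        exact mul_le_mul_of_nonneg_left
          (Real.rpow_le_rpow_of_nonpos (by positivity) ha₁low (by linarith)) hK
    _ = K * (a₀ ^ p * a₀ ^ (-α i) * (1 + z) ^ (-(α i - p))) := by
        rw [Real.mul_rpow ha₀pos.le (by positivity), ← Real.rpow_add ha₀pos]
        congr 3; ring
    _ ≤ K * ((2 * s * N) ^ p * a₀ ^ (-α i) * Real.exp (-(c / (32 * s)) * N ^ (0.35 : ℝ))) := by
        gcongr
    _ = K * (2 * s) ^ p * (N ^ (q + p) * Real.exp (-(c / (32 * s)) * N ^ (0.35 : ℝ))) *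
          (N ^ (-q) * a₀ ^ (-α i)) := by
        rw [Real.mul_rpow (by positivity) hn0.le, show N ^ p = N ^ (q + p) * N ^ (-q) by
          rw [← Real.rpow_add hn0]; congr 1; ring]
        ring
    _ ≤ η * V * (N ^ (-q) * a₀ ^ (-α i)) := by gcongr
    _ = _ := by ring

end StructuralBreak
end

/-! ### Mass of near and far breaks -/

noncomputable section
namespace StructuralBreak
open scoped RealInnerProductSpace
open Finset (range Ico)

namespace RegularSample

variable {ι F E : Type*} [NormedAddCommGroup F] [InnerProductSpace ℝ F]
  [NormedAddCommGroup E] [InnerProductSpace ℝ E] [FiniteDimensional ℝ E]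
  [MeasurableSpace E] [BorelSpace E]
  {l : Filter ι} {n k₀ kL kR : ι → ℕ} {x : ι → ℕ → F} {e : ι → ℕ → ℝ}
  {SL SR : F →L[ℝ] F} {σ : ℝ} {Ja Jb : F →L[ℝ] E} {γ₀ : E}
  {Pa Pb : E →L[ℝ] F} {Hop : E →L[ℝ] E} {m : E} {b : ℝ} {dLS : ι → E} {κLS : ι → ℕ} {α : ι → ℝ}
  {K : ι → Finset ℕ} {wt : ι → ℕ → ℝ}

omit [FiniteDimensional ℝ E] [MeasurableSpace E] [BorelSpace E] in
theorem true_break_near (h : RegularSample l n k₀ kL kR x e (Pb γ₀ - Pa γ₀) SL SR σ) :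
    ∀ᶠ i in l, gramForm (x i) (window (k₀ i) (k₀ i)) (Pb γ₀ - Pa γ₀) < (n i : ℝ) ^ (0.35 : ℝ) := by
  filter_upwards [h.eventually_size_pos] with i hi
  have : gramForm (x i) (window (k₀ i) (k₀ i)) (Pb γ₀ - Pa γ₀) = 0 := by simp [window, gramForm]
  rw [this]; positivity

omit [MeasurableSpace E] [BorelSpace E] in
-- For near breaks the minimal energy over `n` tends to `σ² / 2 > 0`, uniformly by selections; for
-- far breaks the separation of the sums of squares applies. Either way it eventually exceeds `1`.
theorem energy_min_ge [l.NeBot] (h : RegularSample l n k₀ kL kR x e (Pb γ₀ - Pa γ₀) SL SR σ)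
    (hσ : 0 < σ)
    (hPa : ∀ z γ, ⟪Ja z, γ⟫ = ⟪z, Pa γ⟫) (hPb : ∀ z γ, ⟪Jb z, γ⟫ = ⟪z, Pb γ⟫) {c : ℝ} (hc : 0 < c)
    (hP : ∀ γ, c * ‖γ‖ ^ 2 ≤ ‖Pa γ‖ ^ 2 + ‖Pb γ‖ ^ 2) (hH : ∀ u, 0 ≤ ⟪Hop u, u⟫) (hb : 0 ≤ b)
    (hKn : ∀ᶠ i in l, ∀ k ∈ K i, k ≤ n i) {μ : ℝ} (hμ : 0 < μ)
    (hcoer : ∀ᶠ i in l, ∀ k ∈ K i, ∀ u,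
      μ * ‖u‖ ^ 2 ≤ ⟪(rowGram Ja Jb (x i) (n i) k + Hop) u, u⟫)
    (hk₀ : ∀ᶠ i in l, k₀ i ∈ K i) :
    ∃ c' : ℝ, 0 < c' ∧ ∀ᶠ i in l, ∀ k ∈ K i, ∃ d,
      (rowGram Ja Jb (x i) (n i) k + Hop) d =
        rowScore Ja Jb (x i) (e i) (k₀ i) γ₀ (n i) k + Hop (m - γ₀) ∧
      1 ≤ energy Ja Jb (x i) (e i) (k₀ i) γ₀ Hop m b (n i) k (γ₀ + d) ∧
      ((n i : ℝ) ^ (0.35 : ℝ) ≤ gramForm (x i) (window (k₀ i) k) (Pb γ₀ - Pa γ₀) →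
        (∑ t ∈ range (n i), e i t ^ 2) / 2 + c' * (n i : ℝ) ^ (0.35 : ℝ) ≤
          energy Ja Jb (x i) (e i) (k₀ i) γ₀ Hop m b (n i) k (γ₀ + d)) := by
  obtain ⟨c', hc', hfar⟩ := h.rss_ge_of_far (Ja := Ja) (Jb := Jb) hPa hPb
  refine ⟨c' / 2, by positivity, ?_⟩
  have hnear : ∀ᶠ i in l, ∀ k, (k ∈ K i ∧
      gramForm (x i) (window (k₀ i) k) (Pb γ₀ - Pa γ₀) < (n i : ℝ) ^ (0.35 : ℝ)) →
      ∃ d, (rowGram Ja Jb (x i) (n i) k + Hop) d =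
        rowScore Ja Jb (x i) (e i) (k₀ i) γ₀ (n i) k + Hop (m - γ₀) ∧
      1 ≤ energy Ja Jb (x i) (e i) (k₀ i) γ₀ Hop m b (n i) k (γ₀ + d) := by
    refine eventually_forall_of_selections (κ₀ := k₀) (hk₀.and h.true_break_near) fun κ hκ => ?_
    have hex : ∀ᶠ i in l, ∃ d, (rowGram Ja Jb (x i) (n i) (κ i) + Hop) d =
        rowScore Ja Jb (x i) (e i) (k₀ i) γ₀ (n i) (κ i) + Hop (m - γ₀) := by
      filter_upwards [hκ, hcoer] with i hi hco
      exact exists_center hμ (hco _ hi.1) _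
    obtain ⟨d, hd⟩ := hex.choice
    have hlim := h.tendsto_energy (b := b) hPa hPb hc hP hH (hκ.mono fun _ hi => hi.2) hd
    have hn : Tendsto (fun i => (n i : ℝ)) l atTop := tendsto_natCast_atTop_atTop.comp h.size
    have htop := hlim.pos_mul_atTop (by positivity) hn
    filter_upwards [hd, htop.eventually_ge_atTop 1, h.eventually_size_pos] with i hi h1 hn
    refine ⟨d i, hi, ?_⟩
    rwa [div_mul_cancel₀ _ hn.ne'] at h1
  have hn : Tendsto (fun i => (n i : ℝ)) l atTop := tendsto_natCast_atTop_atTop.comp h.size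
  have hss := h.error.pos_mul_atTop (by positivity) hn
  filter_upwards [hnear, hfar, hcoer, hKn, hss.eventually_ge_atTop 2, h.eventually_size_pos]
    with i hnear hfar hco hKn hss hn k hk
  rw [div_mul_cancel₀ _ hn.ne'] at hss
  rcases lt_or_ge (gramForm (x i) (window (k₀ i) k) (Pb γ₀ - Pa γ₀)) ((n i : ℝ) ^ (0.35 : ℝ))
    with hlt | hge
  · obtain ⟨d, hd, h1⟩ := hnear k ⟨hk, hlt⟩
    exact ⟨d, hd, h1, fun hge => absurd hlt (not_lt.2 hge)⟩
  · obtain ⟨d, hd⟩ := exists_center hμ (hco _ hk)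
      (rowScore Ja Jb (x i) (e i) (k₀ i) γ₀ (n i) k + Hop (m - γ₀))
    have h1 := hfar k (hKn k hk) hge (γ₀ + d)
    have h2 := half_rss_le_energy (Ja := Ja) (Jb := Jb) (x := x i) (e := e i) (n := n i)
      (k₀ := k₀ i) (k := k) (γ₀ := γ₀) (m := m) hH hb (γ₀ + d)
    have h3 : 0 < c' * (n i : ℝ) ^ (0.35 : ℝ) := by positivity
    exact ⟨d, hd, by linarith, fun _ => by linarith⟩

theorem energyMass_bounds [l.NeBot]
    (h : RegularSample l n k₀ kL kR x e (Pb γ₀ - Pa γ₀) SL SR σ) (hσ : 0 < σ)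
    (hPa : ∀ z γ, ⟪Ja z, γ⟫ = ⟪z, Pa γ⟫) (hPb : ∀ z γ, ⟪Jb z, γ⟫ = ⟪z, Pb γ⟫) {c : ℝ} (hc : 0 < c)
    (hP : ∀ γ, c * ‖γ‖ ^ 2 ≤ ‖Pa γ‖ ^ 2 + ‖Pb γ‖ ^ 2)
    (hsym : ∀ u v, ⟪Hop u, v⟫ = ⟪u, Hop v⟫) (hH : ∀ u, 0 ≤ ⟪Hop u, u⟫) (hb : 0 ≤ b)
    (hα : ∀ᶠ i in l, (n i : ℝ) / 2 ≤ α i)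
    (hKn : ∀ᶠ i in l, ∀ k ∈ K i, k ≤ n i) {μ : ℝ} (hμ : 0 < μ)
    (hcoer : ∀ᶠ i in l, ∀ k ∈ K i, ∀ u,
      μ * ‖u‖ ^ 2 ≤ ⟪(rowGram Ja Jb (x i) (n i) k + Hop) u, u⟫)
    (hk₀ : ∀ᶠ i in l, k₀ i ∈ K i) :
    ∃ c' C : ℝ, 0 < c' ∧ 0 < C ∧ ∀ᶠ i in l, ∀ k ∈ K i,
      (∀ γ, 0 < energy Ja Jb (x i) (e i) (k₀ i) γ₀ Hop m b (n i) k γ) ∧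
      Integrable (fun γ => energy Ja Jb (x i) (e i) (k₀ i) γ₀ Hop m b (n i) k γ ^ (-α i)) ∧
      ((n i : ℝ) ^ (0.35 : ℝ) ≤ gramForm (x i) (window (k₀ i) k) (Pb γ₀ - Pa γ₀) →
        energyMass Ja Jb (x i) (e i) (k₀ i) γ₀ Hop m b (n i) (α i) k Set.univ ≤
        C * ((∑ t ∈ range (n i), e i t ^ 2) / 2 + c' * (n i : ℝ) ^ (0.35 : ℝ)) ^
          (-(α i - (Module.finrank ℝ E + 1)))) := by
  obtain ⟨c', hc', hmin⟩ := h.energy_min_ge (m := m) hσ hPa hPb hc hP hH hb hKn hμ hcoer hk₀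
  obtain ⟨C, hC, hint⟩ := exists_integral_rpow_neg_le E hμ
  refine ⟨c', C, hc', hC, ?_⟩
  have hn : Tendsto (fun i => (n i : ℝ)) l atTop := tendsto_natCast_atTop_atTop.comp h.size
  filter_upwards [hmin, hcoer, hα, hn.eventually_ge_atTop (2 * (Module.finrank ℝ E + 1))]
    with i hmin hco hα hn k hk
  obtain ⟨d, hd, h1, h2⟩ := hmin k hk
  have hlow : ∀ γ, energy Ja Jb (x i) (e i) (k₀ i) γ₀ Hop m b (n i) k (γ₀ + d) +
      μ / 2 * ‖γ - (γ₀ + d)‖ ^ 2 ≤ energy Ja Jb (x i) (e i) (k₀ i) γ₀ Hop m b (n i) k γ := by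
    intro γ
    have h3 := energy_completed (b := b) hsym hd (γ - (γ₀ + d))
    rw [add_sub_cancel] at h3
    rw [h3]
    linarith [hco k hk (γ - (γ₀ + d))]
  obtain ⟨hi1, hi2⟩ := hint _ _ _ (α i) (measurable_energy Ja Jb (x i) (e i) (k₀ i) γ₀ Hop m b (n i) k)
    h1 (by linarith) hlow
  refine ⟨fun γ => lt_of_lt_of_le (by positivity) (hlow γ), hi1, fun hfar => ?_⟩
  rw [energyMass, setIntegral_univ]
  refine hi2.trans ?_
  gcongr ?_ * ?_
  have hpos : 0 < (∑ t ∈ range (n i), e i t ^ 2) / 2 + c' * (n i : ℝ) ^ (0.35 : ℝ) := by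
    have h4 : 0 ≤ ∑ t ∈ range (n i), e i t ^ 2 := Finset.sum_nonneg fun _ _ => sq_nonneg _
    have h5 : (0 : ℝ) < n i := lt_of_lt_of_le (by positivity) hn
    positivity
  exact Real.rpow_le_rpow_of_nonpos hpos (h2 hfar) (by linarith)

/-- On the ball of radius `1 / n` around the true slope the energy exceeds `∑ e² / 2` by a bounded
amount: the score contributes at most `n^0.55 / n` and the Gram form `n / n²`, up to constants. The
volume of the ball gives the factor `n ^ (-dim)`. -/
theorem energyMass_true_ge (h : RegularSample l n k₀ kL kR x e (Pb γ₀ - Pa γ₀) SL SR σ)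
    (hPa : ∀ z γ, ⟪Ja z, γ⟫ = ⟪z, Pa γ⟫) (hPb : ∀ z γ, ⟪Jb z, γ⟫ = ⟪z, Pb γ⟫)
    (hα : ∀ᶠ i in l, (n i : ℝ) / 2 ≤ α i)
    (hpos : ∀ᶠ i in l, ∀ γ, 0 < energy Ja Jb (x i) (e i) (k₀ i) γ₀ Hop m b (n i) (k₀ i) γ)
    (hint : ∀ᶠ i in l,
      Integrable (fun γ => energy Ja Jb (x i) (e i) (k₀ i) γ₀ Hop m b (n i) (k₀ i) γ ^ (-α i))) :
    ∃ C : ℝ, ∀ᶠ i in l, volume.real (Metric.ball (0 : E) 1) *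
      (n i : ℝ) ^ (-(Module.finrank ℝ E : ℝ)) *
        ((∑ t ∈ range (n i), e i t ^ 2) / 2 + C) ^ (-α i) ≤
      energyMass Ja Jb (x i) (e i) (k₀ i) γ₀ Hop m b (n i) (α i) (k₀ i) Set.univ := by
  obtain ⟨C, hC, hnb⟩ := h.near_bounds (Ja := Ja) (Jb := Jb) hPa hPb
  obtain ⟨B, hB⟩ := h.bounded
  set R := (‖Ja‖ + ‖Jb‖) * B with hR
  set C' := b + (2 * C + R ^ 2 + ‖Hop‖ * (‖γ₀ - m‖ + 1) ^ 2) / 2 with hC'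
  refine ⟨C', ?_⟩
  filter_upwards [hnb, h.true_break_near, hα, hpos, hint, h.size.eventually_ge_atTop 1]
    with i hnb hnear hα hpos hint hn
  have hn1 : (1 : ℝ) ≤ n i := by exact_mod_cast hn
  have hn0 : (0 : ℝ) < n i := by linarith
  obtain ⟨-, -, hs, -⟩ := hnb _ hnear
  have hle : ∀ γ, ‖γ - γ₀‖ ≤ (n i : ℝ)⁻¹ →
      energy Ja Jb (x i) (e i) (k₀ i) γ₀ Hop m b (n i) (k₀ i) γ ≤
        (∑ t ∈ range (n i), e i t ^ 2) / 2 + C' := by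
    intro γ hγ
    rw [energy, rss_eq, rss_true]
    set u := γ - γ₀ with hu
    have h1 : -(2 * ⟪rowScore Ja Jb (x i) (e i) (k₀ i) γ₀ (n i) (k₀ i), u⟫) ≤ 2 * C := by
      have h2 := neg_le_of_abs_le (abs_real_inner_le_norm
        (rowScore Ja Jb (x i) (e i) (k₀ i) γ₀ (n i) (k₀ i)) u)
      have h3 : ‖rowScore Ja Jb (x i) (e i) (k₀ i) γ₀ (n i) (k₀ i)‖ * ‖u‖ ≤ C := by
        calc _ ≤ C * (n i : ℝ) ^ (0.55 : ℝ) * (n i : ℝ)⁻¹ := by gcongr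
          _ ≤ C * (n i : ℝ) ^ (1 : ℝ) * (n i : ℝ)⁻¹ := by
              exact mul_le_mul_of_nonneg_right (mul_le_mul_of_nonneg_left
                (Real.rpow_le_rpow_of_exponent_le hn1 (by norm_num)) hC) (by positivity)
          _ = C := by rw [Real.rpow_one, mul_inv_cancel_right₀ hn0.ne']
      linarith
    have h2 : ⟪rowGram Ja Jb (x i) (n i) (k₀ i) u, u⟫ ≤ R ^ 2 := by
      rw [rowGram, inner_gramOp]
      calc _ ≤ R ^ 2 * (range (n i)).card * ‖u‖ ^ 2 := gramForm_le (norm_row_le (hB i) (k₀ i)) _ u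
        _ ≤ R ^ 2 * n i * ((n i : ℝ)⁻¹) ^ 2 := by rw [Finset.card_range]; gcongr
        _ = R ^ 2 * (n i : ℝ)⁻¹ := by field_simp
        _ ≤ R ^ 2 * 1 := by gcongr; exact inv_le_one_of_one_le₀ hn1
        _ = R ^ 2 := mul_one _
    have h3 : ⟪Hop (γ - m), γ - m⟫ ≤ ‖Hop‖ * (‖γ₀ - m‖ + 1) ^ 2 := by
      have h4 : ‖γ - m‖ ≤ ‖γ₀ - m‖ + 1 := by
        calc ‖γ - m‖ = ‖(γ₀ - m) + u‖ := by congr 1; rw [hu]; abel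
          _ ≤ ‖γ₀ - m‖ + ‖u‖ := norm_add_le _ _
          _ ≤ _ := by gcongr; exact hγ.trans (inv_le_one_of_one_le₀ hn1)
      calc _ ≤ ‖Hop (γ - m)‖ * ‖γ - m‖ := real_inner_le_norm _ _
        _ ≤ ‖Hop‖ * ‖γ - m‖ * ‖γ - m‖ := by gcongr; exact Hop.le_opNorm _
        _ ≤ ‖Hop‖ * (‖γ₀ - m‖ + 1) * (‖γ₀ - m‖ + 1) := by gcongr
        _ = _ := by ring
    rw [hC']
    linarith
  have := le_integral_rpow_neg (f := energy Ja Jb (x i) (e i) (k₀ i) γ₀ Hop m b (n i) (k₀ i))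
    (y := γ₀) (r := (n i : ℝ)⁻¹) (a := (∑ t ∈ range (n i), e i t ^ 2) / 2 + C') (α := α i)
    (by positivity) (by linarith) hpos hint hle
  rw [energyMass, setIntegral_univ]
  rwa [inv_pow, ← Real.rpow_natCast, ← Real.rpow_neg hn0.le] at this

/-- Bernstein–von Mises theorem for the mixture over candidate breaks. -/
theorem mixture_tendsto [l.NeBot]
    (h : RegularSample l n k₀ kL kR x e (Pb γ₀ - Pa γ₀) SL SR σ) (hσ : 0 < σ)
    (hPa : ∀ z γ, ⟪Ja z, γ⟫ = ⟪z, Pa γ⟫) (hPb : ∀ z γ, ⟪Jb z, γ⟫ = ⟪z, Pb γ⟫) {c : ℝ} (hc : 0 < c)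
    (hP : ∀ γ, c * ‖γ‖ ^ 2 ≤ ‖Pa γ‖ ^ 2 + ‖Pb γ‖ ^ 2)
    (hsym : ∀ u v, ⟪Hop u, v⟫ = ⟪u, Hop v⟫) (hH : ∀ u, 0 ≤ ⟪Hop u, u⟫) (hb : 0 ≤ b)
    (hαlim : Tendsto (fun i => α i / n i) l (𝓝 (1 / 2)))
    (hα : ∀ᶠ i in l, (n i : ℝ) / 2 ≤ α i)
    (hKn : ∀ᶠ i in l, ∀ k ∈ K i, k ≤ n i) {μ : ℝ} (hμ : 0 < μ)
    (hcoer : ∀ᶠ i in l, ∀ k ∈ K i, ∀ u,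
      μ * ‖u‖ ^ 2 ≤ ⟪(rowGram Ja Jb (x i) (n i) k + Hop) u, u⟫)
    (hk₀ : ∀ᶠ i in l, k₀ i ∈ K i)
    (hwt : ∀ i k, 0 ≤ wt i k) (hwt_sum : ∀ᶠ i in l, ∑ k ∈ K i, wt i k = 1) {w : ℝ} (hw : 0 < w)
    (hwt_true : ∀ᶠ i in l, w / n i ≤ wt i (k₀ i))
    (hκLS : ∀ᶠ i in l,
      gramForm (x i) (window (k₀ i) (κLS i)) (Pb γ₀ - Pa γ₀) < (n i : ℝ) ^ (0.35 : ℝ))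
    (hdLS : ∀ᶠ i in l, rowGram Ja Jb (x i) (n i) (κLS i) (dLS i) =
      rowScore Ja Jb (x i) (e i) (k₀ i) γ₀ (n i) (κLS i)) {η : ℝ} (hη : 0 < η) :
    ∀ᶠ i in l, 0 < ∑ k ∈ K i, wt i k *
        energyMass Ja Jb (x i) (e i) (k₀ i) γ₀ Hop m b (n i) (α i) k Set.univ ∧
      (∀ k ∈ K i, (∀ γ, 0 < energy Ja Jb (x i) (e i) (k₀ i) γ₀ Hop m b (n i) k γ) ∧
        Integrable (fun γ => energy Ja Jb (x i) (e i) (k₀ i) γ₀ Hop m b (n i) k γ ^ (-α i))) ∧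
      ∀ S, MeasurableSet S →
        |(∑ k ∈ K i, wt i k * energyMass Ja Jb (x i) (e i) (k₀ i) γ₀ Hop m b (n i) (α i) k
            ((fun γ => Real.sqrt (n i) • (γ - (γ₀ + dLS i))) ⁻¹' S)) /
          (∑ k ∈ K i, wt i k *
            energyMass Ja Jb (x i) (e i) (k₀ i) γ₀ Hop m b (n i) (α i) k Set.univ) -
          gaussianRatio ((σ ^ 2)⁻¹ • gramLimit Ja Jb Pa Pb SL SR) S| ≤ η := by
  obtain ⟨c', C, hc', hC, hbd⟩ := h.energyMass_bounds (m := m) hσ hPa hPb hc hP hsym hH hb hα hKn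
    hμ hcoer hk₀
  have hbd₀ := hbd.and hk₀
  obtain ⟨C₀, htrue⟩ := h.energyMass_true_ge (m := m) hPa hPb hα
    (hbd₀.mono fun i hi => (hi.1 _ hi.2).1) (hbd₀.mono fun i hi => (hi.1 _ hi.2).2.1)
  have hvol : 0 < volume.real (Metric.ball (0 : E) 1) :=
    ENNReal.toReal_pos (Metric.measure_ball_pos volume _ one_pos).ne' measure_ball_lt_top.ne
  -- `p` is the power lost to integrability for far breaks; in `q`, `dim` comes from the volume of
  -- the ball and `1` from the prior weight `w / n` of the true break.
  have hratio := tendsto_far_ratio h.size (C := C₀) (p := Module.finrank ℝ E + 1)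
    (q := Module.finrank ℝ E + 1) (K := C) (V := w * volume.real (Metric.ball (0 : E) 1)) hc'
    (by positivity) (by positivity) h.error hα (by positivity) hC.le (half_pos hη)
  have hnear : ∀ᶠ i in l, ∀ k, (k ∈ K i ∧
      gramForm (x i) (window (k₀ i) k) (Pb γ₀ - Pa γ₀) < (n i : ℝ) ^ (0.35 : ℝ)) →
      ∀ S, MeasurableSet S →
      |energyMass Ja Jb (x i) (e i) (k₀ i) γ₀ Hop m b (n i) (α i) k
          ((fun γ => Real.sqrt (n i) • (γ - (γ₀ + dLS i))) ⁻¹' S) /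
        energyMass Ja Jb (x i) (e i) (k₀ i) γ₀ Hop m b (n i) (α i) k Set.univ -
        gaussianRatio ((σ ^ 2)⁻¹ • gramLimit Ja Jb Pa Pb SL SR) S| ≤ η / 2 := by
    refine eventually_forall_of_selections (κ₀ := k₀) (hk₀.and h.true_break_near) fun κ hκ => ?_
    have hex : ∀ᶠ i in l, ∃ d, (rowGram Ja Jb (x i) (n i) (κ i) + Hop) d =
        rowScore Ja Jb (x i) (e i) (k₀ i) γ₀ (n i) (κ i) + Hop (m - γ₀) := by
      filter_upwards [hκ, hcoer] with i hi hco
      exact exists_center hμ (hco _ hi.1) _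
    obtain ⟨d, hd⟩ := hex.choice
    exact h.conditional_posterior_tendsto hσ hPa hPb hc hP hsym hH hαlim
      (hκ.mono fun _ hi => hi.2) hκLS hd hdLS (half_pos hη)
  filter_upwards [hbd, htrue, hratio, hnear, hk₀, hwt_sum, hwt_true, h.eventually_size_pos]
    with i hbd htrue hratio hnear hk₀ hwt_sum hwt_true hn
  set M : ℕ → Set E → ℝ := fun k S =>
    energyMass Ja Jb (x i) (e i) (k₀ i) γ₀ Hop m b (n i) (α i) k S with hM
  set N : Set E → ℝ := gaussianRatio ((σ ^ 2)⁻¹ • gramLimit Ja Jb Pa Pb SL SR) with hN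
  have hMnn : ∀ k ∈ K i, ∀ S, 0 ≤ M k S := fun k hk S =>
    integral_nonneg fun γ => Real.rpow_nonneg ((hbd k hk).1 γ).le _
  have hMmono : ∀ k ∈ K i, ∀ S, M k S ≤ M k Set.univ := fun k hk S => by
    simp only [hM, energyMass, setIntegral_univ]
    exact setIntegral_le_integral (hbd k hk).2.1
      (Eventually.of_forall fun γ => Real.rpow_nonneg ((hbd k hk).1 γ).le _)
  have hMpos : ∀ k ∈ K i, 0 < M k Set.univ := fun k hk => by
    simp only [hM, energyMass, setIntegral_univ]
    refine (integral_pos_iff_support_of_nonneg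
      (fun γ => Real.rpow_nonneg ((hbd k hk).1 γ).le _) (hbd k hk).2.1).2 ?_
    have : Function.support (fun γ =>
        energy Ja Jb (x i) (e i) (k₀ i) γ₀ Hop m b (n i) k γ ^ (-α i)) = Set.univ := by
      ext γ
      simpa using (Real.rpow_pos_of_pos ((hbd k hk).1 γ) _).ne'
    rw [this]
    exact Measure.measure_univ_pos.2 (NeZero.ne _)
  set tot := ∑ k ∈ K i, wt i k * M k Set.univ with htot
  have hterm : wt i (k₀ i) * M (k₀ i) Set.univ ≤ tot :=
    Finset.single_le_sum (f := fun k => wt i k * M k Set.univ)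
      (fun k hk => mul_nonneg (hwt i k) (hMnn k hk _)) hk₀
  have hw0 : 0 < wt i (k₀ i) := lt_of_lt_of_le (by positivity) hwt_true
  have htotpos : 0 < tot := lt_of_lt_of_le (mul_pos hw0 (hMpos _ hk₀)) hterm
  refine ⟨htotpos, fun k hk => ⟨(hbd k hk).1, (hbd k hk).2.1⟩, fun S hS => ?_⟩
  set S' := (fun γ => Real.sqrt (n i) • (γ - (γ₀ + dLS i))) ⁻¹' S with hS'
  have hN01 : 0 ≤ N S ∧ N S ≤ 1 := by
    have hnn : ∀ θ : E, 0 ≤ Real.exp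
      (-⟪((σ ^ 2)⁻¹ • gramLimit Ja Jb Pa Pb SL SR) θ, θ⟫ / 2) := fun θ => (Real.exp_pos _).le
    refine ⟨div_nonneg (integral_nonneg hnn) (integral_nonneg hnn), ?_⟩
    by_cases hint : Integrable fun θ : E => Real.exp
      (-⟪((σ ^ 2)⁻¹ • gramLimit Ja Jb Pa Pb SL SR) θ, θ⟫ / 2)
    · exact div_le_one_of_le₀ (setIntegral_le_integral hint (Eventually.of_forall hnn))
        (integral_nonneg hnn)
    -- By convention both the undefined integral and the quotient are zero.
    · rw [hN, gaussianRatio, integral_undef hint, div_zero]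
      exact zero_le_one
  have hfar : ∀ k ∈ K i, (n i : ℝ) ^ (0.35 : ℝ) ≤
      gramForm (x i) (window (k₀ i) k) (Pb γ₀ - Pa γ₀) → M k Set.univ ≤ η / 2 * tot := by
    intro k hk hge
    refine ((hbd k hk).2.2 hge).trans (hratio.trans ?_)
    have h1 : w * volume.real (Metric.ball (0 : E) 1) *
        (n i : ℝ) ^ (-(Module.finrank ℝ E + 1 : ℝ)) *
        ((∑ t ∈ range (n i), e i t ^ 2) / 2 + C₀) ^ (-α i) ≤ tot := by
      refine le_trans ?_ hterm
      calc _ = w / n i * (volume.real (Metric.ball (0 : E) 1) *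
            (n i : ℝ) ^ (-(Module.finrank ℝ E : ℝ)) *
            ((∑ t ∈ range (n i), e i t ^ 2) / 2 + C₀) ^ (-α i)) := by
            rw [neg_add, Real.rpow_add hn, Real.rpow_neg_one]; ring
        _ ≤ w / n i * M (k₀ i) Set.univ := by gcongr
        _ ≤ _ := mul_le_mul_of_nonneg_right hwt_true (hMnn _ hk₀ _)
    gcongr
  -- The first term serves the near breaks, the second the far ones. Since the weights sum to one,
  -- the weighted sum over `k` is `η * tot`; the number of breaks does not enter.
  have hk : ∀ k ∈ K i, |M k S' - N S * M k Set.univ| ≤ η / 2 * M k Set.univ + η / 2 * tot := by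
    intro k hk
    rcases lt_or_ge (gramForm (x i) (window (k₀ i) k) (Pb γ₀ - Pa γ₀)) ((n i : ℝ) ^ (0.35 : ℝ))
      with hlt | hge
    · have h1 := hnear k ⟨hk, hlt⟩ S hS
      have h2 : M k S' - N S * M k Set.univ = (M k S' / M k Set.univ - N S) * M k Set.univ := by
        have := (hMpos k hk).ne'
        field_simp
      rw [h2, abs_mul, abs_of_pos (hMpos k hk)]
      have h3 : |M k S' / M k Set.univ - N S| * M k Set.univ ≤ η / 2 * M k Set.univ :=
        mul_le_mul_of_nonneg_right h1 (hMpos k hk).le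
      have : 0 ≤ η / 2 * tot := by positivity
      linarith
    · have h1 := hfar k hk hge
      have h2 := hMmono k hk S'
      have h3 := hMnn k hk S'
      have h4 : N S * M k Set.univ ≤ M k Set.univ :=
        mul_le_of_le_one_left (hMpos k hk).le hN01.2
      have h5 : 0 ≤ N S * M k Set.univ := mul_nonneg hN01.1 (hMpos k hk).le
      have h6 : 0 ≤ η / 2 * M k Set.univ := mul_nonneg (by positivity) (hMpos k hk).le
      rw [abs_le]
      constructor <;> linarith
  have hdiff : |(∑ k ∈ K i, wt i k * M k S') - N S * tot| ≤ η * tot := by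
    have h1 : (∑ k ∈ K i, wt i k * M k S') - N S * tot =
        ∑ k ∈ K i, wt i k * (M k S' - N S * M k Set.univ) := by
      rw [htot, Finset.mul_sum, ← Finset.sum_sub_distrib]
      exact Finset.sum_congr rfl fun k _ => by ring
    rw [h1]
    calc _ ≤ ∑ k ∈ K i, wt i k * (η / 2 * M k Set.univ + η / 2 * tot) := by
          refine (Finset.abs_sum_le_sum_abs _ _).trans (Finset.sum_le_sum fun k hk' => ?_)
          rw [abs_mul, abs_of_nonneg (hwt i k)]
          exact mul_le_mul_of_nonneg_left (hk k hk') (hwt i k)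
      _ = η / 2 * tot + η / 2 * tot * ∑ k ∈ K i, wt i k := by
          rw [htot, Finset.mul_sum, Finset.mul_sum, ← Finset.sum_add_distrib]
          exact Finset.sum_congr rfl fun k _ => by ring
      _ = η * tot := by rw [hwt_sum]; ring
  rw [div_sub' htotpos.ne', abs_div, abs_of_pos htotpos, div_le_iff₀ htotpos, mul_comm tot]
  exact hdiff

end RegularSample
end StructuralBreak
end

/-! ### The design matrix as a two-regime regression -/

noncomputable section
namespace StructuralBreak
open scoped RealInnerProductSpace
open Finset (range Ico)

section Slopes

variable {dx dz : ℕ}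

/-- The regression coefficients of the first regime. -/
def earlySlope (dx dz : ℕ) : EuclideanSpace ℝ (Fin dx ⊕ Fin dz) →L[ℝ] EuclideanSpace ℝ (Fin dx) :=
  LinearMap.toContinuousLinearMap
    { toFun := fun γ => WithLp.toLp 2 fun i => γ (Sum.inl i)
      map_add' := fun _ _ => by ext; simp
      map_smul' := fun _ _ => by ext; simp }

/-- The regression coefficients `β + R δ` of the second regime. -/
def lateSlope (R : Matrix (Fin dx) (Fin dz) ℝ) :
    EuclideanSpace ℝ (Fin dx ⊕ Fin dz) →L[ℝ] EuclideanSpace ℝ (Fin dx) :=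
  LinearMap.toContinuousLinearMap
    { toFun := fun γ => WithLp.toLp 2 fun i =>
        γ (Sum.inl i) + R.mulVec (fun j => γ (Sum.inr j)) i
      map_add' := fun γ γ' => by
        ext i
        change (γ (Sum.inl i) + γ' (Sum.inl i)) +
          R.mulVec ((fun j => γ (Sum.inr j)) + fun j => γ' (Sum.inr j)) i =
          (γ (Sum.inl i) + R.mulVec (fun j => γ (Sum.inr j)) i) +
            (γ' (Sum.inl i) + R.mulVec (fun j => γ' (Sum.inr j)) i)
        rw [Matrix.mulVec_add, Pi.add_apply]
        ring
      map_smul' := fun c γ => by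
        ext i
        change c * γ (Sum.inl i) + R.mulVec (c • fun j => γ (Sum.inr j)) i =
          c * (γ (Sum.inl i) + R.mulVec (fun j => γ (Sum.inr j)) i)
        rw [Matrix.mulVec_smul, Pi.smul_apply, smul_eq_mul]
        ring }

theorem earlySlope_apply (γ : EuclideanSpace ℝ (Fin dx ⊕ Fin dz)) (i : Fin dx) :
    earlySlope dx dz γ i = γ (Sum.inl i) := rfl

theorem lateSlope_apply (R : Matrix (Fin dx) (Fin dz) ℝ)
    (γ : EuclideanSpace ℝ (Fin dx ⊕ Fin dz)) (i : Fin dx) :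
    lateSlope R γ i = γ (Sum.inl i) + R.mulVec (fun j => γ (Sum.inr j)) i := rfl

/-- The row of the design matrix belonging to an observation in the first regime. -/
def earlyRow (dx dz : ℕ) : EuclideanSpace ℝ (Fin dx) →L[ℝ] EuclideanSpace ℝ (Fin dx ⊕ Fin dz) :=
  ContinuousLinearMap.adjoint (earlySlope dx dz)

/-- The row of the design matrix belonging to an observation in the second regime. -/
def lateRow (R : Matrix (Fin dx) (Fin dz) ℝ) :
    EuclideanSpace ℝ (Fin dx) →L[ℝ] EuclideanSpace ℝ (Fin dx ⊕ Fin dz) :=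
  ContinuousLinearMap.adjoint (lateSlope R)

theorem inner_earlyRow (z : EuclideanSpace ℝ (Fin dx)) (γ : EuclideanSpace ℝ (Fin dx ⊕ Fin dz)) :
    ⟪earlyRow dx dz z, γ⟫ = ⟪z, earlySlope dx dz γ⟫ :=
  ContinuousLinearMap.adjoint_inner_left _ _ _

theorem inner_lateRow (R : Matrix (Fin dx) (Fin dz) ℝ) (z : EuclideanSpace ℝ (Fin dx))
    (γ : EuclideanSpace ℝ (Fin dx ⊕ Fin dz)) : ⟪lateRow R z, γ⟫ = ⟪z, lateSlope R γ⟫ :=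
  ContinuousLinearMap.adjoint_inner_left _ _ _

/-- Full column rank makes `(β, δ) ↦ (β, β + R δ)` injective, and an injective linear map in finite
dimension is bounded below. -/
theorem exists_slopes_coercive {R : Matrix (Fin dx) (Fin dz) ℝ} (hR : LinearIndependent ℝ R.col) :
    ∃ c : ℝ, 0 < c ∧ ∀ γ, c * ‖γ‖ ^ 2 ≤ ‖earlySlope dx dz γ‖ ^ 2 + ‖lateSlope R γ‖ ^ 2 := by
  have hker : ((earlySlope dx dz).prod (lateSlope R)).toLinearMap.ker = ⊥ := by
    rw [LinearMap.ker_eq_bot']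
    intro γ hγ
    have h1 : earlySlope dx dz γ = 0 := congrArg Prod.fst hγ
    have h2 : lateSlope R γ = 0 := congrArg Prod.snd hγ
    have h3 : ∀ i, γ (Sum.inl i) = 0 := fun i => by
      rw [← earlySlope_apply, h1]; rfl
    have h4 : R.mulVec (fun j => γ (Sum.inr j)) = 0 := by
      ext i
      have := lateSlope_apply R γ i
      rw [h2, h3, zero_add] at this
      exact this.symm
    have h5 := Matrix.mulVec_injective_iff.2 hR (h4.trans (Matrix.mulVec_zero R).symm)
    ext (i | j)
    · exact h3 i
    · exact congrFun h5 j
  obtain ⟨K, hK, hanti⟩ := LinearMap.exists_antilipschitzWith _ hker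
  have hK' : (0 : ℝ) < K := hK
  refine ⟨((K : ℝ) ^ 2)⁻¹, by positivity, fun γ => ?_⟩
  have h1 := hanti.le_mul_dist γ 0
  rw [map_zero, dist_zero_right, dist_zero_right] at h1
  have h2 : ‖((earlySlope dx dz).prod (lateSlope R)).toLinearMap γ‖ ^ 2 ≤
      ‖earlySlope dx dz γ‖ ^ 2 + ‖lateSlope R γ‖ ^ 2 := by
    change ‖(earlySlope dx dz γ, lateSlope R γ)‖ ^ 2 ≤ _
    rw [Prod.norm_def]
    rcases max_cases ‖earlySlope dx dz γ‖ ‖lateSlope R γ‖ with h | h <;> rw [h.1] <;>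
      nlinarith [sq_nonneg ‖earlySlope dx dz γ‖, sq_nonneg ‖lateSlope R γ‖]
  refine le_trans ?_ h2
  rw [inv_mul_le_iff₀ (by positivity), ← mul_pow]
  gcongr

theorem lateSlope_sub_earlySlope_slope (R : Matrix (Fin dx) (Fin dz) ℝ)
    (β : EuclideanSpace ℝ (Fin dx)) (δ : EuclideanSpace ℝ (Fin dz)) (i : Fin dx) :
    (lateSlope R (slope β δ) - earlySlope dx dz (slope β δ)) i = R.mulVec δ i := by
  rw [PiLp.sub_apply, lateSlope_apply, earlySlope_apply]
  simp [slope]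

theorem jump_ne_zero {R : Matrix (Fin dx) (Fin dz) ℝ} (hR : LinearIndependent ℝ R.col)
    (β : EuclideanSpace ℝ (Fin dx)) {δ : EuclideanSpace ℝ (Fin dz)} (hδ : δ ≠ 0) :
    lateSlope R (slope β δ) - earlySlope dx dz (slope β δ) ≠ 0 := by
  intro h
  apply hδ
  have h1 : R.mulVec δ = 0 := by
    ext i
    rw [← lateSlope_sub_earlySlope_slope R β, h]; rfl
  have := Matrix.mulVec_injective_iff.2 hR (h1.trans (Matrix.mulVec_zero R).symm)
  ext j
  exact congrFun this j

variable (R : Matrix (Fin dx) (Fin dz) ℝ) (x : ℕ → EuclideanSpace ℝ (Fin dx)) (e : ℕ → ℝ)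
  (γ₀ γ : EuclideanSpace ℝ (Fin dx ⊕ Fin dz)) (T : ℕ) (τ₀ τ : ℝ)

theorem design_mulVec (i : Fin T) : (design R x T τ).mulVec γ i =
    ⟪row (earlyRow dx dz) (lateRow R) x (breakIndex τ T) i, γ⟫ := by
  have hin : ∀ z w : EuclideanSpace ℝ (Fin dx), ⟪z, w⟫ = ∑ j, z j * w j := fun z w => by
    simp [PiLp.inner_apply, mul_comm]
  rw [design, Matrix.fromCols_mulVec, Pi.add_apply, ← Matrix.mulVec_mulVec]
  have h1 : (regressors x T).mulVec (γ ∘ Sum.inl) i = ∑ j, x i j * γ (Sum.inl j) := rfl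
  rw [row]
  split_ifs with h
  · have h2 : (lateRegressors x T τ).mulVec (R.mulVec (γ ∘ Sum.inr)) i = 0 := by
      simp [lateRegressors, Matrix.mulVec, dotProduct, not_le.2 h]
    rw [h2, inner_earlyRow, hin, h1, add_zero]
    rfl
  · have h2 : (lateRegressors x T τ).mulVec (R.mulVec (γ ∘ Sum.inr)) i =
        ∑ j, x i j * R.mulVec (γ ∘ Sum.inr) j := by
      simp [lateRegressors, Matrix.mulVec, dotProduct, not_lt.1 h]
    rw [h2, inner_lateRow, hin, h1, ← Finset.sum_add_distrib]
    refine Finset.sum_congr rfl fun j _ => ?_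
    rw [lateSlope_apply, mul_add]
    rfl

theorem sumSq_response : sumSq R x T (response R x e γ₀ τ₀ T) τ γ =
    rss (earlyRow dx dz) (lateRow R) x e (breakIndex τ₀ T) γ₀ T (breakIndex τ T) γ := by
  rw [sumSq, rss, ← Fin.sum_univ_eq_sum_range
    (fun t => (⟪row (earlyRow dx dz) (lateRow R) x (breakIndex τ₀ T) t, γ₀⟫ + e t -
      ⟪row (earlyRow dx dz) (lateRow R) x (breakIndex τ T) t, γ⟫) ^ 2)]
  refine Finset.sum_congr rfl fun i _ => ?_
  rw [response, design_mulVec, design_mulVec]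

end Slopes

/-! ### Integrating out the error variance -/

section Scale

/-- The substitution `y = s⁻¹` turns the integral into Euler's integral for `Γ`. -/
theorem lintegral_inverseGamma {α A : ℝ} (hα : 0 < α) (hA : 0 < A) :
    ∫⁻ s in Set.Ioi (0 : ℝ), ENNReal.ofReal (s ^ (-α - 1) * Real.exp (-A / s)) =
      ENNReal.ofReal (Real.Gamma α * A ^ (-α)) := by
  have hker : ∀ s ∈ Set.Ioi (0 : ℝ), (|(-1 : ℝ)| * s ^ ((-1 : ℝ) - 1)) •
      (fun y : ℝ => y ^ (α - 1) * Real.exp (-(A * y))) (s ^ (-1 : ℝ)) =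
      s ^ (-α - 1) * Real.exp (-A / s) := by
    intro s hs
    have hs' : (0 : ℝ) < s := hs
    simp only [abs_neg, abs_one, one_mul, smul_eq_mul]
    rw [← Real.rpow_mul hs'.le, ← mul_assoc, ← Real.rpow_add hs', Real.rpow_neg_one]
    congr 2
    · ring
    · rw [neg_div, div_eq_mul_inv]
  have hint : ∫ s in Set.Ioi (0 : ℝ), s ^ (-α - 1) * Real.exp (-A / s) =
      Real.Gamma α * A ^ (-α) := by
    have hsub := integral_comp_rpow_Ioi (fun y : ℝ => y ^ (α - 1) * Real.exp (-(A * y)))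
      (p := -1) (by norm_num)
    rw [← setIntegral_congr_fun measurableSet_Ioi hker, hsub, Real.integral_rpow_mul_exp_neg_mul_Ioi hα hA,
      one_div, Real.inv_rpow hA.le, Real.rpow_neg hA.le, mul_comm]
  have hpos : 0 < Real.Gamma α * A ^ (-α) :=
    mul_pos (Real.Gamma_pos_of_pos hα) (Real.rpow_pos_of_pos hA _)
  rw [← hint, ofReal_integral_eq_lintegral_ofReal]
  -- A Bochner integral with nonzero value belongs to an integrable function.
  · by_contra hni
    rw [integral_undef hni] at hint
    exact hpos.ne hint
  · filter_upwards [ae_restrict_mem measurableSet_Ioi] with s hs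
    have hs' : (0 : ℝ) < s := hs
    change (0 : ℝ) ≤ _
    positivity

variable {dx dz : ℕ} (R : Matrix (Fin dx) (Fin dz) ℝ) (x : ℕ → EuclideanSpace ℝ (Fin dx))
  (e : ℕ → ℝ) (γ₀ m γ : EuclideanSpace ℝ (Fin dx ⊕ Fin dz)) (T : ℕ) (τ₀ τ : ℝ)
  (H : Matrix (Fin dx ⊕ Fin dz) (Fin dx ⊕ Fin dz) ℝ) (a b : ℝ)

/-- The exponent of the marginal posterior kernel of the slopes. -/
def posteriorExponent (dx dz : ℕ) (a : ℝ) (T : ℕ) : ℝ :=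
  (T : ℝ) / 2 + (Fintype.card (Fin dx ⊕ Fin dz) : ℝ) / 2 + a

/-- The energy of the slopes under the model with break index `k`. -/
abbrev modelEnergy (k : ℕ) (γ : EuclideanSpace ℝ (Fin dx ⊕ Fin dz)) : ℝ :=
  energy (earlyRow dx dz) (lateRow R) x e (breakIndex τ₀ T) γ₀ (Matrix.toEuclideanCLM (𝕜 := ℝ) H)
    m b T k γ

/-- As a function of `s` this is an inverse gamma kernel whose rate is the energy. For the improper
prior, `a = -k / 2` cancels the power of `s` in the Gaussian prior factor and the exponent is `T /
2`. -/
theorem likelihood_mul_priorKernel {s : ℝ} (hs : 0 < s) :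
    likelihood R x T (response R x e γ₀ τ₀ T) τ s γ * priorKernel m H a b s γ =
      (2 * Real.pi) ^ (-(T : ℝ) / 2) * (s ^ (-posteriorExponent dx dz a T - 1) *
        Real.exp (-modelEnergy R x e γ₀ m T τ₀ H b (breakIndex τ T) γ / s)) := by
  have hquad : ⟪Matrix.toEuclideanCLM (𝕜 := ℝ) H (γ - m), γ - m⟫ =
      (γ - m).ofLp ⬝ᵥ H.mulVec (γ - m).ofLp := by
    rw [EuclideanSpace.inner_eq_star_dotProduct]
    rw [Matrix.ofLp_toEuclideanCLM, star_trivial]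
  have hlik : likelihood R x T (response R x e γ₀ τ₀ T) τ s γ =
      (2 * Real.pi) ^ (-(T : ℝ) / 2) * s ^ (-(T : ℝ) / 2) *
        Real.exp (-(sumSq R x T (response R x e γ₀ τ₀ T) τ γ) / (2 * s)) := by
    rw [likelihood, Finset.prod_mul_distrib, ← Real.exp_sum, Finset.prod_const, Finset.card_univ,
      Fintype.card_fin, ← Finset.sum_div, Finset.sum_neg_distrib, sumSq,
      ← Real.mul_rpow (by positivity) hs.le]
    congr 1
    rw [Real.sqrt_eq_rpow, ← Real.rpow_neg (by positivity), ← Real.rpow_natCast,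
      ← Real.rpow_mul (by positivity)]
    congr 1
    ring
  rw [hlik, priorKernel, sumSq_response, modelEnergy, energy, hquad]
  have h1 : s ^ (-posteriorExponent dx dz a T - 1) =
      s ^ (-(T : ℝ) / 2) * s ^ (-(Fintype.card (Fin dx ⊕ Fin dz) : ℝ) / 2) * s ^ (-a - 1) := by
    rw [← Real.rpow_add hs, ← Real.rpow_add hs, posteriorExponent]
    congr 1
    ring
  have h2 : Real.exp (-(b + (rss (earlyRow dx dz) (lateRow R) x e (breakIndex τ₀ T) γ₀ T
      (breakIndex τ T) γ + (γ - m).ofLp ⬝ᵥ H.mulVec (γ - m).ofLp) / 2) / s) =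
      Real.exp (-(rss (earlyRow dx dz) (lateRow R) x e (breakIndex τ₀ T) γ₀ T
        (breakIndex τ T) γ) / (2 * s)) *
      Real.exp (-((γ - m).ofLp ⬝ᵥ H.mulVec (γ - m).ofLp) / (2 * s)) * Real.exp (-b / s) := by
    rw [← Real.exp_add, ← Real.exp_add]
    congr 1
    field_simp
    ring
  rw [h1, h2]
  simp only [WithLp.ofLp_sub]
  ring

theorem lintegral_scale (hα : 0 < posteriorExponent dx dz a T)
    (hpos : 0 < modelEnergy R x e γ₀ m T τ₀ H b (breakIndex τ T) γ) {q : ℝ} (hq : 0 ≤ q) :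
    ∫⁻ s in Set.Ioi (0 : ℝ), ENNReal.ofReal (likelihood R x T (response R x e γ₀ τ₀ T) τ s γ *
      (priorKernel m H a b s γ * q)) =
    ENNReal.ofReal ((2 * Real.pi) ^ (-(T : ℝ) / 2) * Real.Gamma (posteriorExponent dx dz a T)) *
      ENNReal.ofReal (modelEnergy R x e γ₀ m T τ₀ H b (breakIndex τ T) γ ^
        (-posteriorExponent dx dz a T)) * ENNReal.ofReal q := by
  have hG := Real.Gamma_pos_of_pos hα
  have h1 : ∀ s ∈ Set.Ioi (0 : ℝ),
      ENNReal.ofReal (likelihood R x T (response R x e γ₀ τ₀ T) τ s γ *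
        (priorKernel m H a b s γ * q)) =
      ENNReal.ofReal ((2 * Real.pi) ^ (-(T : ℝ) / 2) * q) *
        ENNReal.ofReal (s ^ (-posteriorExponent dx dz a T - 1) *
        Real.exp (-modelEnergy R x e γ₀ m T τ₀ H b (breakIndex τ T) γ / s)) := by
    intro s hs
    rw [← mul_assoc, likelihood_mul_priorKernel R x e γ₀ m γ T τ₀ τ H a b hs,
      ← ENNReal.ofReal_mul (by positivity)]
    congr 1
    ring
  rw [setLIntegral_congr_fun measurableSet_Ioi h1, lintegral_const_mul' _ _ ENNReal.ofReal_ne_top,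
    lintegral_inverseGamma hα hpos, ← ENNReal.ofReal_mul (by positivity),
    ← ENNReal.ofReal_mul (by positivity), ← ENNReal.ofReal_mul (by positivity)]
  congr 1
  ring

end Scale

end StructuralBreak
end

/-! ### Break indices and their prior weights -/

noncomputable section
namespace StructuralBreak
open scoped RealInnerProductSpace
open Finset (range Ico)

theorem breakIndex_le {τ : ℝ} (hτ : τ ≤ 1) (T : ℕ) : breakIndex τ T ≤ T := by
  have h1 : ⌈τ * T⌉₊ ≤ T := Nat.ceil_le.2 (mul_le_of_le_one_left (Nat.cast_nonneg T) hτ)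
  exact (Nat.sub_le _ _).trans h1

theorem measurable_breakIndex (T : ℕ) : Measurable fun τ : ℝ => breakIndex τ T :=
  (measurable_from_nat (f := fun n : ℕ => n - 1)).comp
    (Nat.measurable_ceil.comp (measurable_id.mul_const (T : ℝ)))

/-- The cell of index `k` is the half-open interval `(k / T, (k + 1) / T]`. Positivity of `τ * T`
keeps the truncated subtraction in `breakIndex` from interfering. -/
theorem breakIndex_eq_iff {τ : ℝ} {T k : ℕ} (h : 0 < τ * T) :
    breakIndex τ T = k ↔ (k : ℝ) < τ * T ∧ τ * T ≤ k + 1 := by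
  have h0 : 0 < ⌈τ * T⌉₊ := Nat.ceil_pos.2 h
  have h1 : breakIndex τ T = k ↔ ⌈τ * T⌉₊ = k + 1 := by rw [breakIndex]; omega
  rw [h1, Nat.ceil_eq_iff (Nat.succ_ne_zero k)]
  simp

theorem breakIndex_lt {τ : ℝ} {T : ℕ} (h : 0 < τ * T) : (breakIndex τ T : ℝ) < τ * T :=
  ((breakIndex_eq_iff h).1 rfl).1

theorem le_breakIndex_add_one {τ : ℝ} {T : ℕ} (h : 0 < τ * T) : τ * T ≤ breakIndex τ T + 1 :=
  ((breakIndex_eq_iff h).1 rfl).2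

open Classical in
/-- The break indices that occur for break locations in `H₀`. -/
def admissibleBreaks (H₀ : Set ℝ) (T : ℕ) : Finset ℕ :=
  (range (T + 1)).filter fun k => ∃ τ ∈ H₀, breakIndex τ T = k

theorem mem_admissibleBreaks {H₀ : Set ℝ} (hH₀ : H₀ ⊆ Set.Ioo 0 1) {T k : ℕ} :
    k ∈ admissibleBreaks H₀ T ↔ ∃ τ ∈ H₀, breakIndex τ T = k := by
  rw [admissibleBreaks]
  simp only [Finset.mem_filter, Finset.mem_range, Nat.lt_succ_iff]
  refine ⟨fun h => h.2, fun h => ⟨?_, h⟩⟩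
  obtain ⟨τ, hτ, rfl⟩ := h
  exact breakIndex_le (hH₀ hτ).2.le T

theorem le_of_mem_admissibleBreaks {H₀ : Set ℝ} {T k : ℕ} (h : k ∈ admissibleBreaks H₀ T) :
    k ≤ T := by
  rw [admissibleBreaks] at h
  simp only [Finset.mem_filter, Finset.mem_range] at h
  omega

/-- The prior probability of the break index `k`. -/
def breakWeight (H₀ : Set ℝ) (p : ℝ → ℝ) (T k : ℕ) : ℝ :=
  (∫⁻ τ in H₀ ∩ (fun τ => breakIndex τ T) ⁻¹' {k}, ENNReal.ofReal (p τ)).toReal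

theorem breakWeight_nonneg (H₀ : Set ℝ) (p : ℝ → ℝ) (T k : ℕ) : 0 ≤ breakWeight H₀ p T k :=
  ENNReal.toReal_nonneg

section Prior

variable {H₀ : Set ℝ} {p : ℝ → ℝ} {τ₀ : ℝ} (hp : BreakPrior H₀ p τ₀)
include hp

theorem BreakPrior.lintegral_ne_top (s : Set ℝ) :
    ∫⁻ τ in H₀ ∩ s, ENNReal.ofReal (p τ) ≠ ⊤ :=
  ne_top_of_le_ne_top (by rw [hp.lintegral_eq_one]; exact ENNReal.one_ne_top)
    (lintegral_mono_set Set.inter_subset_left)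

/-- Cutting `H₀` into the cells of constant break index turns the mixture over `τ` into a finite
one. -/
theorem BreakPrior.lintegral_breakIndex (hH₀ : MeasurableSet H₀) (hsub : H₀ ⊆ Set.Ioo 0 1) (T : ℕ)
    (g : ℕ → ENNReal) :
    ∫⁻ τ in H₀, g (breakIndex τ T) * ENNReal.ofReal (p τ) =
      ∑ k ∈ admissibleBreaks H₀ T, g k * ENNReal.ofReal (breakWeight H₀ p T k) := by
  have hU : H₀ = ⋃ k ∈ admissibleBreaks H₀ T, H₀ ∩ (fun τ => breakIndex τ T) ⁻¹' {k} := by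
    ext τ
    simp only [Set.mem_iUnion, Set.mem_inter_iff, Set.mem_preimage, Set.mem_singleton_iff,
      exists_prop]
    exact ⟨fun h => ⟨_, (mem_admissibleBreaks hsub).2 ⟨τ, h, rfl⟩, h, rfl⟩, fun ⟨_, _, h, _⟩ => h⟩
  have hmeas : ∀ k, MeasurableSet (H₀ ∩ (fun τ => breakIndex τ T) ⁻¹' {k}) := fun k =>
    hH₀.inter (measurable_breakIndex T (measurableSet_singleton k))
  conv_lhs => rw [hU]
  rw [lintegral_biUnion_finset (fun i _ j _ hij => ?_) fun k _ => hmeas k]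
  · refine Finset.sum_congr rfl fun k _ => ?_
    rw [breakWeight, ENNReal.ofReal_toReal (hp.lintegral_ne_top _),
      ← lintegral_const_mul _ hp.measurable.ennreal_ofReal]
    refine setLIntegral_congr_fun (hmeas k) fun τ hτ => ?_
    have : breakIndex τ T = k := hτ.2
    simp only [this]
  · refine Set.disjoint_left.2 fun τ h1 h2 => hij ?_
    exact (h1.2 : breakIndex τ T = i).symm.trans h2.2

theorem BreakPrior.sum_breakWeight (hH₀ : MeasurableSet H₀) (hsub : H₀ ⊆ Set.Ioo 0 1) (T : ℕ) :
    ∑ k ∈ admissibleBreaks H₀ T, breakWeight H₀ p T k = 1 := by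
  have h := hp.lintegral_breakIndex hH₀ hsub T fun _ => 1
  simp only [one_mul, hp.lintegral_eq_one] at h
  rw [← ENNReal.ofReal_sum_of_nonneg fun _ _ => breakWeight_nonneg ..] at h
  have := congrArg ENNReal.toReal h
  rw [ENNReal.toReal_ofReal (Finset.sum_nonneg fun _ _ => breakWeight_nonneg ..)] at this
  simpa using this.symm

/-- The cell containing `τ₀` has length `1 / T` and for large `T` lies in the neighbourhood where
the density is at least `c`. -/
theorem BreakPrior.exists_le_breakWeight (hτ₀ : H₀ ∈ 𝓝 τ₀) (hsub : H₀ ⊆ Set.Ioo 0 1) :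
    ∃ w : ℝ, 0 < w ∧ ∀ᶠ T : ℕ in atTop, w / T ≤ breakWeight H₀ p T (breakIndex τ₀ T) := by
  obtain ⟨c, C, hc, hnear⟩ := hp.near
  have hτpos : 0 < τ₀ := (hsub (mem_of_mem_nhds hτ₀)).1
  obtain ⟨r, hr, hball⟩ := Metric.eventually_nhds_iff.1 (hnear.and hτ₀)
  refine ⟨c, hc, ?_⟩
  filter_upwards [eventually_gt_atTop 0, (tendsto_natCast_atTop_atTop (R := ℝ)).eventually_gt_atTop
    r⁻¹] with T hT hTr
  have hT' : (0 : ℝ) < T := by exact_mod_cast hT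
  set k := breakIndex τ₀ T with hk
  have hk1 := breakIndex_lt (mul_pos hτpos hT')
  have hk2 := le_breakIndex_add_one (mul_pos hτpos hT')
  have hTr' : 1 / (T : ℝ) < r := by
    rw [one_div]; exact inv_lt_of_inv_lt₀ hr hTr
  have hin : ∀ τ ∈ Set.Ioc ((k : ℝ) / T) ((k + 1) / T), (c ≤ p τ) ∧ τ ∈ H₀ ∧
      breakIndex τ T = k := by
    intro τ hτ
    have h1 : (k : ℝ) < τ * T := (div_lt_iff₀ hT').1 hτ.1
    have h2 : τ * T ≤ k + 1 := (le_div_iff₀ hT').1 hτ.2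
    have hd : dist τ τ₀ < r := by
      refine lt_of_le_of_lt ?_ hTr'
      rw [Real.dist_eq, le_div_iff₀ hT', ← abs_of_pos hT', ← abs_mul, sub_mul, abs_le]
      constructor <;> linarith
    have h3 := hball hd
    exact ⟨h3.1.1, h3.2, (breakIndex_eq_iff (lt_of_le_of_lt (Nat.cast_nonneg k) h1)).2 ⟨h1, h2⟩⟩
  have hle : ENNReal.ofReal (c / T) ≤
      ∫⁻ τ in H₀ ∩ (fun τ => breakIndex τ T) ⁻¹' {k}, ENNReal.ofReal (p τ) := by
    calc ENNReal.ofReal (c / T)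
        = ∫⁻ _ in Set.Ioc ((k : ℝ) / T) ((k + 1) / T), ENNReal.ofReal c := by
          rw [setLIntegral_const, Real.volume_Ioc, ← ENNReal.ofReal_mul hc.le]
          congr 1
          field_simp
          ring
      _ ≤ ∫⁻ τ in Set.Ioc ((k : ℝ) / T) ((k + 1) / T), ENNReal.ofReal (p τ) :=
          setLIntegral_mono' measurableSet_Ioc fun τ hτ => ENNReal.ofReal_le_ofReal (hin τ hτ).1
      _ ≤ _ := lintegral_mono_set fun τ hτ => Set.mem_inter (hin τ hτ).2.1 (hin τ hτ).2.2
  rw [breakWeight, ← ENNReal.ofReal_le_iff_le_toReal (hp.lintegral_ne_top _)]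
  exact hle

end Prior

/-! ### The marginal posterior of the slopes as a finite mixture -/

section Posterior

variable {dx dz : ℕ} (R : Matrix (Fin dx) (Fin dz) ℝ) (x : ℕ → EuclideanSpace ℝ (Fin dx))
  (e : ℕ → ℝ) (γ₀ m : EuclideanSpace ℝ (Fin dx ⊕ Fin dz)) (T : ℕ) (τ₀ : ℝ)
  (H : Matrix (Fin dx ⊕ Fin dz) (Fin dx ⊕ Fin dz) ℝ) (a b : ℝ)

/-- The integral over `S` of the marginal posterior kernel of the model with break index `k`. -/
abbrev modelMass (k : ℕ) (S : Set (EuclideanSpace ℝ (Fin dx ⊕ Fin dz))) : ℝ :=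
  energyMass (earlyRow dx dz) (lateRow R) x e (breakIndex τ₀ T) γ₀
    (Matrix.toEuclideanCLM (𝕜 := ℝ) H) m b T (posteriorExponent dx dz a T) k S

variable {H₀ : Set ℝ} {p : ℝ → ℝ} (hp : BreakPrior H₀ p τ₀)
include hp

/-- The variance is integrated out first and `τ` is reduced to its cells; the remaining factor does
not depend on `k` or `S` and cancels on normalization. -/
theorem posteriorUnnorm_apply (hH₀ : MeasurableSet H₀) (hsub : H₀ ⊆ Set.Ioo 0 1)
    (hα : 0 < posteriorExponent dx dz a T)
    (hpos : ∀ k ∈ admissibleBreaks H₀ T, ∀ γ, 0 < modelEnergy R x e γ₀ m T τ₀ H b k γ)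
    (hint : ∀ k ∈ admissibleBreaks H₀ T, Integrable fun γ =>
      modelEnergy R x e γ₀ m T τ₀ H b k γ ^ (-posteriorExponent dx dz a T))
    {S : Set (EuclideanSpace ℝ (Fin dx ⊕ Fin dz))} (hS : MeasurableSet S) :
    posteriorUnnorm R x T (response R x e γ₀ τ₀ T) m H a b H₀ p S =
      ENNReal.ofReal ((2 * Real.pi) ^ (-(T : ℝ) / 2) * Real.Gamma (posteriorExponent dx dz a T)) *
      ENNReal.ofReal (∑ k ∈ admissibleBreaks H₀ T,
        breakWeight H₀ p T k * modelMass R x e γ₀ m T τ₀ H a b k S) := by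
  set Cst := ENNReal.ofReal
    ((2 * Real.pi) ^ (-(T : ℝ) / 2) * Real.Gamma (posteriorExponent dx dz a T)) with hCst
  have hdens : ∀ γ, (∫⁻ τ in H₀, ∫⁻ s in Set.Ioi 0,
      ENNReal.ofReal (likelihood R x T (response R x e γ₀ τ₀ T) τ s γ *
        (priorKernel m H a b s γ * p τ))) =
      ∑ k ∈ admissibleBreaks H₀ T, Cst * ENNReal.ofReal (modelEnergy R x e γ₀ m T τ₀ H b k γ ^
        (-posteriorExponent dx dz a T)) * ENNReal.ofReal (breakWeight H₀ p T k) := by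
    intro γ
    rw [← hp.lintegral_breakIndex hH₀ hsub T fun k => Cst *
      ENNReal.ofReal (modelEnergy R x e γ₀ m T τ₀ H b k γ ^ (-posteriorExponent dx dz a T))]
    refine setLIntegral_congr_fun hH₀ fun τ hτ => ?_
    exact lintegral_scale R x e γ₀ m γ T τ₀ τ H a b hα
      (hpos _ ((mem_admissibleBreaks hsub).2 ⟨τ, hτ, rfl⟩) γ) (hp.nonneg τ)
  have hnn : ∀ k ∈ admissibleBreaks H₀ T, ∀ γ,
      0 ≤ modelEnergy R x e γ₀ m T τ₀ H b k γ ^ (-posteriorExponent dx dz a T) :=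
    fun k hk γ => Real.rpow_nonneg (hpos k hk γ).le _
  have hm : ∀ k, Measurable fun γ =>
      ENNReal.ofReal (modelEnergy R x e γ₀ m T τ₀ H b k γ ^ (-posteriorExponent dx dz a T)) :=
    fun k => ((measurable_energy _ _ _ _ _ _ _ _ _ _ _).pow_const _).ennreal_ofReal
  rw [posteriorUnnorm, withDensity_apply _ hS]
  simp_rw [hdens]
  rw [lintegral_finsetSum _ fun k _ => ((hm k).const_mul _).mul_const _,
    ENNReal.ofReal_sum_of_nonneg, Finset.mul_sum]
  · refine Finset.sum_congr rfl fun k hk => ?_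
    rw [lintegral_mul_const _ ((hm k).const_mul _), lintegral_const_mul _ (hm k),
      ← ofReal_integral_eq_lintegral_ofReal (hint k hk).integrableOn
        (Eventually.of_forall (hnn k hk)), mul_assoc, mul_comm (ENNReal.ofReal (∫ _ in S, _)),
      ENNReal.ofReal_mul (breakWeight_nonneg ..)]
    rfl
  · exact fun k hk => mul_nonneg ENNReal.toReal_nonneg (integral_nonneg (hnn k hk))

theorem rescale_posterior_real (hH₀ : MeasurableSet H₀) (hsub : H₀ ⊆ Set.Ioo 0 1)
    (hα : 0 < posteriorExponent dx dz a T)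
    (hpos : ∀ k ∈ admissibleBreaks H₀ T, ∀ γ, 0 < modelEnergy R x e γ₀ m T τ₀ H b k γ)
    (hint : ∀ k ∈ admissibleBreaks H₀ T, Integrable fun γ =>
      modelEnergy R x e γ₀ m T τ₀ H b k γ ^ (-posteriorExponent dx dz a T))
    (ctr : EuclideanSpace ℝ (Fin dx ⊕ Fin dz))
    {S : Set (EuclideanSpace ℝ (Fin dx ⊕ Fin dz))} (hS : MeasurableSet S) :
    (rescale T ctr (posterior R x T (response R x e γ₀ τ₀ T) m H a b H₀ p)).real S =
      (∑ k ∈ admissibleBreaks H₀ T, breakWeight H₀ p T k *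
        modelMass R x e γ₀ m T τ₀ H a b k ((fun γ => Real.sqrt T • (γ - ctr)) ⁻¹' S)) /
      ∑ k ∈ admissibleBreaks H₀ T, breakWeight H₀ p T k *
        modelMass R x e γ₀ m T τ₀ H a b k Set.univ := by
  have hmap : Measurable fun γ : EuclideanSpace ℝ (Fin dx ⊕ Fin dz) =>
      Real.sqrt T • (γ - ctr) := by fun_prop
  have hC : 0 < (2 * Real.pi) ^ (-(T : ℝ) / 2) * Real.Gamma (posteriorExponent dx dz a T) := by
    have := Real.Gamma_pos_of_pos hα
    positivity
  have hsum : ∀ A, 0 ≤ ∑ k ∈ admissibleBreaks H₀ T, breakWeight H₀ p T k *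
      modelMass R x e γ₀ m T τ₀ H a b k A := fun A =>
    Finset.sum_nonneg fun k hk => mul_nonneg ENNReal.toReal_nonneg
      (integral_nonneg fun γ => Real.rpow_nonneg (hpos k hk γ).le _)
  rw [measureReal_def, rescale, Measure.map_apply hmap hS, posterior, Measure.smul_apply,
    smul_eq_mul, posteriorUnnorm_apply R x e γ₀ m T τ₀ H a b hp hH₀ hsub hα hpos hint (hmap hS),
    posteriorUnnorm_apply R x e γ₀ m T τ₀ H a b hp hH₀ hsub hα hpos hint MeasurableSet.univ,
    ENNReal.toReal_mul, ENNReal.toReal_inv, ENNReal.toReal_mul, ENNReal.toReal_mul,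
    ENNReal.toReal_ofReal hC.le, ENNReal.toReal_ofReal (hsum _), ENNReal.toReal_ofReal (hsum _)]
  rw [mul_inv, mul_mul_mul_comm, inv_mul_cancel₀ hC.ne', one_mul, inv_mul_eq_div]

end Posterior

end StructuralBreak
end

noncomputable section
namespace StructuralBreak
open scoped RealInnerProductSpace
open Finset (range Ico)

/-! ### Convergence in probability as convergence along a filter -/

section InProbability

variable {Ω : Type*} [MeasurableSpace Ω] (P : Measure Ω)

/-- The filter of events, depending on the sample size `T`, whose probability tends to one. -/
def inProb : Filter (ℕ × Ω) where
  sets := {S | Tendsto (fun T => P {ω | (T, ω) ∉ S}) atTop (𝓝 0)}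
  univ_sets := by simp
  sets_of_superset := fun {S S'} hS hSS' =>
    tendsto_of_tendsto_of_tendsto_of_le_of_le tendsto_const_nhds hS (fun _ => zero_le)
      fun _ => measure_mono fun _ h h' => h (hSS' h')
  inter_sets := fun {S S'} hS hS' => by
    have h : Tendsto (fun T => P {ω | (T, ω) ∉ S} + P {ω | (T, ω) ∉ S'}) atTop (𝓝 0) := by
      simpa using Tendsto.add hS hS'
    refine tendsto_of_tendsto_of_tendsto_of_le_of_le tendsto_const_nhds h (fun _ => zero_le)
      fun T => (measure_mono fun ω hω => ?_).trans (measure_union_le _ _)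
    by_contra hc
    simp only [Set.mem_union, Set.mem_ofPred_eq, not_or, not_not] at hc
    exact hω hc

theorem eventually_inProb {Q : ℕ × Ω → Prop} :
    (∀ᶠ i in inProb P, Q i) ↔ Tendsto (fun T => P {ω | ¬ Q (T, ω)}) atTop (𝓝 0) := Iff.rfl

instance inProb_neBot [IsProbabilityMeasure P] : (inProb P).NeBot := by
  refine ⟨fun h => ?_⟩
  have h1 : ∀ᶠ _ in inProb P, False := by rw [h]; exact eventually_bot
  rw [eventually_inProb] at h1
  simp at h1

theorem tendsto_fst_inProb : Tendsto Prod.fst (inProb P) atTop := by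
  intro S hS
  change Tendsto (fun T => P {ω | ¬ T ∈ S}) atTop (𝓝 0)
  refine tendsto_const_nhds.congr' ?_
  filter_upwards [hS] with T hT
  simp [hT]

variable {P}

theorem tendsto_inProb_iff {E : Type*} [PseudoMetricSpace E] {f : ℕ → Ω → E} {c : E} :
    TendstoInMeasure P f atTop (fun _ => c) ↔
      Tendsto (fun i : ℕ × Ω => f i.1 i.2) (inProb P) (𝓝 c) := by
  rw [tendstoInMeasure_iff_dist, Metric.tendsto_nhds]
  refine forall₂_congr fun ε _ => ?_
  rw [eventually_inProb]
  simp only [not_lt]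

theorem tendstoInMeasure_of_inProb {E : Type*} [PseudoMetricSpace E] {f : ℕ → Ω → E} {c : E}
    (h : Tendsto (fun i : ℕ × Ω => f i.1 i.2) (inProb P) (𝓝 c)) :
    TendstoInMeasure P f atTop fun _ => c :=
  tendsto_inProb_iff.2 h

theorem eventually_inProb_of_forall_le {Q : ℕ × Ω → Prop} {u : ℕ → ℝ}
    (h : ∀ᶠ T in atTop, P {ω | ¬ Q (T, ω)} ≤ ENNReal.ofReal (u T)) (hu : Tendsto u atTop (𝓝 0)) :
    ∀ᶠ i in inProb P, Q i := by
  rw [eventually_inProb]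
  have h1 := ENNReal.tendsto_ofReal hu
  rw [ENNReal.ofReal_zero] at h1
  exact tendsto_of_tendsto_of_tendsto_of_le_of_le' tendsto_const_nhds h1
    (Eventually.of_forall fun _ => zero_le) h

/-- A bound that outgrows every multiple of the rate removes the dependence of `M` on the
probability level. -/
theorem IsBigOInProb.eventually_le {Z : ℕ → Ω → ℝ} {r s : ℕ → ℝ} (h : IsBigOInProb P Z r)
    (hrs : ∀ M : ℝ, ∀ᶠ T in atTop, M * r T ≤ s T) : ∀ᶠ i in inProb P, |Z i.1 i.2| ≤ s i.1 := by
  rw [eventually_inProb, ENNReal.tendsto_nhds_zero]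
  intro η hη
  rcases eq_or_ne η ⊤ with rfl | hη'
  · simp
  obtain ⟨M, hM⟩ := h η.toReal (ENNReal.toReal_pos hη.ne' hη')
  filter_upwards [hM, hrs M] with T h1 h2
  rw [ENNReal.ofReal_toReal hη'] at h1
  refine (measure_mono fun ω hω => ?_).trans h1
  exact h2.trans_lt (not_le.1 hω)

end InProbability

/-! ### A maximal inequality for the scores -/

section MaximalInequality

variable {Ω F : Type*} {m0 : MeasurableSpace Ω} {P : Measure Ω} [IsProbabilityMeasure P]
  [NormedAddCommGroup F] [InnerProductSpace ℝ F] {𝒢 : Filtration ℕ m0}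
  {x : ℕ → Ω → F} {ε : ℕ → Ω → ℝ} {B v : ℝ}

theorem stronglyMeasurable_score (hx : ∀ t, StronglyMeasurable[𝒢 t] (x t))
    (hε : ∀ t, StronglyMeasurable[𝒢 (t + 1)] (ε t)) (k : ℕ) :
    StronglyMeasurable[𝒢 k] fun ω => score (fun t => x t ω) (fun t => ε t ω) (range k) := by
  unfold score
  refine Finset.stronglyMeasurable_fun_sum _ fun t ht => ?_
  have htk : t + 1 ≤ k := Finset.mem_range.1 ht
  exact ((hε t).mono (𝒢.mono htk)).smul ((hx t).mono (𝒢.mono (by omega)))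

omit [IsProbabilityMeasure P] in
theorem memLp_score (hx : ∀ t, StronglyMeasurable[𝒢 t] (x t)) (hB : ∀ t ω, ‖x t ω‖ ≤ B)
    (hε2 : ∀ t, MemLp (ε t) 2 P) (k : ℕ) :
    MemLp (fun ω => score (fun t => x t ω) (fun t => ε t ω) (range k)) 2 P := by
  unfold score
  refine memLp_finsetSum _ fun t _ => ?_
  have h1 : MemLp (x t) ⊤ P := memLp_top_of_bound
    ((hx t).mono (𝒢.le t)).aestronglyMeasurable B (Eventually.of_forall (hB t))
  exact h1.smul (hε2 t)

theorem norm_score_succ_sq (x : ℕ → F) (e : ℕ → ℝ) (k : ℕ) :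
    ‖score x e (range (k + 1))‖ ^ 2 = ‖score x e (range k)‖ ^ 2 +
      (2 * (⟪score x e (range k), x k⟫ * e k) + e k ^ 2 * ‖x k‖ ^ 2) := by
  rw [score, Finset.sum_range_succ, norm_add_sq_real, inner_smul_right, norm_smul, mul_pow,
    Real.norm_eq_abs, sq_abs, score]
  ring

omit [IsProbabilityMeasure P] in
theorem integrable_inner_score (hx : ∀ t, StronglyMeasurable[𝒢 t] (x t))
    (hε : ∀ t, StronglyMeasurable[𝒢 (t + 1)] (ε t)) (hB : ∀ t ω, ‖x t ω‖ ≤ B)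
    (hε2 : ∀ t, MemLp (ε t) 2 P) (k : ℕ) :
    Integrable (fun ω => ⟪score (fun t => x t ω) (fun t => ε t ω) (range k), x k ω⟫ * ε k ω) P := by
  have h1 := memLp_score hx hB hε2 k
  have hm : StronglyMeasurable[𝒢 k] fun ω =>
      ⟪score (fun t => x t ω) (fun t => ε t ω) (range k), x k ω⟫ :=
    (stronglyMeasurable_score hx hε k).inner (hx k)
  have h2 : MemLp (fun ω => ⟪score (fun t => x t ω) (fun t => ε t ω) (range k), x k ω⟫) 2 P := by
    refine h1.of_le_mul (c := B) (hm.mono (𝒢.le k)).aestronglyMeasurable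
      (Eventually.of_forall fun ω => ?_)
    rw [mul_comm]
    exact (norm_inner_le_norm _ _).trans (mul_le_mul_of_nonneg_left (hB k ω) (norm_nonneg _))
  exact h2.integrable_mul (hε2 k)

omit [InnerProductSpace ℝ F] in
theorem integrable_sq_mul_norm_sq (hx : ∀ t, StronglyMeasurable[𝒢 t] (x t))
    (hB : ∀ t ω, ‖x t ω‖ ≤ B) (hε2 : ∀ t, MemLp (ε t) 2 P) (k : ℕ) :
    Integrable (fun ω => ε k ω ^ 2 * ‖x k ω‖ ^ 2) P := by
  have hB0 : 0 ≤ B := by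
    obtain ⟨ω⟩ := P.nonempty_of_neZero
    exact (norm_nonneg _).trans (hB 0 ω)
  refine (hε2 k).integrable_sq.mul_bdd (c := B ^ 2) ?_ (Eventually.of_forall fun ω => ?_)
  · exact (((hx k).mono (𝒢.le k)).norm.pow 2).aestronglyMeasurable
  · rw [norm_pow, norm_norm]
    exact pow_le_pow_left₀ (norm_nonneg _) (hB k ω) 2

theorem condExp_inner_score (hx : ∀ t, StronglyMeasurable[𝒢 t] (x t))
    (hε : ∀ t, StronglyMeasurable[𝒢 (t + 1)] (ε t)) (hB : ∀ t ω, ‖x t ω‖ ≤ B)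
    (hε2 : ∀ t, MemLp (ε t) 2 P) (hmean : ∀ t, P[ε t | 𝒢 t] =ᵐ[P] fun _ => 0) (k : ℕ) :
    P[fun ω => ⟪score (fun t => x t ω) (fun t => ε t ω) (range k), x k ω⟫ * ε k ω | 𝒢 k]
      =ᵐ[P] fun _ => 0 := by
  have hm : StronglyMeasurable[𝒢 k] fun ω =>
      ⟪score (fun t => x t ω) (fun t => ε t ω) (range k), x k ω⟫ :=
    (stronglyMeasurable_score hx hε k).inner (hx k)
  have h1 := condExp_mul_of_stronglyMeasurable_left hm (integrable_inner_score hx hε hB hε2 k)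
    ((hε2 k).integrable (by norm_num))
  filter_upwards [h1, hmean k] with ω h1 h2
  refine h1.trans ?_
  rw [Pi.mul_apply, h2, mul_zero]

/-- The increment is a martingale difference, because the covariate is known before its error, plus
a nonnegative square. -/
theorem submartingale_norm_score_sq (hx : ∀ t, StronglyMeasurable[𝒢 t] (x t))
    (hε : ∀ t, StronglyMeasurable[𝒢 (t + 1)] (ε t)) (hB : ∀ t ω, ‖x t ω‖ ≤ B)
    (hε2 : ∀ t, MemLp (ε t) 2 P) (hmean : ∀ t, P[ε t | 𝒢 t] =ᵐ[P] fun _ => 0) :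
    Submartingale (fun k ω => ‖score (fun t => x t ω) (fun t => ε t ω) (range k)‖ ^ 2) 𝒢 P := by
  refine submartingale_of_condExp_sub_nonneg_nat
    (fun k => (stronglyMeasurable_score hx hε k).norm.pow 2)
    (fun k => (memLp_score hx hB hε2 k).integrable_norm_pow (by norm_num)) fun k => ?_
  have h1 : (fun ω => ‖score (fun t => x t ω) (fun t => ε t ω) (range (k + 1))‖ ^ 2) -
      (fun ω => ‖score (fun t => x t ω) (fun t => ε t ω) (range k)‖ ^ 2) =
      (2 : ℝ) • (fun ω => ⟪score (fun t => x t ω) (fun t => ε t ω) (range k), x k ω⟫ * ε k ω) +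
        fun ω => ε k ω ^ 2 * ‖x k ω‖ ^ 2 := by
    ext ω
    simp only [Pi.sub_apply, Pi.add_apply, Pi.smul_apply, smul_eq_mul]
    rw [norm_score_succ_sq]
    ring
  rw [h1]
  have hi := integrable_inner_score hx hε hB hε2 k
  have h2 := condExp_add (hi.smul (2 : ℝ)) (integrable_sq_mul_norm_sq hx hB hε2 k) (𝒢 k)
  have h3 := condExp_smul (μ := P) (2 : ℝ)
    (fun ω => ⟪score (fun t => x t ω) (fun t => ε t ω) (range k), x k ω⟫ * ε k ω) (𝒢 k)
  have h4 := condExp_inner_score hx hε hB hε2 hmean k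
  have h5 : 0 ≤ᵐ[P] P[fun ω => ε k ω ^ 2 * ‖x k ω‖ ^ 2 | 𝒢 k] :=
    condExp_nonneg (Eventually.of_forall fun ω => by simp only [Pi.zero_apply]; positivity)
  filter_upwards [h2, h3, h4, h5] with ω h2 h3 h4 h5
  rw [h2, Pi.add_apply, h3, Pi.smul_apply, h4, smul_zero, zero_add]
  exact h5

theorem integral_norm_score_sq_le (hx : ∀ t, StronglyMeasurable[𝒢 t] (x t))
    (hε : ∀ t, StronglyMeasurable[𝒢 (t + 1)] (ε t)) (hB : ∀ t ω, ‖x t ω‖ ≤ B)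
    (hε2 : ∀ t, MemLp (ε t) 2 P) (hmean : ∀ t, P[ε t | 𝒢 t] =ᵐ[P] fun _ => 0)
    (hvar : ∀ t, ∫ ω, ε t ω ^ 2 ∂P = v) (k : ℕ) :
    ∫ ω, ‖score (fun t => x t ω) (fun t => ε t ω) (range k)‖ ^ 2 ∂P ≤ k * (v * B ^ 2) := by
  induction k with
  | zero => simp [score]
  | succ k ih =>
    simp_rw [norm_score_succ_sq]
    have hi := integrable_inner_score hx hε hB hε2 k
    have hs := integrable_sq_mul_norm_sq hx hB hε2 k
    have hsum : Integrable (fun ω =>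
        2 * (⟪score (fun t => x t ω) (fun t => ε t ω) (range k), x k ω⟫ * ε k ω) +
          ε k ω ^ 2 * ‖x k ω‖ ^ 2) P := (hi.const_mul 2).add hs
    rw [integral_add ((memLp_score hx hB hε2 k).integrable_norm_pow (by norm_num)) hsum, integral_add (hi.const_mul 2) hs, integral_const_mul]
    have h0 : ∫ ω, ⟪score (fun t => x t ω) (fun t => ε t ω) (range k), x k ω⟫ * ε k ω ∂P = 0 := by
      rw [← integral_condExp (𝒢.le k), integral_congr_ae (condExp_inner_score hx hε hB hε2 hmean k)]
      simp
    have h1 : ∫ ω, ε k ω ^ 2 * ‖x k ω‖ ^ 2 ∂P ≤ v * B ^ 2 := by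
      rw [← hvar k, ← integral_mul_const]
      refine integral_mono hs ((hε2 k).integrable_sq.mul_const _) fun ω => ?_
      have := hB k ω
      dsimp only
      gcongr
    rw [h0]
    push_cast
    linarith

/-- Kolmogorov's maximal inequality for the partial sums of `ε_t x_t`. -/
theorem measure_exists_score_ge_le (hx : ∀ t, StronglyMeasurable[𝒢 t] (x t))
    (hε : ∀ t, StronglyMeasurable[𝒢 (t + 1)] (ε t)) (hB : ∀ t ω, ‖x t ω‖ ≤ B)
    (hε2 : ∀ t, MemLp (ε t) 2 P) (hmean : ∀ t, P[ε t | 𝒢 t] =ᵐ[P] fun _ => 0)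
    (hvar : ∀ t, ∫ ω, ε t ω ^ 2 ∂P = v) (n : ℕ) {r : ℝ} (hr : 0 < r) :
    P {ω | ∃ k ≤ n, r ≤ ‖score (fun t => x t ω) (fun t => ε t ω) (range k)‖} ≤
      ENNReal.ofReal (n * (v * B ^ 2) / r ^ 2) := by
  have hr2 : (0 : ℝ) < r ^ 2 := by positivity
  have h1 := maximal_ineq (submartingale_norm_score_sq hx hε hB hε2 hmean)
    (fun k ω => by simp only [Pi.zero_apply]; positivity) (ε := ⟨r ^ 2, hr2.le⟩) n
  set A := {ω | ((⟨r ^ 2, hr2.le⟩ : NNReal) : ℝ) ≤ (range (n + 1)).sup'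
    Finset.nonempty_range_add_one fun k =>
      ‖score (fun t => x t ω) (fun t => ε t ω) (range k)‖ ^ 2} with hA
  have hsub : {ω | ∃ k ≤ n, r ≤ ‖score (fun t => x t ω) (fun t => ε t ω) (range k)‖} ⊆ A := by
    rintro ω ⟨k, hk, hle⟩
    rw [hA, Set.mem_ofPred_eq, Finset.le_sup'_iff]
    exact ⟨k, Finset.mem_range.2 (by omega), pow_le_pow_left₀ hr.le hle 2⟩
  have h2 : ∫ ω in A, ‖score (fun t => x t ω) (fun t => ε t ω) (range n)‖ ^ 2 ∂P ≤
      n * (v * B ^ 2) :=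
    (setIntegral_le_integral ((memLp_score hx hB hε2 n).integrable_norm_pow (by norm_num))
      (Eventually.of_forall fun ω => by simp only [Pi.zero_apply]; positivity)).trans
      (integral_norm_score_sq_le hx hε hB hε2 hmean hvar n)
  have h3 : ENNReal.ofReal (r ^ 2) * P A ≤ ENNReal.ofReal (n * (v * B ^ 2)) := by
    refine le_trans (le_of_eq ?_) (h1.trans (ENNReal.ofReal_le_ofReal h2))
    congr 1
    exact ENNReal.ofReal_eq_coe_nnreal hr2.le
  refine (measure_mono hsub).trans ?_
  rw [ENNReal.ofReal_div_of_pos hr2, ENNReal.le_div_iff_mul_le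
    (Or.inl (ENNReal.ofReal_pos.2 hr2).ne') (Or.inl ENNReal.ofReal_ne_top), mul_comm]
  exact h3

theorem score_Ico_add (x : ℕ → F) (e : ℕ → ℝ) (m k : ℕ) :
    score x e (Ico m (m + k)) =
      score (fun t => x (m + t)) (fun t => e (m + t)) (range k) := by
  rw [score, Finset.sum_Ico_eq_sum_range, Nat.add_sub_cancel_left]
  rfl

theorem measure_exists_score_Ico_ge_le (hx : ∀ t, StronglyMeasurable[𝒢 t] (x t))
    (hε : ∀ t, StronglyMeasurable[𝒢 (t + 1)] (ε t)) (hB : ∀ t ω, ‖x t ω‖ ≤ B)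
    (hε2 : ∀ t, MemLp (ε t) 2 P) (hmean : ∀ t, P[ε t | 𝒢 t] =ᵐ[P] fun _ => 0)
    (hvar : ∀ t, ∫ ω, ε t ω ^ 2 ∂P = v) (m n : ℕ) {r : ℝ} (hr : 0 < r) :
    P {ω | ∃ k ≤ n, r ≤ ‖score (fun t => x t ω) (fun t => ε t ω) (Ico m (m + k))‖} ≤
      ENNReal.ofReal (n * (v * B ^ 2) / r ^ 2) := by
  simp_rw [score_Ico_add]
  -- Sums that start at `m` are scores for the filtration shifted by `m`.
  let 𝒢' : Filtration ℕ m0 :=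
    ⟨fun k => 𝒢 (m + k), fun i j hij => 𝒢.mono (by omega), fun k => 𝒢.le _⟩
  exact measure_exists_score_ge_le (𝒢 := 𝒢') (x := fun t => x (m + t)) (ε := fun t => ε (m + t))
    (fun t => hx _) (fun t => hε _) (fun t ω => hB _ _) (fun t => hε2 _) (fun t => hmean _)
    (fun t => hvar _) n hr

end MaximalInequality

end StructuralBreak
end

/-! ### Limits of Gram operators, scores and error sums -/

noncomputable section
namespace StructuralBreak
open scoped RealInnerProductSpace
open Finset (range Ico)

/-- The continuous linear map given by a square matrix. -/
def matrixOp {ι : Type*} [Fintype ι] [DecidableEq ι] (M : Matrix ι ι ℝ) :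
    EuclideanSpace ℝ ι →L[ℝ] EuclideanSpace ℝ ι :=
  Matrix.toEuclideanCLM (𝕜 := ℝ) M

theorem matrixOp_smul {ι : Type*} [Fintype ι] [DecidableEq ι] (c : ℝ) (M : Matrix ι ι ℝ) :
    matrixOp (c • M) = c • matrixOp M :=
  map_smul _ _ _

theorem ofLp_matrixOp {ι : Type*} [Fintype ι] [DecidableEq ι] (M : Matrix ι ι ℝ)
    (u : EuclideanSpace ℝ ι) : (matrixOp M u).ofLp = M.mulVec u.ofLp :=
  Matrix.ofLp_toEuclideanCLM _ _

theorem gramOp_eq_matrixOp {d : ℕ} (x : ℕ → EuclideanSpace ℝ (Fin d)) (I : Finset ℕ) :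
    gramOp x I = matrixOp (Matrix.of fun i j => ∑ t ∈ I, x t i * x t j) := by
  ext u i
  rw [gramOp_apply, ofLp_matrixOp]
  simp only [WithLp.ofLp_sum, WithLp.ofLp_smul, Finset.sum_apply, Pi.smul_apply, smul_eq_mul,
    Matrix.mulVec, dotProduct, Matrix.of_apply, PiLp.inner_apply, Finset.sum_mul]
  rw [Finset.sum_comm]
  refine Finset.sum_congr rfl fun t _ => Finset.sum_congr rfl fun j _ => ?_
  simp
  ring

theorem continuous_matrixOp {ι : Type*} [Fintype ι] [DecidableEq ι] :
    Continuous fun M : Matrix ι ι ℝ => matrixOp M :=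
  LinearMap.continuous_of_finiteDimensional
    ((Matrix.toEuclideanCLM (n := ι) (𝕜 := ℝ)).toAlgEquiv.toLinearMap)

theorem tendsto_breakIndex_div {τ : ℝ} (hτ : 0 < τ) :
    Tendsto (fun T : ℕ => (breakIndex τ T : ℝ) / T) atTop (𝓝 τ) := by
  have h1 : Tendsto (fun T : ℕ => τ - (T : ℝ)⁻¹) atTop (𝓝 τ) := by
    simpa using (tendsto_const_nhds (x := τ)).sub (tendsto_inv_atTop_nhds_zero_nat (𝕜 := ℝ))
  refine tendsto_of_tendsto_of_tendsto_of_le_of_le' h1 tendsto_const_nhds ?_ ?_ <;>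
    filter_upwards [eventually_gt_atTop 0] with T hT
  all_goals
    have hT' : (0 : ℝ) < T := by exact_mod_cast hT
  · rw [le_div_iff₀ hT', sub_mul, inv_mul_cancel₀ hT'.ne']
    linarith [le_breakIndex_add_one (mul_pos hτ hT')]
  · rw [div_le_iff₀ hT']
    exact (breakIndex_lt (mul_pos hτ hT')).le

theorem tendsto_of_div_tendsto {κ : ℕ → ℕ} {ρ : ℝ} (hρ : 0 < ρ)
    (hκ : Tendsto (fun T : ℕ => (κ T : ℝ) / T) atTop (𝓝 ρ)) : Tendsto κ atTop atTop := by
  rw [← tendsto_natCast_atTop_iff (R := ℝ)]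
  refine (hκ.pos_mul_atTop hρ tendsto_natCast_atTop_atTop).congr' ?_
  filter_upwards [eventually_gt_atTop 0] with T hT
  have hT' : (T : ℝ) ≠ 0 := by exact_mod_cast hT.ne'
  exact div_mul_cancel₀ _ hT'

theorem tendsto_inProb_comp {Ω E : Type*} [MeasurableSpace Ω] {P : Measure Ω}
    [PseudoMetricSpace E] {f : ℕ → Ω → E} {c : E} {κ : ℕ → ℕ}
    (h : TendstoInMeasure P f atTop fun _ => c) (hκ : Tendsto κ atTop atTop) :
    Tendsto (fun i : ℕ × Ω => f (κ i.1) i.2) (inProb P) (𝓝 c) := by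
  rw [tendstoInMeasure_iff_dist] at h
  rw [Metric.tendsto_nhds]
  intro η hη
  rw [eventually_inProb]
  refine ((h η hη).comp hκ).congr fun T => ?_
  simp only [Function.comp_apply, not_lt]

section Operators

variable {ι F : Type*} [NormedAddCommGroup F] [InnerProductSpace ℝ F] {l : Filter ι}
  {x : ι → ℕ → F} {n κ κ' : ι → ℕ} {S : F →L[ℝ] F} {ρ ρ' : ℝ}

theorem tendsto_inv_smul_gramOp_of_div (hρ : Tendsto (fun i => (κ i : ℝ) / n i) l (𝓝 ρ))
    (hκ : ∀ᶠ i in l, 0 < κ i)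
    (h : Tendsto (fun i => (κ i : ℝ)⁻¹ • gramOp (x i) (range (κ i))) l (𝓝 S)) :
    Tendsto (fun i => (n i : ℝ)⁻¹ • gramOp (x i) (range (κ i))) l (𝓝 (ρ • S)) := by
  refine (hρ.smul h).congr' ?_
  filter_upwards [hκ] with i hi
  have hne : (κ i : ℝ) ≠ 0 := by exact_mod_cast (ne_of_gt hi)
  rw [smul_smul]
  congr 1
  field_simp

theorem tendsto_inv_smul_gramOp_Ico
    (h : Tendsto (fun i => (n i : ℝ)⁻¹ • gramOp (x i) (range (κ i))) l (𝓝 (ρ • S)))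
    (h' : Tendsto (fun i => (n i : ℝ)⁻¹ • gramOp (x i) (range (κ' i))) l (𝓝 (ρ' • S)))
    (hle : ∀ᶠ i in l, κ i ≤ κ' i) :
    Tendsto (fun i => (n i : ℝ)⁻¹ • gramOp (x i) (Ico (κ i) (κ' i))) l (𝓝 ((ρ' - ρ) • S)) := by
  rw [sub_smul]
  refine (h'.sub h).congr' ?_
  filter_upwards [hle] with i hi
  rw [← smul_sub]
  congr 1
  rw [sub_eq_iff_eq_add', gramOp, gramOp, gramOp, Finset.range_eq_Ico, Finset.range_eq_Ico]
  exact (Finset.sum_Ico_consecutive _ (Nat.zero_le _) hi).symm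

end Operators

namespace DGPAssumptions

variable {Ω : Type*} [m0 : MeasurableSpace Ω] {P : Measure Ω} {dx dz : ℕ}
  {x : ℕ → Ω → EuclideanSpace ℝ (Fin dx)} {ε : ℕ → Ω → ℝ} {δ₀ : EuclideanSpace ℝ (Fin dz)}
  {σ₀ : ℝ} {SigmaX : Matrix (Fin dx) (Fin dx) ℝ}
  (h : DGPAssumptions P x ε δ₀ σ₀ SigmaX)
include h

theorem exists_norm_le : ∃ B : ℝ, ∀ t ω, ‖x t ω‖ ≤ B := by
  obtain ⟨S, -, hS, hx⟩ := h.bounded_x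
  obtain ⟨B, hB⟩ := hS.exists_norm_le
  exact ⟨B, fun t ω => hB _ (hx t ω)⟩

theorem exists_filtration : ∃ 𝒢 : Filtration ℕ m0, ∀ t, 𝒢 t = covariatesAndPast x ε t := by
  refine ⟨⟨covariatesAndPast x ε, fun s t hst => ?_, fun t => ?_⟩, fun _ => rfl⟩
  · exact sup_le_sup le_rfl (iSup₂_mono' fun r hr => ⟨r, lt_of_lt_of_le hr hst, le_rfl⟩)
  · exact sup_le (iSup_le fun s => (h.measurable_x s).comap_le)
      (iSup₂_le fun s _ => (h.measurable_ε s).comap_le)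

omit m0 h in
theorem stronglyMeasurable_x (s t : ℕ) : StronglyMeasurable[covariatesAndPast x ε t] (x s) := by
  have h1 : MeasurableSpace.comap (x s) inferInstance ≤ covariatesAndPast x ε t :=
    (le_iSup (fun s => MeasurableSpace.comap (x s) inferInstance) s).trans le_sup_left
  exact ((comap_measurable (x s)).mono h1 le_rfl).stronglyMeasurable

omit m0 h in
theorem stronglyMeasurable_ε (t : ℕ) :
    StronglyMeasurable[covariatesAndPast x ε (t + 1)] (ε t) := by
  have h1 : MeasurableSpace.comap (ε t) inferInstance ≤ covariatesAndPast x ε (t + 1) :=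
    (le_iSup₂ (f := fun s (_ : s ∈ Set.Iio (t + 1)) => MeasurableSpace.comap (ε s) inferInstance)
      t (Nat.lt_succ_self t)).trans le_sup_right
  exact ((comap_measurable (ε t)).mono h1 le_rfl).stronglyMeasurable

variable [IsProbabilityMeasure P]

theorem integral_sq (t : ℕ) : ∫ ω, ε t ω ^ 2 ∂P = σ₀ ^ 2 := by
  obtain ⟨𝒢, h𝒢⟩ := h.exists_filtration
  rw [← integral_condExp (𝒢.le t), h𝒢, integral_congr_ae (h.condVar t)]
  simp

theorem exists_measure_score_le : ∃ C : ℝ, ∀ m n : ℕ, ∀ r : ℝ, 0 < r →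
    P {ω | ∃ k ≤ n, r ≤ ‖StructuralBreak.score (fun t => x t ω) (fun t => ε t ω) (Ico m (m + k))‖} ≤
      ENNReal.ofReal (C * n / r ^ 2) := by
  obtain ⟨B, hB⟩ := h.exists_norm_le
  obtain ⟨𝒢, h𝒢⟩ := h.exists_filtration
  refine ⟨σ₀ ^ 2 * B ^ 2, fun m n r hr => ?_⟩
  have := measure_exists_score_Ico_ge_le (𝒢 := 𝒢) (x := x) (ε := ε) (P := P)
    (fun t => by rw [h𝒢]; exact stronglyMeasurable_x t t)
    (fun t => by rw [h𝒢]; exact stronglyMeasurable_ε t) hB h.memLp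
    (fun t => by rw [h𝒢]; exact h.condMean t) h.integral_sq m n hr
  rwa [mul_comm (n : ℝ)] at this

/-- The maximal inequality bounds the exceptional probability by a multiple of `T / T^1.1`. -/
theorem eventually_score_range_le : ∀ᶠ i in inProb P, ∀ k ≤ i.1,
    ‖StructuralBreak.score (fun t => x t i.2) (fun t => ε t i.2) (range k)‖ ≤ (i.1 : ℝ) ^ (0.55 : ℝ) := by
  obtain ⟨C, hC⟩ := h.exists_measure_score_le
  have hlim : Tendsto (fun T : ℕ => C * (T : ℝ) ^ (-(0.1 : ℝ))) atTop (𝓝 0) := by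
    simpa using ((tendsto_rpow_neg_atTop (by norm_num : (0 : ℝ) < 0.1)).comp
      (tendsto_natCast_atTop_atTop (R := ℝ))).const_mul C
  refine eventually_inProb_of_forall_le ?_ hlim
  filter_upwards [eventually_gt_atTop 0] with T hT
  have hT' : (0 : ℝ) < T := by exact_mod_cast hT
  refine (measure_mono fun ω hω => ?_).trans
    ((hC 0 T ((T : ℝ) ^ (0.55 : ℝ)) (by positivity)).trans (le_of_eq ?_))
  · simp only [Set.mem_ofPred_eq, not_forall, not_le] at hω
    obtain ⟨k, hk, hlt⟩ := hω
    refine ⟨k, hk, ?_⟩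
    rw [zero_add, ← Finset.range_eq_Ico]
    exact hlt.le
  · congr 1
    rw [mul_div_assoc]
    congr 1
    rw [← Real.rpow_natCast, ← Real.rpow_mul hT'.le]
    conv_lhs => rw [← Real.rpow_one (T : ℝ), ← Real.rpow_mul hT'.le, ← Real.rpow_sub hT']
    norm_num

/-- Every window is a difference of two partial sums started at `kL`, so half the threshold is used
for these. The exceptional probability is of order `T^0.6 / T^0.65`. -/
theorem eventually_score_window_le {k₀ kL kR : ℕ → ℕ} {C₀ : ℝ}
    (horder : ∀ᶠ T in atTop, kL T ≤ k₀ T ∧ k₀ T ≤ kR T)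
    (hwidth : ∀ᶠ T : ℕ in atTop, (kR T : ℝ) - kL T ≤ C₀ * (T : ℝ) ^ (0.6 : ℝ)) :
    ∀ᶠ i in inProb P, ∀ k, kL i.1 ≤ k → k ≤ kR i.1 →
      ‖StructuralBreak.score (fun t => x t i.2) (fun t => ε t i.2) (window (k₀ i.1) k)‖ ≤
        (i.1 : ℝ) ^ (0.325 : ℝ) := by
  obtain ⟨C, hC⟩ := h.exists_measure_score_le
  have hlim : Tendsto (fun T : ℕ => 4 * (|C| * C₀) * (T : ℝ) ^ (-(0.05 : ℝ))) atTop (𝓝 0) := by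
    simpa using ((tendsto_rpow_neg_atTop (by norm_num : (0 : ℝ) < 0.05)).comp
      (tendsto_natCast_atTop_atTop (R := ℝ))).const_mul (4 * (|C| * C₀))
  refine eventually_inProb_of_forall_le ?_ hlim
  filter_upwards [eventually_gt_atTop 0, horder, hwidth] with T hT horder hwidth
  have hT' : (0 : ℝ) < T := by exact_mod_cast hT
  refine (measure_mono fun ω hω => ?_).trans
    ((hC (kL T) (kR T - kL T) ((T : ℝ) ^ (0.325 : ℝ) / 2) (by positivity)).trans
      (ENNReal.ofReal_le_ofReal ?_))
  · by_contra hc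
    simp only [Set.mem_ofPred_eq, not_exists, not_and, not_le] at hc
    refine hω fun k hk1 hk2 => ?_
    have hle : ∀ j, kL T ≤ j → j ≤ kR T →
        ‖StructuralBreak.score (fun t => x t ω) (fun t => ε t ω) (Ico (kL T) j)‖ ≤ (T : ℝ) ^ (0.325 : ℝ) / 2 := by
      intro j hj1 hj2
      have := hc (j - kL T) (by omega)
      rw [Nat.add_sub_cancel' hj1] at this
      exact this.le
    have hdiff : StructuralBreak.score (fun t => x t ω) (fun t => ε t ω) (window (k₀ T) k) =
        StructuralBreak.score (fun t => x t ω) (fun t => ε t ω) (Ico (kL T) (max k (k₀ T))) -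
          StructuralBreak.score (fun t => x t ω) (fun t => ε t ω) (Ico (kL T) (min k (k₀ T))) := by
      rw [eq_sub_iff_add_eq', window]
      exact Finset.sum_Ico_consecutive _ (le_min hk1 horder.1) (min_le_max)
    rw [hdiff]
    refine (norm_sub_le _ _).trans ?_
    have h1 := hle (max k (k₀ T)) (hk1.trans (le_max_left _ _)) (max_le hk2 horder.2)
    have h2 := hle (min k (k₀ T)) (le_min hk1 horder.1) ((min_le_left _ _).trans hk2)
    change _ ≤ (T : ℝ) ^ (0.325 : ℝ)
    linarith
  · have hcast : ((kR T - kL T : ℕ) : ℝ) ≤ C₀ * (T : ℝ) ^ (0.6 : ℝ) := by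
      rwa [Nat.cast_sub (horder.1.trans horder.2)]
    rw [div_pow, div_div_eq_mul_div, ← Real.rpow_natCast ((T : ℝ) ^ (0.325 : ℝ)),
      ← Real.rpow_mul hT'.le]
    calc C * ((kR T - kL T : ℕ) : ℝ) * 2 ^ 2 / (T : ℝ) ^ ((0.325 : ℝ) * (2 : ℕ))
        ≤ |C| * (C₀ * (T : ℝ) ^ (0.6 : ℝ)) * 2 ^ 2 / (T : ℝ) ^ ((0.325 : ℝ) * (2 : ℕ)) := by
          gcongr
          exact le_abs_self C
      _ = 4 * (|C| * C₀) * ((T : ℝ) ^ (0.6 : ℝ) / (T : ℝ) ^ ((0.325 : ℝ) * (2 : ℕ))) := by ring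
      _ = _ := by
          rw [← Real.rpow_sub hT']
          norm_num

theorem tendsto_sum_sq {κ : ℕ → ℕ} {ρ : ℝ} (hρ : 0 < ρ)
    (hκ : Tendsto (fun T : ℕ => (κ T : ℝ) / T) atTop (𝓝 ρ)) :
    Tendsto (fun i : ℕ × Ω => (∑ t ∈ range (κ i.1), ε t i.2 ^ 2) / i.1) (inProb P)
      (𝓝 (ρ * σ₀ ^ 2)) := by
  have hae := strong_law_ae_real (μ := P) (fun t ω => ε t ω ^ 2) (h.memLp 0).integrable_sq
    (fun i j hij => (h.indep.indepFun hij).comp (measurable_id.pow_const 2)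
      (measurable_id.pow_const 2))
    fun t => (h.identDistrib t).comp (measurable_id.pow_const 2)
  rw [h.integral_sq 0] at hae
  have hmeas : ∀ n : ℕ, AEStronglyMeasurable
      (fun ω => (∑ t ∈ range n, ε t ω ^ 2) / (n : ℝ)) P := fun n =>
    (((Finset.measurable_fun_sum _ fun t _ => (h.measurable_ε t).pow_const 2)).div_const
      _).aestronglyMeasurable
  have h1 := tendstoInMeasure_of_tendsto_ae hmeas hae
  have hκ' := tendsto_of_div_tendsto hρ hκ
  have h2 := tendsto_inProb_comp h1 hκ'
  refine ((hκ.comp (tendsto_fst_inProb P)).mul h2).congr' ?_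
  filter_upwards [(tendsto_fst_inProb P).eventually (hκ'.eventually_gt_atTop 0)] with i hi
  have : (κ i.1 : ℝ) ≠ 0 := by exact_mod_cast (ne_of_gt hi)
  simp only [Function.comp_apply]
  field_simp

omit [IsProbabilityMeasure P] in
theorem tendsto_gramOp_range {κ : ℕ → ℕ} {ρ : ℝ} (hρ : 0 < ρ)
    (hκ : Tendsto (fun T : ℕ => (κ T : ℝ) / T) atTop (𝓝 ρ)) :
    Tendsto (fun i : ℕ × Ω => (i.1 : ℝ)⁻¹ • gramOp (fun t => x t i.2) (range (κ i.1))) (inProb P)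
      (𝓝 (ρ • matrixOp SigmaX)) := by
  have hκ' := tendsto_of_div_tendsto hρ hκ
  have hmat : Tendsto (fun i : ℕ × Ω => Matrix.of fun k l =>
      (κ i.1 : ℝ)⁻¹ * ∑ t ∈ range (κ i.1), x t i.2 k * x t i.2 l) (inProb P) (𝓝 SigmaX) := by
    have h3 : ∀ k l, Tendsto (fun i : ℕ × Ω =>
        (κ i.1 : ℝ)⁻¹ * ∑ t ∈ range (κ i.1), x t i.2 k * x t i.2 l) (inProb P)
        (𝓝 (SigmaX k l)) := fun k l => by
      have h2 := tendsto_inProb_comp (h.plim k l) hκ'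
      exact h2
    exact tendsto_pi_nhds.2 fun k => tendsto_pi_nhds.2 fun l => h3 k l
  have h1 := ((continuous_matrixOp (ι := Fin dx)).tendsto SigmaX).comp hmat
  refine tendsto_inv_smul_gramOp_of_div (hκ.comp (tendsto_fst_inProb P))
    ((tendsto_fst_inProb P).eventually (hκ'.eventually_gt_atTop 0)) (h1.congr fun i => ?_)
  have hM : (Matrix.of fun k l =>
      (κ i.1 : ℝ)⁻¹ * ∑ t ∈ range (κ i.1), x t i.2 k * x t i.2 l) =
      (κ i.1 : ℝ)⁻¹ • Matrix.of fun k l => ∑ t ∈ range (κ i.1), x t i.2 k * x t i.2 l := rfl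
  rw [Function.comp_apply, hM, matrixOp_smul, gramOp_eq_matrixOp]

omit [IsProbabilityMeasure P] in
theorem tendsto_gramOp_Ico {κ κ' : ℕ → ℕ} {ρ ρ' : ℝ} (hρ : 0 < ρ) (hρ' : 0 < ρ')
    (hκ : Tendsto (fun T : ℕ => (κ T : ℝ) / T) atTop (𝓝 ρ))
    (hκ' : Tendsto (fun T : ℕ => (κ' T : ℝ) / T) atTop (𝓝 ρ'))
    (hle : ∀ᶠ T in atTop, κ T ≤ κ' T) :
    Tendsto (fun i : ℕ × Ω => (i.1 : ℝ)⁻¹ • gramOp (fun t => x t i.2) (Ico (κ i.1) (κ' i.1)))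
      (inProb P) (𝓝 ((ρ' - ρ) • matrixOp SigmaX)) := by
  exact tendsto_inv_smul_gramOp_Ico (h.tendsto_gramOp_range hρ hκ) (h.tendsto_gramOp_range hρ' hκ')
    ((tendsto_fst_inProb P).eventually hle)

end DGPAssumptions

end StructuralBreak
end

/-! ### Signal on short windows next to the break -/

noncomputable section
namespace StructuralBreak
open scoped RealInnerProductSpace
open Finset (range Ico)

theorem inner_matrixOp {ι : Type*} [Fintype ι] [DecidableEq ι] (M : Matrix ι ι ℝ)
    (u : EuclideanSpace ℝ ι) : ⟪matrixOp M u, u⟫ = ∑ i, ∑ j, M i j * (u j * u i) := by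
  rw [PiLp.inner_apply]
  refine Finset.sum_congr rfl fun i _ => ?_
  rw [ofLp_matrixOp, Matrix.mulVec, dotProduct]
  simp only [RCLike.inner_apply, conj_trivial, Finset.mul_sum]
  exact Finset.sum_congr rfl fun j _ => by ring

/-- The deviation of `∑_{t<n} ⟪x_t, D⟫²` from `n s`. -/
def gramExcess {F : Type*} [NormedAddCommGroup F] [InnerProductSpace ℝ F] (x : ℕ → F) (D : F)
    (s : ℝ) (n : ℕ) : ℝ :=
  gramForm x (range n) D - n * s

theorem gramExcess_sub {F : Type*} [NormedAddCommGroup F] [InnerProductSpace ℝ F] (x : ℕ → F)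
    (D : F) (s : ℝ) {k k' : ℕ} (h : k ≤ k') :
    gramExcess x D s k' - gramExcess x D s k = gramForm x (Ico k k') D - ((k' : ℝ) - k) * s := by
  have : gramForm x (range k') D = gramForm x (range k) D + gramForm x (Ico k k') D := by
    rw [gramForm, gramForm, gramForm, Finset.range_eq_Ico, Finset.range_eq_Ico]
    exact (Finset.sum_Ico_consecutive _ (Nat.zero_le _) h).symm
  rw [gramExcess, gramExcess, this]
  ring

theorem breakIndex_mono {τ τ' : ℝ} {T T' : ℕ} (h : τ * T ≤ τ' * T') :
    breakIndex τ T ≤ breakIndex τ' T' :=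
  Nat.sub_le_sub_right (Nat.ceil_mono h) 1

theorem eventually_const_le_rpow (C : ℝ) {p : ℝ} (hp : 0 < p) :
    ∀ᶠ T : ℕ in atTop, C ≤ (T : ℝ) ^ p :=
  ((tendsto_rpow_atTop hp).comp tendsto_natCast_atTop_atTop).eventually_ge_atTop C

theorem eventually_const_mul_rpow_le (C : ℝ) {p q : ℝ} (hpq : p < q) :
    ∀ᶠ T : ℕ in atTop, C * (T : ℝ) ^ p ≤ (T : ℝ) ^ q := by
  filter_upwards [eventually_const_le_rpow C (sub_pos.2 hpq), eventually_gt_atTop 0] with T hT h0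
  have h0' : (0 : ℝ) < T := by exact_mod_cast h0
  calc C * (T : ℝ) ^ p ≤ (T : ℝ) ^ (q - p) * (T : ℝ) ^ p := by gcongr
    _ = (T : ℝ) ^ q := by rw [← Real.rpow_add h0', sub_add_cancel]

namespace DGPAssumptions

variable {Ω : Type*} [m0 : MeasurableSpace Ω] {P : Measure Ω} {dx dz : ℕ}
  {x : ℕ → Ω → EuclideanSpace ℝ (Fin dx)} {ε : ℕ → Ω → ℝ} {δ₀ : EuclideanSpace ℝ (Fin dz)}
  {σ₀ : ℝ} {SigmaX : Matrix (Fin dx) (Fin dx) ℝ}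
  (h : DGPAssumptions P x ε δ₀ σ₀ SigmaX)
include h

theorem eventually_gramForm_Ico (D : EuclideanSpace ℝ (Fin dx)) {τ₁ τ₂ : ℝ} (h0 : 0 < τ₁)
    (h12 : τ₁ < τ₂) (h1 : τ₂ < 1) :
    ∀ᶠ i in inProb P, |gramForm (fun t => x t i.2)
      (Ico (breakIndex τ₁ i.1) (breakIndex τ₂ i.1)) D -
        (τ₂ - τ₁) * i.1 * ⟪matrixOp SigmaX D, D⟫| ≤ (i.1 : ℝ) ^ (0.55 : ℝ) := by
  -- The rate `T^(-1/2)` is weakened twice: to `T^(-0.46)` to absorb the constant in `O_p`, and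
  -- after multiplication by `T` from `T^0.54` to `T^0.55` to absorb the entries of `D`.
  have hent : ∀ k l, ∀ᶠ i in inProb P, |(i.1 : ℝ)⁻¹ *
      (∑ t ∈ Ico (breakIndex τ₁ i.1) (breakIndex τ₂ i.1), x t i.2 k * x t i.2 l) -
        (τ₂ - τ₁) * SigmaX k l| ≤ (i.1 : ℝ) ^ (-(0.46 : ℝ)) := by
    intro k l
    have h2 := (h.gram τ₁ τ₂ h0 h12 h1 k l).eventually_le
      (s := fun T : ℕ => (T : ℝ) ^ (-(0.46 : ℝ))) fun M => by
      refine (eventually_const_mul_rpow_le M (p := -(1 / 2)) (q := -0.46) (by norm_num)).mono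
        fun T hT => ?_
      rwa [Real.rpow_neg (Nat.cast_nonneg T), ← Real.sqrt_eq_rpow] at hT
    exact h2
  have hall : ∀ᶠ i in inProb P, ∀ k l, |(i.1 : ℝ)⁻¹ *
      (∑ t ∈ Ico (breakIndex τ₁ i.1) (breakIndex τ₂ i.1), x t i.2 k * x t i.2 l) -
        (τ₂ - τ₁) * SigmaX k l| ≤ (i.1 : ℝ) ^ (-(0.46 : ℝ)) :=
    eventually_all.2 fun k => eventually_all.2 fun l => hent k l
  set C := ∑ k, ∑ l, |D l * D k| with hC
  filter_upwards [hall, (tendsto_fst_inProb P).eventually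
    (eventually_const_mul_rpow_le C (p := 0.54) (q := 0.55) (by norm_num)),
    (tendsto_fst_inProb P).eventually (eventually_gt_atTop 0)] with i hi hCi hpos
  have hT : (0 : ℝ) < i.1 := by exact_mod_cast hpos
  have hform : gramForm (fun t => x t i.2) (Ico (breakIndex τ₁ i.1) (breakIndex τ₂ i.1)) D -
        (τ₂ - τ₁) * i.1 * ⟪matrixOp SigmaX D, D⟫ =
      i.1 * ∑ k, ∑ l, ((i.1 : ℝ)⁻¹ *
        (∑ t ∈ Ico (breakIndex τ₁ i.1) (breakIndex τ₂ i.1), x t i.2 k * x t i.2 l) -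
          (τ₂ - τ₁) * SigmaX k l) * (D l * D k) := by
    rw [← inner_gramOp, gramOp_eq_matrixOp, inner_matrixOp, inner_matrixOp]
    simp only [Matrix.of_apply, Finset.mul_sum]
    rw [← Finset.sum_sub_distrib]
    refine Finset.sum_congr rfl fun k _ => ?_
    rw [← Finset.sum_sub_distrib]
    refine Finset.sum_congr rfl fun l _ => ?_
    rw [← Finset.mul_sum]
    field_simp
  rw [hform, abs_mul, abs_of_pos hT]
  calc (i.1 : ℝ) * |∑ k, ∑ l, ((i.1 : ℝ)⁻¹ *
        (∑ t ∈ Ico (breakIndex τ₁ i.1) (breakIndex τ₂ i.1), x t i.2 k * x t i.2 l) -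
          (τ₂ - τ₁) * SigmaX k l) * (D l * D k)|
      ≤ i.1 * ∑ k, ∑ l, (i.1 : ℝ) ^ (-(0.46 : ℝ)) * |D l * D k| := by
        gcongr
        refine (Finset.abs_sum_le_sum_abs _ _).trans (Finset.sum_le_sum fun k _ =>
          (Finset.abs_sum_le_sum_abs _ _).trans (Finset.sum_le_sum fun l _ => ?_))
        rw [abs_mul]
        exact mul_le_mul_of_nonneg_right (hi k l) (abs_nonneg _)
    _ = C * ((i.1 : ℝ) ^ (1 : ℝ) * (i.1 : ℝ) ^ (-(0.46 : ℝ))) := by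
        simp only [← Finset.mul_sum]
        rw [Real.rpow_one]
        ring
    _ = C * (i.1 : ℝ) ^ (0.54 : ℝ) := by rw [← Real.rpow_add hT]; norm_num
    _ ≤ _ := hCi

theorem eventually_gramExcess_sub_le_of_lt (D : EuclideanSpace ℝ (Fin dx)) {τ₁ τ₂ : ℝ}
    (h0 : 0 < τ₁) (h12 : τ₁ < τ₂) (h1 : τ₂ < 1) :
    ∀ᶠ i in inProb P,
      |gramExcess (fun t => x t i.2) D ⟪matrixOp SigmaX D, D⟫ (breakIndex τ₂ i.1) -
        gramExcess (fun t => x t i.2) D ⟪matrixOp SigmaX D, D⟫ (breakIndex τ₁ i.1)| ≤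
        2 * (i.1 : ℝ) ^ (0.55 : ℝ) := by
  set s := ⟪matrixOp SigmaX D, D⟫ with hs
  filter_upwards [h.eventually_gramForm_Ico D h0 h12 h1, (tendsto_fst_inProb P).eventually
    (eventually_const_le_rpow |s| (p := 0.55) (by norm_num)),
    (tendsto_fst_inProb P).eventually (eventually_gt_atTop 0)] with i hi hsi hpos
  have hT : (0 : ℝ) < i.1 := by exact_mod_cast hpos
  rw [gramExcess_sub _ _ _ (breakIndex_mono (by gcongr))]
  have e1 := breakIndex_lt (mul_pos h0 hT)
  have e2 := le_breakIndex_add_one (mul_pos h0 hT)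
  have e3 := breakIndex_lt (mul_pos (h0.trans h12) hT)
  have e4 := le_breakIndex_add_one (mul_pos (h0.trans h12) hT)
  -- Rounding the fractions to indices costs at most `|s|`, absorbed by the second `T^0.55`.
  have hk : |(τ₂ - τ₁) * i.1 - ((breakIndex τ₂ i.1 : ℝ) - breakIndex τ₁ i.1)| ≤ 1 := by
    rw [abs_le]
    constructor <;> linarith
  have hsplit : gramForm (fun t => x t i.2) (Ico (breakIndex τ₁ i.1) (breakIndex τ₂ i.1)) D -
      ((breakIndex τ₂ i.1 : ℝ) - breakIndex τ₁ i.1) * s =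
      (gramForm (fun t => x t i.2) (Ico (breakIndex τ₁ i.1) (breakIndex τ₂ i.1)) D -
        (τ₂ - τ₁) * i.1 * s) +
      ((τ₂ - τ₁) * i.1 - ((breakIndex τ₂ i.1 : ℝ) - breakIndex τ₁ i.1)) * s := by ring
  rw [hsplit]
  refine (abs_add_le _ _).trans ?_
  rw [abs_mul]
  have := mul_le_mul_of_nonneg_right hk (abs_nonneg s)
  linarith

theorem eventually_gramExcess_sub_le (D : EuclideanSpace ℝ (Fin dx)) {τ τ' : ℝ}
    (hτ : τ ∈ Set.Ioo 0 1) (hτ' : τ' ∈ Set.Ioo 0 1) :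
    ∀ᶠ i in inProb P,
      |gramExcess (fun t => x t i.2) D ⟪matrixOp SigmaX D, D⟫ (breakIndex τ i.1) -
        gramExcess (fun t => x t i.2) D ⟪matrixOp SigmaX D, D⟫ (breakIndex τ' i.1)| ≤
        2 * (i.1 : ℝ) ^ (0.55 : ℝ) := by
  rcases lt_trichotomy τ τ' with hlt | rfl | hlt
  · refine (h.eventually_gramExcess_sub_le_of_lt D hτ.1 hlt hτ'.2).mono fun i hi => ?_
    rwa [abs_sub_comm]
  · refine Eventually.of_forall fun i => ?_
    rw [sub_self, abs_zero]
    positivity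
  · exact h.eventually_gramExcess_sub_le_of_lt D hτ'.1 hlt hτ.2

variable [IsProbabilityMeasure P]

/-- Partial sums up to the break are comparable across sample sizes of the same order. -/
theorem eventually_gramExcess_sub_le_of_size (D : EuclideanSpace ℝ (Fin dx)) {τ₀ : ℝ}
    (hτ₀ : τ₀ ∈ Set.Ioo 0 1) {N : ℕ → ℕ} (hN : ∀ᶠ T in atTop, T ≤ 2 * N T ∧ N T ≤ 2 * T) :
    ∀ᶠ i in inProb P,
      |gramExcess (fun t => x t i.2) D ⟪matrixOp SigmaX D, D⟫ (breakIndex τ₀ (N i.1)) -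
        gramExcess (fun t => x t i.2) D ⟪matrixOp SigmaX D, D⟫ (breakIndex τ₀ i.1)| ≤
        6 * (i.1 : ℝ) ^ (0.55 : ℝ) := by
  set s := ⟪matrixOp SigmaX D, D⟫ with hs
  set f : ℕ → ℕ → ENNReal := fun T k =>
    P {ω | ¬ |gramExcess (fun t => x t ω) D s k -
      gramExcess (fun t => x t ω) D s (breakIndex τ₀ T)| ≤ 2 * (T : ℝ) ^ (0.55 : ℝ)} with hf
  -- For each fixed `τ` the failure probability tends to zero. Comparing two sample sizes needs a
  -- fraction `r * τ` that moves with `T`, for which pointwise convergence says nothing; convergence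
  -- of the integral over `τ` survives the change of variable.
  set G : ℕ → ℝ → ENNReal := fun T => (Set.Ioo (0 : ℝ) 1).indicator fun τ =>
    f T (breakIndex τ T) with hG
  have hGm : ∀ T, Measurable (G T) := fun T =>
    ((measurable_from_nat (f := f T)).comp (measurable_breakIndex T)).indicator measurableSet_Ioo
  have hGlim : Tendsto (fun T => ∫⁻ τ, G T τ) atTop (𝓝 0) := by
    have h1 : Tendsto (fun T => ∫⁻ τ, G T τ) atTop (𝓝 (∫⁻ _ : ℝ, 0)) := by
      refine tendsto_lintegral_of_dominated_convergence
        ((Set.Ioo (0 : ℝ) 1).indicator fun _ => 1) hGm (fun T => Eventually.of_forall fun τ => ?_)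
        ?_ (Eventually.of_forall fun τ => ?_)
      · exact Set.indicator_le_indicator prob_le_one
      · rw [lintegral_indicator measurableSet_Ioo]
        simp
      · by_cases hτ : τ ∈ Set.Ioo (0 : ℝ) 1
        · simp only [hG, Set.indicator_of_mem hτ]
          exact eventually_inProb P |>.1 (h.eventually_gramExcess_sub_le D hτ hτ₀)
        · simp only [hG, Set.indicator_of_notMem hτ]
          exact tendsto_const_nhds
    simpa using h1
  rw [eventually_inProb]
  have hNtop : Tendsto N atTop atTop := by
    refine tendsto_atTop.2 fun b => ?_
    filter_upwards [hN, eventually_ge_atTop (2 * b)] with T h1 h2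
    omega
  have hlim : Tendsto (fun T => 2 * (∫⁻ τ, G T τ) + 4 * ∫⁻ τ, G (N T) τ) atTop (𝓝 0) := by
    have h1 := ENNReal.Tendsto.const_mul (a := 2) hGlim (Or.inr (by simp))
    have h2 := ENNReal.Tendsto.const_mul (a := 4) (hGlim.comp hNtop) (Or.inr (by simp))
    simpa using h1.add h2
  refine tendsto_of_tendsto_of_tendsto_of_le_of_le' tendsto_const_nhds hlim
    (Eventually.of_forall fun _ => zero_le) ?_
  filter_upwards [hN, eventually_gt_atTop 0] with T hNT hT
  have hT' : (0 : ℝ) < T := by exact_mod_cast hT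
  have hN' : (0 : ℝ) < N T := by
    have : 0 < N T := by omega
    exact_mod_cast this
  have hTN : (T : ℝ) ≤ 2 * N T := by exact_mod_cast hNT.1
  have hNT' : (N T : ℝ) ≤ 2 * T := by exact_mod_cast hNT.2
  set bad := {ω | ¬ |gramExcess (fun t => x t ω) D s (breakIndex τ₀ (N T)) -
    gramExcess (fun t => x t ω) D s (breakIndex τ₀ T)| ≤ 6 * (T : ℝ) ^ (0.55 : ℝ)} with hbad
  set r : ℝ := T / N T with hr
  have hrpos : 0 < r := by positivity
  have hr2 : r ≤ 2 := by rw [hr, div_le_iff₀ hN']; exact hTN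
  have hpow : ((N T : ℕ) : ℝ) ^ (0.55 : ℝ) ≤ 2 * (T : ℝ) ^ (0.55 : ℝ) := by
    calc ((N T : ℕ) : ℝ) ^ (0.55 : ℝ) ≤ (2 * (T : ℝ)) ^ (0.55 : ℝ) := by gcongr
      _ = 2 ^ (0.55 : ℝ) * (T : ℝ) ^ (0.55 : ℝ) := Real.mul_rpow (by norm_num) hT'.le
      _ ≤ 2 ^ (1 : ℝ) * (T : ℝ) ^ (0.55 : ℝ) := by gcongr <;> norm_num
      _ = _ := by rw [Real.rpow_one]
  -- The fraction `τ` at size `T` and `r * τ` at size `N T` give the same index, the pivot of a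
  -- triangle inequality. The errors are `2 T^0.55` and `2 N^0.55 ≤ 4 T^0.55`, hence the `6`. Taking
  -- `τ < 1 / 2` keeps `r * τ < 1`, as `r ≤ 2`.
  have hpt : ∀ τ ∈ Set.Ioo (0 : ℝ) (1 / 2), P bad ≤ G T τ + G (N T) (r * τ) := by
    intro τ hτ
    have hτ1 : τ ∈ Set.Ioo (0 : ℝ) 1 := ⟨hτ.1, hτ.2.trans (by norm_num)⟩
    have hτ2 : r * τ ∈ Set.Ioo (0 : ℝ) 1 := by
      refine ⟨mul_pos hrpos hτ.1, ?_⟩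
      calc r * τ ≤ 2 * τ := mul_le_mul_of_nonneg_right hr2 hτ.1.le
        _ < 1 := by linarith [hτ.2]
    have hk : breakIndex (r * τ) (N T) = breakIndex τ T := by
      rw [breakIndex, breakIndex]
      congr 2
      rw [hr]
      field_simp
    simp only [hG, Set.indicator_of_mem hτ1, Set.indicator_of_mem hτ2, hf, hk]
    refine (measure_mono fun ω hω => ?_).trans (measure_union_le _ _)
    by_contra hc
    simp only [Set.mem_union, Set.mem_ofPred_eq, not_or, not_not] at hc
    refine hω ?_
    have h3 := abs_sub_le (gramExcess (fun t => x t ω) D s (breakIndex τ₀ (N T)))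
      (gramExcess (fun t => x t ω) D s (breakIndex τ T))
      (gramExcess (fun t => x t ω) D s (breakIndex τ₀ T))
    rw [abs_sub_comm (gramExcess (fun t => x t ω) D s (breakIndex τ₀ (N T)))
      (gramExcess (fun t => x t ω) D s (breakIndex τ T))] at h3
    change _ ≤ 6 * (T : ℝ) ^ (0.55 : ℝ)
    linarith [hc.1, hc.2]
  -- Average over the pivot, on which `bad` does not depend. The substitution costs the factor `N /
  -- T ≤ 2`.
  have hint : P bad * ENNReal.ofReal (1 / 2) ≤ (∫⁻ τ, G T τ) + 2 * ∫⁻ τ, G (N T) τ := by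
    calc P bad * ENNReal.ofReal (1 / 2) = ∫⁻ _ in Set.Ioo (0 : ℝ) (1 / 2), P bad := by
          rw [setLIntegral_const, Real.volume_Ioo, sub_zero]
      _ ≤ ∫⁻ τ in Set.Ioo (0 : ℝ) (1 / 2), (G T τ + G (N T) (r * τ)) :=
          setLIntegral_mono' measurableSet_Ioo hpt
      _ ≤ ∫⁻ τ, (G T τ + G (N T) (r * τ)) := setLIntegral_le_lintegral _ _
      _ = (∫⁻ τ, G T τ) + ∫⁻ τ, G (N T) (r * τ) := lintegral_add_left (hGm T) _
      _ = (∫⁻ τ, G T τ) + ENNReal.ofReal |r⁻¹| * ∫⁻ τ, G (N T) τ := by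
          rw [← lintegral_map (hGm (N T)) (measurable_const_mul r),
            Real.map_volume_mul_left hrpos.ne', lintegral_smul_measure, smul_eq_mul]
      _ ≤ _ := by
          gcongr
          rw [abs_of_pos (inv_pos.2 hrpos), hr, inv_div]
          refine ENNReal.ofReal_le_of_le_toReal ?_
          rw [div_le_iff₀ hT']
          simpa using hNT'
  have h2 : P bad = 2 * (P bad * ENNReal.ofReal (1 / 2)) := by
    rw [mul_comm, mul_assoc, show (2 : ENNReal) = ENNReal.ofReal 2 by simp,
      ← ENNReal.ofReal_mul (by norm_num)]
    norm_num
  change P bad ≤ _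
  rw [h2]
  refine (mul_le_mul_right hint 2).trans (le_of_eq ?_)
  rw [mul_add, ← mul_assoc]
  norm_num

end DGPAssumptions

end StructuralBreak
end

/-! ### Typical samples are regular -/

noncomputable section
namespace StructuralBreak
open scoped RealInnerProductSpace
open Finset (range Ico)

theorem exists_matrixOp_coercive {ι : Type*} [Fintype ι] [DecidableEq ι] {M : Matrix ι ι ℝ}
    (hM : M.PosDef) : ∃ c : ℝ, 0 < c ∧ ∀ u, c * ‖u‖ ^ 2 ≤ ⟪matrixOp M u, u⟫ := by
  have hpos : ∀ u : EuclideanSpace ℝ ι, u ≠ 0 → 0 < ⟪matrixOp M u, u⟫ := fun u hu => by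
    have h1 := hM.dotProduct_mulVec_pos (x := u.ofLp) (by simpa using hu)
    rw [EuclideanSpace.inner_eq_star_dotProduct, ofLp_matrixOp]
    simpa using h1
  -- The unit sphere is empty in dimension zero; otherwise the constant is the minimum of the form
  -- over this compact set.
  rcases (Metric.sphere (0 : EuclideanSpace ℝ ι) 1).eq_empty_or_nonempty with hemp | hne
  · refine ⟨1, one_pos, fun u => ?_⟩
    have hu : u = 0 := by
      by_contra hu
      have : ‖u‖⁻¹ • u ∈ Metric.sphere (0 : EuclideanSpace ℝ ι) 1 := by
        simp [norm_smul, hu]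
      rw [hemp] at this
      exact this
    simp [hu]
  · have hcont : Continuous fun u : EuclideanSpace ℝ ι => ⟪matrixOp M u, u⟫ := by fun_prop
    obtain ⟨v, hv, hmin⟩ := (isCompact_sphere _ _).exists_isMinOn hne hcont.continuousOn
    refine ⟨⟪matrixOp M v, v⟫, hpos v (ne_zero_of_mem_unit_sphere ⟨v, hv⟩), fun u => ?_⟩
    rcases eq_or_ne u 0 with rfl | hu
    · simp
    have hn : 0 < ‖u‖ := norm_pos_iff.2 hu
    have h1 := hmin (show ‖u‖⁻¹ • u ∈ Metric.sphere (0 : EuclideanSpace ℝ ι) 1 by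
      simp [norm_smul, hu])
    simp only [Set.mem_ofPred_eq, map_smul, real_inner_smul_left, real_inner_smul_right] at h1
    calc _ ≤ ‖u‖⁻¹ * (‖u‖⁻¹ * ⟪matrixOp M u, u⟫) * ‖u‖ ^ 2 := by gcongr
      _ = _ := by field_simp

/-- The half-width of the neighbourhood of the break, in terms of the sample size. -/
def halfWidth (T : ℕ) : ℕ := ⌈(T : ℝ) ^ (0.6 : ℝ)⌉₊

theorem rpow_le_halfWidth (T : ℕ) : (T : ℝ) ^ (0.6 : ℝ) ≤ halfWidth T := Nat.le_ceil _

theorem halfWidth_le (T : ℕ) : (halfWidth T : ℝ) ≤ (T : ℝ) ^ (0.6 : ℝ) + 1 :=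
  (Nat.ceil_lt_add_one (by positivity)).le

theorem eventually_halfWidth_le {c : ℝ} (hc : 0 < c) :
    ∀ᶠ T : ℕ in atTop, (halfWidth T : ℝ) ≤ c * T := by
  filter_upwards [eventually_const_mul_rpow_le (2 / c) (p := 0.6) (q := 1) (by norm_num),
    eventually_const_le_rpow 1 (p := 0.6) (by norm_num)] with T h1 h2
  rw [Real.rpow_one, div_mul_eq_mul_div, div_le_iff₀ hc] at h1
  linarith [halfWidth_le T]

theorem le_gramForm_of_gramExcess {F : Type*} [NormedAddCommGroup F] [InnerProductSpace ℝ F]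
    {x : ℕ → F} {D : F} {s c N b : ℝ} {k k' : ℕ} (hs : 0 ≤ s) (hk : k ≤ k')
    (hlen : c * N - 1 ≤ (k' : ℝ) - k)
    (hexc : |gramExcess x D s k' - gramExcess x D s k| ≤ b) (hb : b + s ≤ c * s / 2 * N) :
    c * s / 2 * N ≤ gramForm x (Ico k k') D := by
  rw [gramExcess_sub x D s hk] at hexc
  have h1 := (abs_le.1 hexc).1
  have h2 := mul_le_mul_of_nonneg_right hlen hs
  linarith

theorem tendsto_natCast_div_self : Tendsto (fun T : ℕ => (T : ℝ) / T) atTop (𝓝 1) := by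
  refine tendsto_const_nhds.congr' ?_
  filter_upwards [eventually_gt_atTop 0] with T hT
  rw [div_self]
  exact_mod_cast hT.ne'

namespace DGPAssumptions

variable {Ω : Type*} [m0 : MeasurableSpace Ω] {P : Measure Ω} [IsProbabilityMeasure P]
  {dx dz : ℕ} {x : ℕ → Ω → EuclideanSpace ℝ (Fin dx)} {ε : ℕ → Ω → ℝ}
  {δ₀ : EuclideanSpace ℝ (Fin dz)} {σ₀ : ℝ} {SigmaX : Matrix (Fin dx) (Fin dx) ℝ}
  (h : DGPAssumptions P x ε δ₀ σ₀ SigmaX)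
include h

/-- The window ends at the true break index of the larger sample size `T + halfWidth T`, so it has
length about `τ₀ T^0.6`, and the comparison of sample sizes bounds the deviation of its signal from
the mean by `6 T^0.55`. -/
theorem separated_right {τ₀ : ℝ} (hτ₀ : τ₀ ∈ Set.Ioo 0 1) {D : EuclideanSpace ℝ (Fin dx)}
    (hs : 0 < ⟪matrixOp SigmaX D, D⟫) :
    ∃ c : ℝ, 0 < c ∧ ∀ᶠ i in inProb P, c * (i.1 : ℝ) ^ (0.6 : ℝ) ≤
      gramForm (fun t => x t i.2)
        (Ico (breakIndex τ₀ i.1) (breakIndex τ₀ (i.1 + halfWidth i.1))) D := by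
  set s := ⟪matrixOp SigmaX D, D⟫ with hs'
  have hsize : ∀ᶠ T in atTop, T ≤ 2 * (T + halfWidth T) ∧ T + halfWidth T ≤ 2 * T := by
    filter_upwards [eventually_halfWidth_le one_pos] with T hT
    rw [one_mul, Nat.cast_le] at hT
    omega
  have hc : 0 < τ₀ * s / 2 := by have := hτ₀.1; positivity
  refine ⟨τ₀ * s / 2, hc, ?_⟩
  filter_upwards [h.eventually_gramExcess_sub_le_of_size D hτ₀ hsize,
    (tendsto_fst_inProb P).eventually (eventually_const_mul_rpow_le (12 / (τ₀ * s / 2))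
      (p := 0.55) (q := 0.6) (by norm_num)),
    (tendsto_fst_inProb P).eventually (eventually_const_le_rpow (2 * s / (τ₀ * s / 2))
      (p := 0.6) (by norm_num)),
    (tendsto_fst_inProb P).eventually (eventually_gt_atTop 0)] with i hi h1 h2 hT
  have hT' : (0 : ℝ) < i.1 := by exact_mod_cast hT
  have hN := rpow_le_halfWidth i.1
  rw [div_mul_eq_mul_div, div_le_iff₀ hc] at h1
  rw [div_le_iff₀ hc] at h2
  have e1 := breakIndex_lt (mul_pos hτ₀.1 hT')
  have e2 := le_breakIndex_add_one (τ := τ₀) (T := i.1 + halfWidth i.1)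
    (mul_pos hτ₀.1 (by push_cast; positivity))
  push_cast at e2
  refine le_gramForm_of_gramExcess hs.le (breakIndex_mono ?_) ?_ hi ?_
  · push_cast
    have := hτ₀.1
    gcongr
    linarith [Nat.cast_nonneg (α := ℝ) (halfWidth i.1)]
  · have := mul_le_mul_of_nonneg_left hN hτ₀.1.le
    linarith
  · linarith

theorem separated_left {τ₀ : ℝ} (hτ₀ : τ₀ ∈ Set.Ioo 0 1) {D : EuclideanSpace ℝ (Fin dx)}
    (hs : 0 < ⟪matrixOp SigmaX D, D⟫) :
    ∃ c : ℝ, 0 < c ∧ ∀ᶠ i in inProb P, c * (i.1 : ℝ) ^ (0.6 : ℝ) ≤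
      gramForm (fun t => x t i.2)
        (Ico (breakIndex τ₀ (i.1 - halfWidth i.1)) (breakIndex τ₀ i.1)) D := by
  set s := ⟪matrixOp SigmaX D, D⟫ with hs'
  have hhalf : ∀ᶠ T in atTop, 2 * halfWidth T ≤ T := by
    filter_upwards [eventually_halfWidth_le (c := 1 / 2) (by norm_num)] with T hT
    have : (2 : ℝ) * halfWidth T ≤ T := by linarith
    exact_mod_cast this
  have hsize : ∀ᶠ T in atTop, T ≤ 2 * (T - halfWidth T) ∧ T - halfWidth T ≤ 2 * T := by
    filter_upwards [hhalf] with T hT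
    omega
  have hc : 0 < τ₀ * s / 2 := by have := hτ₀.1; positivity
  refine ⟨τ₀ * s / 2, hc, ?_⟩
  filter_upwards [h.eventually_gramExcess_sub_le_of_size D hτ₀ hsize,
    (tendsto_fst_inProb P).eventually (eventually_const_mul_rpow_le (12 / (τ₀ * s / 2))
      (p := 0.55) (q := 0.6) (by norm_num)),
    (tendsto_fst_inProb P).eventually (eventually_const_le_rpow (2 * s / (τ₀ * s / 2))
      (p := 0.6) (by norm_num)),
    (tendsto_fst_inProb P).eventually hhalf,
    (tendsto_fst_inProb P).eventually (eventually_gt_atTop 0)] with i hi h1 h2 hh hT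
  have hT' : (0 : ℝ) < i.1 := by exact_mod_cast hT
  have hN := rpow_le_halfWidth i.1
  rw [div_mul_eq_mul_div, div_le_iff₀ hc] at h1
  rw [div_le_iff₀ hc] at h2
  have hcast : ((i.1 - halfWidth i.1 : ℕ) : ℝ) = i.1 - halfWidth i.1 :=
    Nat.cast_sub (by omega)
  have hpos : (0 : ℝ) < ((i.1 - halfWidth i.1 : ℕ) : ℝ) := by
    have : 0 < i.1 - halfWidth i.1 := by omega
    exact_mod_cast this
  have e1 := breakIndex_lt (mul_pos hτ₀.1 hpos)
  have e2 := le_breakIndex_add_one (mul_pos hτ₀.1 hT')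
  rw [hcast] at e1
  rw [abs_sub_comm] at hi
  refine le_gramForm_of_gramExcess hs.le (breakIndex_mono ?_) ?_ hi ?_
  · have := hτ₀.1
    gcongr
    exact Nat.sub_le _ _
  · have := mul_le_mul_of_nonneg_left hN hτ₀.1.le
    linarith
  · linarith

omit [IsProbabilityMeasure P] in
theorem eventually_gramForm_coercive {f : ℕ → Finset ℕ} {ρ : ℝ} (hρ : 0 < ρ)
    (hf : Tendsto (fun i : ℕ × Ω => (i.1 : ℝ)⁻¹ • gramOp (fun t => x t i.2) (f i.1)) (inProb P)
      (𝓝 (ρ • matrixOp SigmaX))) :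
    ∃ c : ℝ, 0 < c ∧ ∀ᶠ i in inProb P, ∀ u,
      c * i.1 * ‖u‖ ^ 2 ≤ gramForm (fun t => x t i.2) (f i.1) u := by
  obtain ⟨c, hc, hco⟩ := exists_matrixOp_coercive h.posDef
  have hco' : ∀ u, ρ * c * ‖u‖ ^ 2 ≤ ⟪(ρ • matrixOp SigmaX) u, u⟫ := fun u => by
    rw [smul_apply, real_inner_smul_left, mul_assoc]
    exact mul_le_mul_of_nonneg_left (hco u) hρ.le
  refine ⟨ρ * c / 2, by positivity, ?_⟩
  filter_upwards [hf.eventually (eventually_coercive (mul_pos hρ hc) hco'),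
    (tendsto_fst_inProb P).eventually (eventually_gt_atTop 0)] with i hi hpos u
  have hT : (0 : ℝ) < i.1 := by exact_mod_cast hpos
  have h1 := hi u
  rw [smul_apply, real_inner_smul_left, inner_gramOp, le_inv_mul_iff₀ hT] at h1
  linarith

omit [IsProbabilityMeasure P] h in
theorem eventually_le_gramForm {f : ℕ → Finset ℕ} {ρ c : ℝ} {D : EuclideanSpace ℝ (Fin dx)}
    (hf : Tendsto (fun i : ℕ × Ω => (i.1 : ℝ)⁻¹ • gramOp (fun t => x t i.2) (f i.1)) (inProb P)
      (𝓝 (ρ • matrixOp SigmaX))) (hc : c < ρ * ⟪matrixOp SigmaX D, D⟫) :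
    ∀ᶠ i in inProb P, c * i.1 ≤ gramForm (fun t => x t i.2) (f i.1) D := by
  have hcont : Continuous fun Q : EuclideanSpace ℝ (Fin dx) →L[ℝ] EuclideanSpace ℝ (Fin dx) =>
      ⟪Q D, D⟫ := by fun_prop
  have h1 := (hcont.tendsto _).comp hf
  rw [smul_apply, real_inner_smul_left] at h1
  filter_upwards [h1.eventually_const_lt hc,
    (tendsto_fst_inProb P).eventually (eventually_gt_atTop 0)] with i hi hpos
  have hT : (0 : ℝ) < i.1 := by exact_mod_cast hpos
  rw [Function.comp_apply, smul_apply, real_inner_smul_left, inner_gramOp,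
    lt_inv_mul_iff₀ hT] at hi
  linarith

/-- Split at the fraction `1 - ρ`. Earlier candidates leave at least the last `ρ T` observations,
whose Gram form is coercive. For later ones the error sum is at most about `ρ σ₀² T < θ T`, while
the window contains all observations between `τ₀ T` and `(1 - ρ) T`. -/
theorem end_right {τ₀ : ℝ} (hτ₀ : τ₀ ∈ Set.Ioo 0 1) {D : EuclideanSpace ℝ (Fin dx)}
    (hs : 0 < ⟪matrixOp SigmaX D, D⟫) :
    ∃ c : ℝ, 0 < c ∧ ∀ θ : ℝ, 0 < θ → ∃ c' : ℝ, 0 < c' ∧ ∀ᶠ i in inProb P,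
      ∀ k, breakIndex τ₀ i.1 ≤ k → k ≤ i.1 →
      (∀ u, c' * i.1 * ‖u‖ ^ 2 ≤ gramForm (fun t => x t i.2) (Ico k i.1) u) ∨
      (∑ t ∈ Ico k i.1, ε t i.2 ^ 2 ≤ θ * i.1 ∧
        c * i.1 ≤ gramForm (fun t => x t i.2) (Ico (breakIndex τ₀ i.1) k) D) := by
  have hτ1 := sub_pos.2 hτ₀.2
  refine ⟨(1 - τ₀) / 4 * ⟪matrixOp SigmaX D, D⟫, by positivity, fun θ hθ => ?_⟩
  -- The bound `(1 - τ₀) / 2` keeps the signal constant independent of `θ`.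
  obtain ⟨ρ, hρ, hρτ, hρθ⟩ : ∃ ρ : ℝ, 0 < ρ ∧ ρ ≤ (1 - τ₀) / 2 ∧ ρ * σ₀ ^ 2 < θ := by
    refine ⟨min ((1 - τ₀) / 2) (θ / (2 * (σ₀ ^ 2 + 1))), by positivity, min_le_left _ _, ?_⟩
    calc _ ≤ θ / (2 * (σ₀ ^ 2 + 1)) * σ₀ ^ 2 := by gcongr; exact min_le_right _ _
      _ < θ := by
        rw [div_mul_eq_mul_div, div_lt_iff₀ (by positivity)]
        nlinarith [sq_nonneg σ₀]
  have hρ1 : 0 < 1 - ρ := by linarith [hτ₀.1]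
  have hκ := tendsto_breakIndex_div hρ1
  have hle : ∀ T, breakIndex (1 - ρ) T ≤ T := fun T => breakIndex_le (by linarith) T
  have hg := h.tendsto_gramOp_Ico hρ1 one_pos hκ tendsto_natCast_div_self
    (Eventually.of_forall hle)
  rw [sub_sub_cancel] at hg
  obtain ⟨c', hc', hco⟩ := h.eventually_gramForm_coercive
    (f := fun T => Ico (breakIndex (1 - ρ) T) T) hρ hg
  have hmid := h.tendsto_gramOp_Ico hτ₀.1 hρ1 (tendsto_breakIndex_div hτ₀.1) hκ
    (Eventually.of_forall fun T => breakIndex_mono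
      (mul_le_mul_of_nonneg_right (by linarith) (Nat.cast_nonneg T)))
  have hD := eventually_le_gramForm
    (f := fun T => Ico (breakIndex τ₀ T) (breakIndex (1 - ρ) T)) hmid
    (c := (1 - τ₀) / 4 * ⟪matrixOp SigmaX D, D⟫)
    (mul_lt_mul_of_pos_right (by linarith) hs)
  have he := (h.tendsto_sum_sq one_pos tendsto_natCast_div_self).sub (h.tendsto_sum_sq hρ1 hκ)
  rw [← sub_mul, sub_sub_cancel] at he
  refine ⟨c', hc', ?_⟩
  filter_upwards [hco, hD, he.eventually_lt_const hρθ,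
    (tendsto_fst_inProb P).eventually (eventually_gt_atTop 0)] with i hco hD he hpos k hk₀ hk
  have hT : (0 : ℝ) < i.1 := by exact_mod_cast hpos
  rcases le_total k (breakIndex (1 - ρ) i.1) with hkle | hkge
  · exact Or.inl fun u => (hco u).trans (gramForm_mono _ (Finset.Ico_subset_Ico_left hkle) u)
  · refine Or.inr ⟨?_, hD.trans (gramForm_mono _ (Finset.Ico_subset_Ico_right hkge) D)⟩
    rw [← sub_div, div_lt_iff₀ hT, Finset.range_eq_Ico, Finset.range_eq_Ico,
      ← Finset.sum_Ico_consecutive _ (Nat.zero_le _) (hle i.1), add_sub_cancel_left] at he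
    exact (Finset.sum_le_sum_of_subset_of_nonneg (Finset.Ico_subset_Ico_left hkge)
      fun _ _ _ => sq_nonneg _).trans he.le

theorem end_left {τ₀ : ℝ} (hτ₀ : τ₀ ∈ Set.Ioo 0 1) {D : EuclideanSpace ℝ (Fin dx)}
    (hs : 0 < ⟪matrixOp SigmaX D, D⟫) :
    ∃ c : ℝ, 0 < c ∧ ∀ θ : ℝ, 0 < θ → ∃ c' : ℝ, 0 < c' ∧ ∀ᶠ i in inProb P,
      ∀ k ≤ breakIndex τ₀ i.1,
      (∀ u, c' * i.1 * ‖u‖ ^ 2 ≤ gramForm (fun t => x t i.2) (range k) u) ∨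
      (∑ t ∈ range k, ε t i.2 ^ 2 ≤ θ * i.1 ∧
        c * i.1 ≤ gramForm (fun t => x t i.2) (Ico k (breakIndex τ₀ i.1)) D) := by
  have hτ1 := hτ₀.1
  refine ⟨τ₀ / 4 * ⟪matrixOp SigmaX D, D⟫, by positivity, fun θ hθ => ?_⟩
  obtain ⟨ρ, hρ, hρτ, hρθ⟩ : ∃ ρ : ℝ, 0 < ρ ∧ ρ ≤ τ₀ / 2 ∧ ρ * σ₀ ^ 2 < θ := by
    refine ⟨min (τ₀ / 2) (θ / (2 * (σ₀ ^ 2 + 1))), by positivity, min_le_left _ _, ?_⟩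
    calc _ ≤ θ / (2 * (σ₀ ^ 2 + 1)) * σ₀ ^ 2 := by gcongr; exact min_le_right _ _
      _ < θ := by
        rw [div_mul_eq_mul_div, div_lt_iff₀ (by positivity)]
        nlinarith [sq_nonneg σ₀]
  have hκ := tendsto_breakIndex_div hρ
  obtain ⟨c', hc', hco⟩ := h.eventually_gramForm_coercive
    (f := fun T => range (breakIndex ρ T)) hρ (h.tendsto_gramOp_range hρ hκ)
  have hmid := h.tendsto_gramOp_Ico hρ hτ₀.1 hκ (tendsto_breakIndex_div hτ₀.1)
    (Eventually.of_forall fun T => breakIndex_mono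
      (mul_le_mul_of_nonneg_right (by linarith) (Nat.cast_nonneg T)))
  have hD := eventually_le_gramForm
    (f := fun T => Ico (breakIndex ρ T) (breakIndex τ₀ T)) hmid
    (c := τ₀ / 4 * ⟪matrixOp SigmaX D, D⟫)
    (mul_lt_mul_of_pos_right (by linarith) hs)
  refine ⟨c', hc', ?_⟩
  filter_upwards [hco, hD, (h.tendsto_sum_sq hρ hκ).eventually_lt_const hρθ,
    (tendsto_fst_inProb P).eventually (eventually_gt_atTop 0)] with i hco hD he hpos k hk
  have hT : (0 : ℝ) < i.1 := by exact_mod_cast hpos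
  rcases le_total (breakIndex ρ i.1) k with hkge | hkle
  · exact Or.inl fun u => (hco u).trans (gramForm_mono _ (Finset.range_mono hkge) u)
  · refine Or.inr ⟨?_, hD.trans (gramForm_mono _ (Finset.Ico_subset_Ico_left hkle) D)⟩
    rw [div_lt_iff₀ hT] at he
    exact (Finset.sum_le_sum_of_subset_of_nonneg (Finset.range_mono hkle)
      fun _ _ _ => sq_nonneg _).trans he.le

/-- Under the assumptions on the data-generating process, samples are regular with probability
tending to one. -/
theorem regularSample {τ₀ : ℝ} (hτ₀ : τ₀ ∈ Set.Ioo 0 1) {D : EuclideanSpace ℝ (Fin dx)}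
    (hD : D ≠ 0) :
    RegularSample (inProb P) Prod.fst (fun i => breakIndex τ₀ i.1)
      (fun i => breakIndex τ₀ (i.1 - halfWidth i.1))
      (fun i => breakIndex τ₀ (i.1 + halfWidth i.1))
      (fun i t => x t i.2) (fun i t => ε t i.2) D
      (τ₀ • matrixOp SigmaX) ((1 - τ₀) • matrixOp SigmaX) σ₀ := by
  obtain ⟨cS, hcS, hcoer⟩ := exists_matrixOp_coercive h.posDef
  have hs : 0 < ⟪matrixOp SigmaX D, D⟫ := by
    have := norm_pos_iff.2 hD
    exact lt_of_lt_of_le (by positivity) (hcoer D)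
  have horder : ∀ᶠ T : ℕ in atTop, breakIndex τ₀ (T - halfWidth T) ≤ breakIndex τ₀ T ∧
      breakIndex τ₀ T ≤ breakIndex τ₀ (T + halfWidth T) := Eventually.of_forall fun T => by
    have := hτ₀.1
    constructor <;> refine breakIndex_mono ?_ <;> gcongr
    · exact Nat.sub_le _ _
    · exact Nat.le_add_right _ _
  have hwidth : ∀ᶠ T : ℕ in atTop, (breakIndex τ₀ (T + halfWidth T) : ℝ) -
      breakIndex τ₀ (T - halfWidth T) ≤ 5 * (T : ℝ) ^ (0.6 : ℝ) := by
    filter_upwards [eventually_halfWidth_le (c := 1 / 2) (by norm_num), eventually_gt_atTop 0,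
      eventually_const_le_rpow 1 (p := 0.6) (by norm_num)] with T hT hpos h1
    have hT' : (0 : ℝ) < T := by exact_mod_cast hpos
    have hle : halfWidth T ≤ T := by
      have : (halfWidth T : ℝ) ≤ T := by linarith
      exact_mod_cast this
    have e1 := breakIndex_lt (τ := τ₀) (T := T + halfWidth T)
      (mul_pos hτ₀.1 (by push_cast; positivity))
    have e2 := le_breakIndex_add_one (τ := τ₀) (T := T - halfWidth T)
      (mul_pos hτ₀.1 (by rw [Nat.cast_sub hle]; linarith))
    rw [Nat.cast_sub hle] at e2
    push_cast at e1
    have e3 := halfWidth_le T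
    have e4 : τ₀ * halfWidth T ≤ halfWidth T :=
      mul_le_of_le_one_left (Nat.cast_nonneg _) hτ₀.2.le
    linarith
  have herr := h.tendsto_sum_sq (κ := fun T => T) one_pos tendsto_natCast_div_self
  rw [one_mul] at herr
  have hgR := h.tendsto_gramOp_Ico hτ₀.1 one_pos (tendsto_breakIndex_div hτ₀.1)
    (κ' := fun T => T) tendsto_natCast_div_self
    (Eventually.of_forall fun T => breakIndex_le hτ₀.2.le T)
  have hgL := h.tendsto_gramOp_range hτ₀.1 (tendsto_breakIndex_div hτ₀.1)
  have hscw := h.eventually_score_window_le horder hwidth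
  have hord : ∀ᶠ i in inProb P, breakIndex τ₀ (i.1 - halfWidth i.1) ≤ breakIndex τ₀ i.1 ∧
      breakIndex τ₀ i.1 ≤ breakIndex τ₀ (i.1 + halfWidth i.1) ∧
      breakIndex τ₀ (i.1 + halfWidth i.1) ≤ i.1 := by
    have hR : ∀ᶠ T : ℕ in atTop, breakIndex τ₀ (T + halfWidth T) ≤ T := by
      filter_upwards [eventually_halfWidth_le (c := (1 - τ₀) / τ₀)
        (div_pos (sub_pos.2 hτ₀.2) hτ₀.1), eventually_gt_atTop 0] with T hT hpos
      have hT' : (0 : ℝ) < T := by exact_mod_cast hpos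
      have e1 := breakIndex_lt (τ := τ₀) (T := T + halfWidth T)
        (mul_pos hτ₀.1 (by push_cast; positivity))
      push_cast at e1
      rw [div_mul_eq_mul_div, le_div_iff₀ hτ₀.1] at hT
      have : (breakIndex τ₀ (T + halfWidth T) : ℝ) ≤ T := by linarith
      exact_mod_cast this
    filter_upwards [(tendsto_fst_inProb P).eventually horder,
      (tendsto_fst_inProb P).eventually hR] with i h1 h2
    exact ⟨h1.1, h1.2, h2⟩
  obtain ⟨B, hB⟩ := h.exists_norm_le
  exact
    { size := tendsto_fst_inProb P
      order := hord
      width := ⟨5, (tendsto_fst_inProb P).eventually hwidth⟩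
      bounded := ⟨B, fun i t => hB t i.2⟩
      error := herr
      gram_left := hgL
      gram_right := hgR
      coercive_left := ⟨τ₀ * cS, mul_pos hτ₀.1 hcS, fun u => by
        rw [smul_apply, real_inner_smul_left, mul_assoc]
        exact mul_le_mul_of_nonneg_left (hcoer u) hτ₀.1.le⟩
      coercive_right := ⟨(1 - τ₀) * cS, mul_pos (sub_pos.2 hτ₀.2) hcS, fun u => by
        rw [smul_apply, real_inner_smul_left, mul_assoc]
        exact mul_le_mul_of_nonneg_left (hcoer u) (sub_pos.2 hτ₀.2).le⟩
      score_le := h.eventually_score_range_le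
      score_window_le := hscw
      separated_left := h.separated_left hτ₀ hs
      separated_right := h.separated_right hτ₀ hs
      end_left := h.end_left hτ₀ hs
      end_right := h.end_right hτ₀ hs }

end DGPAssumptions

end StructuralBreak
end

/-! ### Least squares, the limit matrix and the prior in the concrete model -/

noncomputable section
namespace StructuralBreak
open scoped RealInnerProductSpace
open Finset (range Ico)

theorem inner_rowGram {F E : Type*} [NormedAddCommGroup F] [InnerProductSpace ℝ F]
    [NormedAddCommGroup E] [InnerProductSpace ℝ E] {Ja Jb : F →L[ℝ] E} {Pa Pb : E →L[ℝ] F}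
    (hPa : ∀ z γ, ⟪Ja z, γ⟫ = ⟪z, Pa γ⟫) (hPb : ∀ z γ, ⟪Jb z, γ⟫ = ⟪z, Pb γ⟫) {x : ℕ → F} {n k : ℕ}
    (hk : k ≤ n) (u : E) : ⟪rowGram Ja Jb x n k u, u⟫ =
      gramForm x (range k) (Pa u) + gramForm x (Ico k n) (Pb u) := by
  rw [rowGram_true hPa hPb hk]
  simp [inner_add_left, hPa, hPb, inner_gramOp]

section Estimation

variable {dx dz : ℕ} {R : Matrix (Fin dx) (Fin dz) ℝ} {x : ℕ → EuclideanSpace ℝ (Fin dx)}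
  {e : ℕ → ℝ} {γ₀ γ' : EuclideanSpace ℝ (Fin dx ⊕ Fin dz)} {T : ℕ} {τ₀ τ' : ℝ} {H₀ : Set ℝ}

theorem IsLeastSquares.rss_le (hτ₀ : τ₀ ∈ H₀)
    (h : IsLeastSquares R x T (response R x e γ₀ τ₀ T) H₀ τ' γ') :
    rss (earlyRow dx dz) (lateRow R) x e (breakIndex τ₀ T) γ₀ T (breakIndex τ' T) γ' ≤
      ∑ t ∈ range T, e t ^ 2 := by
  rw [← sumSq_response, ← rss_true (Ja := earlyRow dx dz) (Jb := lateRow R) (x := x) (e := e)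
    (n := T) (k₀ := breakIndex τ₀ T) (γ₀ := γ₀), ← sumSq_response]
  calc _ ≤ residualSumSq R x T (response R x e γ₀ τ₀ T) τ' := le_ciInf h.2.2
    _ ≤ residualSumSq R x T (response R x e γ₀ τ₀ T) τ₀ := h.2.1 τ₀ hτ₀
    _ ≤ _ := ciInf_le ⟨0, by
      rintro _ ⟨γ, rfl⟩
      exact Finset.sum_nonneg fun _ _ => sq_nonneg _⟩ γ₀

theorem IsLeastSquares.rowGram_eq
    (h : IsLeastSquares R x T (response R x e γ₀ τ₀ T) H₀ τ' γ') :
    rowGram (earlyRow dx dz) (lateRow R) x T (breakIndex τ' T) (γ' - γ₀) =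
      rowScore (earlyRow dx dz) (lateRow R) x e (breakIndex τ₀ T) γ₀ T (breakIndex τ' T) := by
  refine rowGram_eq_of_isMin fun γ => ?_
  rw [← sumSq_response, ← sumSq_response]
  exact h.2.2 γ

theorem transpose_mul_design_apply (i j : Fin dx ⊕ Fin dz) (τ : ℝ) :
    ((design R x T τ).transpose * design R x T τ) i j =
      ⟪rowGram (earlyRow dx dz) (lateRow R) x T (breakIndex τ T) (EuclideanSpace.single j 1),
        EuclideanSpace.single i 1⟫ := by
  have hentry : ∀ (t : Fin T) l, design R x T τ t l =
      ⟪row (earlyRow dx dz) (lateRow R) x (breakIndex τ T) t, EuclideanSpace.single l 1⟫ := by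
    intro t l
    rw [← design_mulVec]
    simp
  rw [Matrix.mul_apply, rowGram, gramOp_apply, sum_inner,
    ← Fin.sum_univ_eq_sum_range (fun t =>
      ⟪⟪row (earlyRow dx dz) (lateRow R) x (breakIndex τ T) t, EuclideanSpace.single j (1 : ℝ)⟫ •
        row (earlyRow dx dz) (lateRow R) x (breakIndex τ T) t, EuclideanSpace.single i (1 : ℝ)⟫)]
  refine Finset.sum_congr rfl fun t _ => ?_
  rw [Matrix.transpose_apply, hentry, hentry, real_inner_smul_left, mul_comm]

end Estimation

section Limits

theorem exists_matrixOp_eq {ι : Type*} [Fintype ι] [DecidableEq ι]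
    (Q : EuclideanSpace ℝ ι →L[ℝ] EuclideanSpace ℝ ι) : ∃ V : Matrix ι ι ℝ, matrixOp V = Q :=
  ⟨(Matrix.toEuclideanCLM (n := ι) (𝕜 := ℝ)).symm Q, StarAlgEquiv.apply_symm_apply _ _⟩

theorem matrixOp_apply_single {ι : Type*} [Fintype ι] [DecidableEq ι] (V : Matrix ι ι ℝ)
    (i j : ι) : ⟪matrixOp V (EuclideanSpace.single j 1), EuclideanSpace.single i 1⟫ = V i j := by
  rw [real_inner_comm, EuclideanSpace.inner_single_left, ofLp_matrixOp]
  simp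

theorem posDef_of_matrixOp_coercive {ι : Type*} [Fintype ι] [DecidableEq ι] {V : Matrix ι ι ℝ}
    (hsymm : V.IsHermitian) {c : ℝ} (hc : 0 < c) (h : ∀ u, c * ‖u‖ ^ 2 ≤ ⟪matrixOp V u, u⟫) :
    V.PosDef := by
  refine Matrix.PosDef.of_dotProduct_mulVec_pos hsymm fun v hv => ?_
  have h1 := h (WithLp.toLp 2 v)
  rw [EuclideanSpace.inner_eq_star_dotProduct, ofLp_matrixOp] at h1
  have h2 : 0 < ‖WithLp.toLp 2 v‖ := norm_pos_iff.2 (by simpa using hv)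
  exact lt_of_lt_of_le (by positivity) h1

end Limits

section PriorFacts

variable {ι : Type*} [Fintype ι] [DecidableEq ι] {H : Matrix ι ι ℝ} {a b : ℝ} {H₀ : Set ℝ}

omit [DecidableEq ι] in
theorem ConjugatePrior.isHermitian (h : ConjugatePrior H a b H₀) : H.IsHermitian := by
  rcases h with h | h
  · exact h.1.isHermitian
  · rw [h.1]; exact Matrix.isHermitian_zero

theorem ConjugatePrior.inner_comm (h : ConjugatePrior H a b H₀) (u v : EuclideanSpace ℝ ι) :
    ⟪matrixOp H u, v⟫ = ⟪u, matrixOp H v⟫ := by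
  have h1 : H.transpose = H := by
    have := h.isHermitian.eq
    rwa [Matrix.conjTranspose_eq_transpose_of_trivial] at this
  rw [EuclideanSpace.inner_eq_star_dotProduct, EuclideanSpace.inner_eq_star_dotProduct,
    ofLp_matrixOp, ofLp_matrixOp, star_trivial, star_trivial, Matrix.dotProduct_mulVec,
    ← Matrix.mulVec_transpose, h1]

theorem ConjugatePrior.inner_nonneg (h : ConjugatePrior H a b H₀) (u : EuclideanSpace ℝ ι) :
    0 ≤ ⟪matrixOp H u, u⟫ := by
  rcases h with h | h
  · obtain ⟨c, hc, hco⟩ := exists_matrixOp_coercive h.1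
    exact le_trans (by positivity) (hco u)
  · have : matrixOp H = 0 := by rw [h.1]; exact map_zero _
    simp [this]

omit [DecidableEq ι] in
theorem ConjugatePrior.rate_nonneg (h : ConjugatePrior H a b H₀) : 0 ≤ b := by
  rcases h with h | h
  · exact h.2.2.le
  · exact h.2.2.1.ge

omit [DecidableEq ι] in
theorem ConjugatePrior.exponent_nonneg (h : ConjugatePrior H a b H₀) :
    0 ≤ (Fintype.card ι : ℝ) / 2 + a := by
  rcases h with h | h
  · have := h.2.1; positivity
  · rw [h.2.1]; apply le_of_eq; ring

end PriorFacts

theorem tendsto_posteriorExponent_div (dx dz : ℕ) (a : ℝ) :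
    Tendsto (fun T : ℕ => posteriorExponent dx dz a T / T) atTop (𝓝 (1 / 2)) := by
  have h1 : Tendsto (fun T : ℕ => 1 / 2 +
      ((Fintype.card (Fin dx ⊕ Fin dz) : ℝ) / 2 + a) / (T : ℝ)) atTop (𝓝 (1 / 2 + 0)) :=
    tendsto_const_nhds.add (tendsto_const_div_atTop_nhds_zero_nat _)
  rw [add_zero] at h1
  refine h1.congr' ?_
  filter_upwards [eventually_gt_atTop 0] with T hT
  have hT' : (T : ℝ) ≠ 0 := by exact_mod_cast hT.ne'
  rw [posteriorExponent]
  field_simp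
  ring

namespace DGPAssumptions

variable {Ω : Type*} [m0 : MeasurableSpace Ω] {P : Measure Ω} {dx dz : ℕ}
  {x : ℕ → Ω → EuclideanSpace ℝ (Fin dx)} {ε : ℕ → Ω → ℝ}
  {δ₀ : EuclideanSpace ℝ (Fin dz)} {σ₀ : ℝ} {SigmaX : Matrix (Fin dx) (Fin dx) ℝ}
  (h : DGPAssumptions P x ε δ₀ σ₀ SigmaX)
include h

/-- The posterior precision of the slopes is bounded away from zero, uniformly over the admissible
breaks. -/
theorem exists_precision_coercive {R : Matrix (Fin dx) (Fin dz) ℝ}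
    (hR : LinearIndependent ℝ R.col)
    {H : Matrix (Fin dx ⊕ Fin dz) (Fin dx ⊕ Fin dz) ℝ} {a b : ℝ} {H₀ : Set ℝ} {τ₀ : ℝ}
    (hprior : ConjugatePrior H a b H₀) (hsub : H₀ ⊆ Set.Ioo 0 1) (hτ₀ : τ₀ ∈ H₀) :
    ∃ μ : ℝ, 0 < μ ∧ ∀ᶠ i in inProb P, ∀ k ∈ admissibleBreaks H₀ i.1, ∀ u,
      μ * ‖u‖ ^ 2 ≤ ⟪(rowGram (earlyRow dx dz) (lateRow R) (fun t => x t i.2) i.1 k +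
        matrixOp H) u, u⟫ := by
  rcases hprior with hH | ⟨hH, -, -, c, hc, hcsub⟩
  · obtain ⟨μ, hμ, hco⟩ := exists_matrixOp_coercive hH.1
    refine ⟨μ, hμ, Eventually.of_forall fun i k _ u => ?_⟩
    rw [add_apply, inner_add_left, rowGram, inner_gramOp]
    linarith [hco u, gramForm_nonneg (row (earlyRow dx dz) (lateRow R) (fun t => x t i.2) k)
      (range i.1) u]
  -- Without curvature from the prior the data must supply it: breaks in `[c, 1 - c]` leave both
  -- regimes about `c T` observations at least.
  · have hc1 : 0 < 1 - c := lt_of_lt_of_le (hsub hτ₀).1 (hcsub hτ₀).2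
    have hκ := tendsto_breakIndex_div hc1
    have hg := h.tendsto_gramOp_Ico hc1 one_pos hκ tendsto_natCast_div_self
      (Eventually.of_forall fun T => breakIndex_le (by linarith) T)
    rw [sub_sub_cancel] at hg
    obtain ⟨c₁, hc₁, h1⟩ := h.eventually_gramForm_coercive
      (f := fun T => range (breakIndex c T)) hc
      (h.tendsto_gramOp_range hc (tendsto_breakIndex_div hc))
    obtain ⟨c₂, hc₂, h2⟩ := h.eventually_gramForm_coercive
      (f := fun T => Ico (breakIndex (1 - c) T) T) hc hg
    obtain ⟨cP, hcP, hP⟩ := exists_slopes_coercive hR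
    refine ⟨min c₁ c₂ * cP, by positivity, ?_⟩
    filter_upwards [h1, h2, (tendsto_fst_inProb P).eventually (eventually_ge_atTop 1)]
      with i h1 h2 hi k hk u
    have hi' : (1 : ℝ) ≤ i.1 := by exact_mod_cast hi
    have hkle := le_of_mem_admissibleBreaks hk
    obtain ⟨τ, hτ, rfl⟩ := (mem_admissibleBreaks hsub).1 hk
    have hH0 : matrixOp H = 0 := by rw [hH]; exact map_zero _
    rw [hH0, add_zero, inner_rowGram inner_earlyRow (inner_lateRow R) hkle]
    have e1 := (h1 (earlySlope dx dz u)).trans (gramForm_mono _ (Finset.range_mono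
      (breakIndex_mono (mul_le_mul_of_nonneg_right (hcsub hτ).1 (Nat.cast_nonneg i.1)))) _)
    have e2 := (h2 (lateSlope R u)).trans (gramForm_mono _ (Finset.Ico_subset_Ico_left
      (breakIndex_mono (mul_le_mul_of_nonneg_right (hcsub hτ).2 (Nat.cast_nonneg i.1)))) _)
    have e3 : min c₁ c₂ * ‖earlySlope dx dz u‖ ^ 2 ≤ c₁ * i.1 * ‖earlySlope dx dz u‖ ^ 2 := by
      refine mul_le_mul_of_nonneg_right ((min_le_left _ _).trans ?_) (sq_nonneg _)
      exact le_mul_of_one_le_right hc₁.le hi'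
    have e4 : min c₁ c₂ * ‖lateSlope R u‖ ^ 2 ≤ c₂ * i.1 * ‖lateSlope R u‖ ^ 2 := by
      refine mul_le_mul_of_nonneg_right ((min_le_right _ _).trans ?_) (sq_nonneg _)
      exact le_mul_of_one_le_right hc₂.le hi'
    have e5 := mul_le_mul_of_nonneg_left (hP u) (le_min hc₁.le hc₂.le)
    linarith

end DGPAssumptions

end StructuralBreak
end

/-! ### Assembly of the theorem -/

open StructuralBreak in
theorem theorem2 {Ω : Type*} [MeasurableSpace Ω] (P : Measure Ω) [IsProbabilityMeasure P]
    {dx dz : ℕ}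
    -- the known matrix with `z_t = R' x_t`
    (R : Matrix (Fin dx) (Fin dz) ℝ) (hR : LinearIndependent ℝ R.col)
    -- covariates, errors and true parameters
    (x : ℕ → Ω → EuclideanSpace ℝ (Fin dx)) (ε : ℕ → Ω → ℝ)
    (β₀ : EuclideanSpace ℝ (Fin dx)) (δ₀ : EuclideanSpace ℝ (Fin dz))
    (σ₀ : ℝ) (hσ₀ : 0 < σ₀) (SigmaX : Matrix (Fin dx) (Fin dx) ℝ)
    (hdgp : DGPAssumptions P x ε δ₀ σ₀ SigmaX)
    -- the set of break locations, with the true one in its interior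
    (H₀ : Set ℝ) (hH₀ : MeasurableSet H₀) (hH₀_sub : H₀ ⊆ Set.Ioo 0 1)
    (τ₀ : ℝ) (hτ₀ : H₀ ∈ 𝓝 τ₀)
    -- the prior
    (m : EuclideanSpace ℝ (Fin dx ⊕ Fin dz))
    (H : Matrix (Fin dx ⊕ Fin dz) (Fin dx ⊕ Fin dz) ℝ) (a b : ℝ)
    (hprior : ConjugatePrior H a b H₀)
    (p : ℝ → ℝ) (hp : BreakPrior H₀ p τ₀)
    -- the responses `y_1, …, y_T`, for each `T`
    (Y : (T : ℕ) → Ω → Fin T → ℝ)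
    (hY : ∀ T ω, Y T ω = response R (fun t => x t ω) (fun t => ε t ω) (slope β₀ δ₀) τ₀ T)
    -- the least-squares estimators
    (τLS : ℕ → Ω → ℝ) (γLS : ℕ → Ω → EuclideanSpace ℝ (Fin dx ⊕ Fin dz))
    (hLS : ∀ T ω, IsLeastSquares R (fun t => x t ω) T (Y T ω) H₀ (τLS T ω) (γLS T ω)) :
    ∃ V : Matrix (Fin dx ⊕ Fin dz) (Fin dx ⊕ Fin dz) ℝ,
      (∀ i j, TendstoInMeasure P
        (fun (T : ℕ) ω => (T : ℝ)⁻¹ *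
          ((design R (fun t => x t ω) T τ₀).transpose * design R (fun t => x t ω) T τ₀) i j)
        atTop (fun _ => V i j)) ∧
      V.PosDef ∧
      TendstoInMeasure P
        (fun (T : ℕ) ω => tvDist
          (rescale T (γLS T ω) (posterior R (fun t => x t ω) T (Y T ω) m H a b H₀ p))
          (multivariateGaussian 0 (σ₀ ^ 2 • V⁻¹)))
        atTop (fun _ => 0) := by
  have hτ : τ₀ ∈ Set.Ioo 0 1 := hH₀_sub (mem_of_mem_nhds hτ₀)
  have hτmem : τ₀ ∈ H₀ := mem_of_mem_nhds hτ₀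
  set γ₀ := slope β₀ δ₀ with hγ₀
  have hreg := hdgp.regularSample hτ (jump_ne_zero hR β₀ hdgp.jump_ne_zero)
  obtain ⟨c, hc, hP⟩ := exists_slopes_coercive hR
  set Q := gramLimit (earlyRow dx dz) (lateRow R) (earlySlope dx dz) (lateSlope R)
    (τ₀ • matrixOp SigmaX) ((1 - τ₀) • matrixOp SigmaX) with hQ
  obtain ⟨V, hV⟩ := exists_matrixOp_eq Q
  have hgram := hreg.tendsto_rowGram_true inner_earlyRow (inner_lateRow R)
  have hentry : ∀ i j, Tendsto (fun s : ℕ × Ω => (s.1 : ℝ)⁻¹ *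
      ((design R (fun t => x t s.2) s.1 τ₀).transpose * design R (fun t => x t s.2) s.1 τ₀) i j)
      (inProb P) (𝓝 (V i j)) := by
    intro i j
    have hcont : Continuous fun A : EuclideanSpace ℝ (Fin dx ⊕ Fin dz) →L[ℝ]
        EuclideanSpace ℝ (Fin dx ⊕ Fin dz) =>
        inner ℝ (A (EuclideanSpace.single j 1)) (EuclideanSpace.single i (1 : ℝ)) := by fun_prop
    have h1 := (hcont.tendsto Q).comp hgram
    rw [← hV, matrixOp_apply_single] at h1
    refine h1.congr fun s => ?_
    rw [Function.comp_apply, smul_apply, real_inner_smul_left,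
      transpose_mul_design_apply]
  -- Entrywise limits of symmetric matrices; uniqueness of limits uses that `inProb P` is
  -- nontrivial.
  have hsymm : V.IsHermitian := by
    ext i j
    rw [Matrix.conjTranspose_apply, star_trivial]
    refine tendsto_nhds_unique ((hentry j i).congr fun s => ?_) (hentry i j)
    rw [← Matrix.transpose_apply (_ * _) i j, Matrix.transpose_mul, Matrix.transpose_transpose]
  obtain ⟨c', hc', hco⟩ := hreg.gramLimit_coercive inner_earlyRow (inner_lateRow R) hc hP
  have hVpos : V.PosDef := posDef_of_matrixOp_coercive hsymm hc' (by rw [hV]; exact hco)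
  refine ⟨V, fun i j => tendstoInMeasure_of_inProb (hentry i j), hVpos,
    tendstoInMeasure_of_inProb ?_⟩
  obtain ⟨μ, hμ, hcoer⟩ := hdgp.exists_precision_coercive hR hprior hH₀_sub hτmem
  obtain ⟨w, hw, hwt⟩ := hp.exists_le_breakWeight hτ₀ hH₀_sub
  have hexp : ∀ T : ℕ, (T : ℝ) / 2 ≤ posteriorExponent dx dz a T := fun T => by
    rw [posteriorExponent, add_assoc]
    linarith [hprior.exponent_nonneg]
  have hls : ∀ T ω, IsLeastSquares R (fun t => x t ω) T
      (response R (fun t => x t ω) (fun t => ε t ω) γ₀ τ₀ T) H₀ (τLS T ω) (γLS T ω) :=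
    fun T ω => hY T ω ▸ hLS T ω
  -- Minimality alone places the least-squares break near the true one, however ties are resolved.
  have hnear := hreg.near_of_rss_le inner_earlyRow (inner_lateRow R)
    (κ := fun i => breakIndex (τLS i.1 i.2) i.1) (γ := fun i => γLS i.1 i.2)
    (Eventually.of_forall fun i => breakIndex_le (hH₀_sub (hls i.1 i.2).1).2.le _)
    (Eventually.of_forall fun i => (hls i.1 i.2).rss_le hτmem)
  rw [Metric.tendsto_nhds]
  intro η hη
  have hαlim : Tendsto (fun i : ℕ × Ω => posteriorExponent dx dz a i.1 / (i.1 : ℝ)) (inProb P)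
      (𝓝 (1 / 2)) :=
    (tendsto_posteriorExponent_div dx dz a).comp (tendsto_fst_inProb P)
  have hwt' : ∀ᶠ i : ℕ × Ω in inProb P,
      w / (i.1 : ℝ) ≤ breakWeight H₀ p i.1 (breakIndex τ₀ i.1) :=
    (tendsto_fst_inProb P).eventually hwt
  have hmass := hreg.mixture_tendsto (Hop := matrixOp H) (m := m) (b := b)
    (dLS := fun i => γLS i.1 i.2 - γ₀) (κLS := fun i => breakIndex (τLS i.1 i.2) i.1)
    (α := fun i => posteriorExponent dx dz a i.1) (K := fun i => admissibleBreaks H₀ i.1)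
    (wt := fun i k => breakWeight H₀ p i.1 k) hσ₀ inner_earlyRow (inner_lateRow R) hc hP
    hprior.inner_comm hprior.inner_nonneg hprior.rate_nonneg
  have hmix := hmass hαlim
    (Eventually.of_forall fun i => hexp i.1)
    (Eventually.of_forall fun i k hk => le_of_mem_admissibleBreaks hk) hμ hcoer
    (Eventually.of_forall fun i => (mem_admissibleBreaks hH₀_sub).2 ⟨τ₀, hτmem, rfl⟩)
    (fun i k => breakWeight_nonneg H₀ p i.1 k)
    (Eventually.of_forall fun i => hp.sum_breakWeight hH₀ hH₀_sub i.1) hw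
    hwt' hnear
    (Eventually.of_forall fun i => (hls i.1 i.2).rowGram_eq) (half_pos hη)
  filter_upwards [hmix, (tendsto_fst_inProb P).eventually (eventually_gt_atTop 0)] with i hi hpos
  obtain ⟨-, hpi, hS⟩ := hi
  have hT : (0 : ℝ) < i.1 := by exact_mod_cast hpos
  have hα : 0 < posteriorExponent dx dz a i.1 := lt_of_lt_of_le (by positivity) (hexp i.1)
  have hbound : tvDist
      (rescale i.1 (γLS i.1 i.2) (posterior R (fun t => x t i.2) i.1 (Y i.1 i.2) m H a b H₀ p))
      (multivariateGaussian 0 (σ₀ ^ 2 • V⁻¹)) ≤ η / 2 := by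
    -- `hS` holds for all measurable sets on one event, so the supremum is bounded there.
    refine ciSup_le fun A => ?_
    have h1 := hS A.1 A.2
    rw [hY, rescale_posterior_real R _ _ _ m i.1 τ₀ H a b hp hH₀ hH₀_sub hα
      (fun k hk => (hpi k hk).1) (fun k hk => (hpi k hk).2) _ A.2,
      multivariateGaussian_real_eq hVpos hσ₀ A.1 A.2]
    rw [add_sub_cancel, ← hQ, ← hV] at h1
    exact h1
  have hnonneg : 0 ≤ tvDist
      (rescale i.1 (γLS i.1 i.2) (posterior R (fun t => x t i.2) i.1 (Y i.1 i.2) m H a b H₀ p))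
      (multivariateGaussian 0 (σ₀ ^ 2 • V⁻¹)) := Real.iSup_nonneg fun _ => abs_nonneg _
  rw [Real.dist_eq, sub_zero, abs_of_nonneg hnonneg]
  linarith
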